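/- Let $N\in\mathbb{N}$ and let $T_-,T_+$ be orthogonal projectors in $\mathbb{C}^N$, $T_\pm^\perp=I-T_\pm$. Put $$E^{DD}=\operatorname{Ran}T_-\cap\operatorname{Ran}T_+,\quad E^{ND}=\operatorname{Ran}T_-^\perp\cap\operatorname{Ran}T_+,\quad E^{DN}=\operatorname{Ran}T_-\cap\operatorname{Ran}T_+^\perp,\quad E^{NN}=\operatorname{Ran}T_-^\perp\cap\operatorname{Ran}T_+^\perp .$$ For subspaces $E_1,E_2$ of equal dimension with orthogonal projectors $P_1,P_2$, write $\angle(E_1,E_2)=\gamma\in(0,\frac{\pi}{2})$ if $\|P_2x\|=\cos\gamma\,\|x\|$ for all $x\in E_1$ and $\|P_1x\|=\cos\gamma\,\|x\|$ for all $x\in E_2$. There is an orthogonal decomposition $$\mathbb{C}^N=E^{DD}\oplus E^{ND}\oplus E^{DN}\oplus E^{NN}\oplus\bigoplus_{i=1}^kE^{[\gamma_i]},\qquad 0<\gamma_1<\dots<\gamma_k<\tfrac{\pi}{2},$$ with $E^{[\gamma_i]}\neq\{0\}$, $E^{[\gamma_i]}=E^{[\gamma_i]}_-+E^{[\gamma_i]}_+$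 and $\angle(E^{[\gamma_i]}_-,E^{[\gamma_i]}_+)=\gamma_i$, where $E^{[\gamma_i]}_\pm=E^{[\gamma_i]}\cap\operatorname{Ran}T_\pm$. For every such decomposition put $N^{DD}=\dim E^{DD}$, $N^{ND}=\dim E^{ND}$, $N^{DN}=\dim E^{DN}$, $N^{NN}=\dim E^{NN}$ and $N^{[\gamma_i]}=\dim E^{[\gamma_i]}_-=\dim E^{[\gamma_i]}_+$. For $V=V^*\in L^1([0,1];\mathbb{C}^{N\times N})$ and self-adjoint $a=T_-^\perp aT_-^\perp$, $b=T_+^\perp bT_+^\perp$, consider the self-adjoint operator $L\psi=-\psi''+V\psi$ in $L^2([0,1];\mathbb{C}^N)$ with the boundary conditions $$T_-^\perp(\psi'(0)-a\psi(0))-T_-\psi(0)=0,\qquad T_+^\perp(\psi'(1)+b\psi(1))-T_+\psi(1)=0 .$$ Then for every $R$ there exist an integer $n^\bullet\ge1$ and a constant $\varpi\ge0$ such that, for all such $V,a,b$ with $\int_0^1\|V(x)\|\,dx\le R$, $\|a\|\le R$, $\|b\|\le R$ (operator norms) and all $n\ge n^\bullet$, the operator $L$ has, counting multiplicities, exactly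 - $nN+N^{NN}$ eigenvalues in $(-\infty,\ \pi^2n^2+\varpi)$; - $N^{NN}+N^{DD}$ eigenvalues in $(\pi^2n^2-\varpi,\ \pi^2n^2+\varpi)$; - $N^{ND}+N^{DN}$ eigenvalues in $(\pi^2(n+\frac12)^2-\varpi,\ \pi^2(n+\frac12)^2+\varpi)$; - $N^{[\gamma_i]}$ eigenvalues in each of the two intervals $((\pi n\pm\gamma_i)^2-\varpi,\ (\pi n\pm\gamma_i)^2+\varpi)$, $i=1,\dots,k$. -/

import Mathlib

open MeasureTheory Set
open scoped Real ENNReal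

noncomputable section

/-- The Euclidean (Hermitian) space `ℂ^N`. -/
abbrev CVec (N : ℕ) : Type := EuclideanSpace ℂ (Fin N)

/-- Linear operators on `ℂ^N` (complex `N × N` matrices), with the operator norm. -/
abbrev COp (N : ℕ) : Type := CVec N →L[ℂ] CVec N

/-- The Hilbert space `L²([0,1]; ℂ^N)`. -/
abbrev L2Vec (N : ℕ) : Type := Lp (CVec N) 2 (volume.restrict (Icc (0 : ℝ) 1))

/-- The range of an operator, as a subspace of `ℂ^N`. -/
def opRange {N : ℕ} (T : COp N) : Submodule ℂ (CVec N) :=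
  LinearMap.range (T : CVec N →ₗ[ℂ] CVec N)

/-! ### Geometry of two orthogonal projectors -/

/-- `∠(E₁, E₂) = γ ∈ (0, π/2)` for two subspaces of the same dimension. -/
structure HasAngle {N : ℕ} (E₁ E₂ : Submodule ℂ (CVec N)) (γ : ℝ) : Prop where
  finrank_eq : Module.finrank ℂ E₁ = Module.finrank ℂ E₂
  pos : 0 < γ
  lt : γ < π / 2
  left : ∀ x ∈ E₁, ‖E₂.starProjection x‖ = Real.cos γ * ‖x‖
  right : ∀ x ∈ E₂, ‖E₁.starProjection x‖ = Real.cos γ * ‖x‖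

/-- `E^{DD} = Ran T₋ ∩ Ran T₊`. -/
def spaceDD {N : ℕ} (Tm Tp : COp N) : Submodule ℂ (CVec N) := opRange Tm ⊓ opRange Tp

/-- `E^{ND} = Ran T₋^⊥ ∩ Ran T₊`. -/
def spaceND {N : ℕ} (Tm Tp : COp N) : Submodule ℂ (CVec N) := opRange (1 - Tm) ⊓ opRange Tp

/-- `E^{DN} = Ran T₋ ∩ Ran T₊^⊥`. -/
def spaceDN {N : ℕ} (Tm Tp : COp N) : Submodule ℂ (CVec N) := opRange Tm ⊓ opRange (1 - Tp)

/-- `E^{NN} = Ran T₋^⊥ ∩ Ran T₊^⊥`. -/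
def spaceNN {N : ℕ} (Tm Tp : COp N) : Submodule ℂ (CVec N) :=
  opRange (1 - Tm) ⊓ opRange (1 - Tp)

/-- The family consisting of `E^{DD}, E^{ND}, E^{DN}, E^{NN}` and `E^{[γ₁]}, …, E^{[γ_k]}`. -/
def decompositionFamily {N : ℕ} (Tm Tp : COp N) {k : ℕ} (F : Fin k → Submodule ℂ (CVec N)) :
    Fin 4 ⊕ Fin k → Submodule ℂ (CVec N) :=
  Sum.elim ![spaceDD Tm Tp, spaceND Tm Tp, spaceDN Tm Tp, spaceNN Tm Tp] F

/-- The orthogonal decomposition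
`ℂ^N = E^{DD} ⊕ E^{ND} ⊕ E^{DN} ⊕ E^{NN} ⊕ ⨁ᵢ E^{[γᵢ]}` attached to `T₋, T₊`, where
`0 < γ₁ < … < γ_k < π/2`, `E^{[γᵢ]} ≠ 0` and, with `E^{[γᵢ]}_± = E^{[γᵢ]} ∩ Ran T_±`,
`E^{[γᵢ]} = E^{[γᵢ]}_- + E^{[γᵢ]}_+` and `∠(E^{[γᵢ]}_-, E^{[γᵢ]}_+) = γᵢ`. -/
structure IsAngleDecomposition {N : ℕ} (Tm Tp : COp N) {k : ℕ} (γ : Fin k → ℝ)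
    (F : Fin k → Submodule ℂ (CVec N)) : Prop where
  strictMono : StrictMono γ
  ne_bot : ∀ i, F i ≠ ⊥
  eq_sup : ∀ i, F i = (F i ⊓ opRange Tm) ⊔ (F i ⊓ opRange Tp)
  angle : ∀ i, HasAngle (F i ⊓ opRange Tm) (F i ⊓ opRange Tp) (γ i)
  orthogonal : Pairwise fun i j => decompositionFamily Tm Tp F i ⟂ decompositionFamily Tm Tp F j
  iSup_eq_top : ⨆ i, decompositionFamily Tm Tp F i = ⊤

/-! ### The Sturm-Liouville operator -/

/-- On `[0,1]` the function `ψ` is continuously differentiable with derivative `φ`, and `φ` is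
absolutely continuous with almost everywhere derivative `χ`. -/
structure HasSecondDeriv {N : ℕ} (ψ φ χ : ℝ → CVec N) : Prop where
  integrable : IntegrableOn χ (Icc 0 1)
  deriv_eq : ∀ x ∈ Icc (0 : ℝ) 1, φ x = φ 0 + ∫ t in (0 : ℝ)..x, χ t
  eq : ∀ x ∈ Icc (0 : ℝ) 1, ψ x = ψ 0 + ∫ t in (0 : ℝ)..x, φ t

/-- `T₋^⊥ (ψ'(0) - a ψ(0)) - T₋ ψ(0)`, where `u = ψ(0)` and `u' = ψ'(0)`. -/
def boundaryMinus {N : ℕ} (Tm a : COp N) (u u' : CVec N) : CVec N :=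
  (1 - Tm) (u' - a u) - Tm u

/-- `T₊^⊥ (ψ'(1) + b ψ(1)) - T₊ ψ(1)`, where `u = ψ(1)` and `u' = ψ'(1)`. -/
def boundaryPlus {N : ℕ} (Tp b : COp N) (u u' : CVec N) : CVec N :=
  (1 - Tp) (u' + b u) - Tp u

theorem HasSecondDeriv.continuousOn_deriv {N : ℕ} {ψ φ χ : ℝ → CVec N}
    (h : HasSecondDeriv ψ φ χ) : ContinuousOn φ (Icc 0 1) := by
  have h1 : ContinuousOn (fun x => φ 0 + ∫ t in (0 : ℝ)..x, χ t) (Icc 0 1) := by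
    refine continuousOn_const.add ?_
    have := intervalIntegral.continuousOn_primitive_interval (μ := volume) (f := χ)
      (a := 0) (b := 1) (by rw [uIcc_of_le zero_le_one]; exact h.integrable)
    rwa [uIcc_of_le zero_le_one] at this
  exact h1.congr h.deriv_eq

theorem HasSecondDeriv.intervalIntegrable {N : ℕ} {f : ℝ → CVec N}
    (h : IntegrableOn f (Icc 0 1)) {x : ℝ} (hx : x ∈ Icc (0 : ℝ) 1) :
    IntervalIntegrable f volume 0 x := by
  rw [intervalIntegrable_iff_integrableOn_Ioc_of_le hx.1]
  exact h.mono_set (Ioc_subset_Icc_self.trans (Icc_subset_Icc_right hx.2))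

theorem HasSecondDeriv.add {N : ℕ} {ψ₁ φ₁ χ₁ ψ₂ φ₂ χ₂ : ℝ → CVec N}
    (h₁ : HasSecondDeriv ψ₁ φ₁ χ₁) (h₂ : HasSecondDeriv ψ₂ φ₂ χ₂) :
    HasSecondDeriv (fun x => ψ₁ x + ψ₂ x) (fun x => φ₁ x + φ₂ x) (fun x => χ₁ x + χ₂ x) where
  integrable := h₁.integrable.add h₂.integrable
  deriv_eq x hx := by
    rw [intervalIntegral.integral_add (intervalIntegrable h₁.integrable hx)
      (intervalIntegrable h₂.integrable hx)]
    simp only [h₁.deriv_eq x hx, h₂.deriv_eq x hx]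
    abel
  eq x hx := by
    rw [intervalIntegral.integral_add
      (intervalIntegrable (h₁.continuousOn_deriv.integrableOn_Icc) hx)
      (intervalIntegrable (h₂.continuousOn_deriv.integrableOn_Icc) hx)]
    simp only [h₁.eq x hx, h₂.eq x hx]
    abel

theorem HasSecondDeriv.smul {N : ℕ} {ψ φ χ : ℝ → CVec N} (c : ℂ) (h : HasSecondDeriv ψ φ χ) :
    HasSecondDeriv (fun x => c • ψ x) (fun x => c • φ x) (fun x => c • χ x) where
  integrable := Integrable.smul c h.integrable
  deriv_eq x hx := by
    rw [intervalIntegral.integral_smul, ← smul_add, ← h.deriv_eq x hx]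
  eq x hx := by
    rw [intervalIntegral.integral_smul, ← smul_add, ← h.eq x hx]

/-- The graph of the self-adjoint operator `L ψ = -ψ'' + V ψ` in `L²([0,1]; ℂ^N)` with the
separated boundary conditions given by `T₋, a, T₊, b`: the pairs `(ψ, L ψ)`, where `ψ` and `ψ'`
are absolutely continuous on `[0,1]`, `-ψ'' + V ψ` is in `L²` and the boundary conditions hold. -/
def sturmLiouvilleGraph {N : ℕ} (Tm Tp a b : COp N) (V : ℝ → COp N) :
    Submodule ℂ (L2Vec N × L2Vec N) where
  carrier := {p | ∃ ψ φ χ : ℝ → CVec N, HasSecondDeriv ψ φ χ ∧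
    boundaryMinus Tm a (ψ 0) (φ 0) = 0 ∧ boundaryPlus Tp b (ψ 1) (φ 1) = 0 ∧
    (∀ᵐ x ∂(volume.restrict (Icc (0 : ℝ) 1)), p.1 x = ψ x) ∧
    (∀ᵐ x ∂(volume.restrict (Icc (0 : ℝ) 1)), p.2 x = -χ x + V x (ψ x))}
  zero_mem' := by
    refine ⟨fun _ => 0, fun _ => 0, fun _ => 0, ⟨by simp, by simp, by simp⟩,
      by simp [boundaryMinus], by simp [boundaryPlus], ?_, ?_⟩
    · filter_upwards [Lp.coeFn_zero (CVec N) 2 (volume.restrict (Icc (0 : ℝ) 1))] with x hx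
      simpa using hx
    · filter_upwards [Lp.coeFn_zero (CVec N) 2 (volume.restrict (Icc (0 : ℝ) 1))] with x hx
      simpa using hx
  add_mem' := by
    rintro p q ⟨ψ₁, φ₁, χ₁, h₁, m₁, p₁, e₁, f₁⟩ ⟨ψ₂, φ₂, χ₂, h₂, m₂, p₂, e₂, f₂⟩
    refine ⟨_, _, _, h₁.add h₂, ?_, ?_, ?_, ?_⟩
    · have : boundaryMinus Tm a (ψ₁ 0 + ψ₂ 0) (φ₁ 0 + φ₂ 0)
          = boundaryMinus Tm a (ψ₁ 0) (φ₁ 0) + boundaryMinus Tm a (ψ₂ 0) (φ₂ 0) := by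
        simp only [boundaryMinus, map_add, map_sub]; abel
      rw [this, m₁, m₂, add_zero]
    · have : boundaryPlus Tp b (ψ₁ 1 + ψ₂ 1) (φ₁ 1 + φ₂ 1)
          = boundaryPlus Tp b (ψ₁ 1) (φ₁ 1) + boundaryPlus Tp b (ψ₂ 1) (φ₂ 1) := by
        simp only [boundaryPlus, map_add]; abel
      rw [this, p₁, p₂, add_zero]
    · filter_upwards [Lp.coeFn_add p.1 q.1, e₁, e₂] with x hx h1 h2
      simp only [Prod.fst_add, hx, Pi.add_apply, h1, h2]
    · filter_upwards [Lp.coeFn_add p.2 q.2, f₁, f₂] with x hx h1 h2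
      simp only [Prod.snd_add, hx, Pi.add_apply, h1, h2, map_add]
      abel
  smul_mem' := by
    rintro c p ⟨ψ, φ, χ, h, m, p', e, f⟩
    refine ⟨_, _, _, h.smul c, ?_, ?_, ?_, ?_⟩
    · have : boundaryMinus Tm a (c • ψ 0) (c • φ 0) = c • boundaryMinus Tm a (ψ 0) (φ 0) := by
        simp only [boundaryMinus, map_smul, smul_sub, map_sub]
      rw [this, m, smul_zero]
    · have : boundaryPlus Tp b (c • ψ 1) (c • φ 1) = c • boundaryPlus Tp b (ψ 1) (φ 1) := by
        simp only [boundaryPlus, map_smul, smul_sub, smul_add, map_add]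
      rw [this, p', smul_zero]
    · filter_upwards [Lp.coeFn_smul c p.1, e] with x hx h1
      simp only [Prod.smul_fst, hx, Pi.smul_apply, h1]
    · filter_upwards [Lp.coeFn_smul c p.2, f] with x hx h1
      simp only [Prod.smul_snd, hx, Pi.smul_apply, h1, map_smul, smul_add, smul_neg]

/-- The eigenspace `{f ∈ L²([0,1]; ℂ^N) : f ∈ dom L, L f = μ f}`. -/
def sturmLiouvilleEigenspace {N : ℕ} (Tm Tp a b : COp N) (V : ℝ → COp N) (μ : ℝ) :
    Submodule ℂ (L2Vec N) :=
  (sturmLiouvilleGraph Tm Tp a b V).comap (LinearMap.id.prod ((μ : ℂ) • LinearMap.id))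

/-- The operator `L` has exactly `m` eigenvalues in `I`, counted with multiplicities: the
eigenvalues in `I` form a finite set, their eigenspaces are finite dimensional, and the dimensions
of these add up to `m`. -/
def HasEigenvalueCount {N : ℕ} (Tm Tp a b : COp N) (V : ℝ → COp N) (I : Set ℝ) (m : ℕ) : Prop :=
  ∃ S : Finset ℝ,
    (∀ μ, μ ∈ S ↔ μ ∈ I ∧ sturmLiouvilleEigenspace Tm Tp a b V μ ≠ ⊥) ∧
    (∀ μ ∈ S, FiniteDimensional ℂ (sturmLiouvilleEigenspace Tm Tp a b V μ)) ∧
    ∑ μ ∈ S, Module.finrank ℂ (sturmLiouvilleEigenspace Tm Tp a b V μ) = m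

/-- The open interval `(c - r, c + r)`. -/
abbrev intervalAround (c r : ℝ) : Set ℝ := Ioo (c - r) (c + r)

end

/-! ### Calculus of absolutely continuous functions on `[0,1]`. -/

section

/-! For `V = a = b = 0` the spectrum is explicit. A solution of frequency `κ > 0` obeying the left
condition is `cos(κx) T₋^⊥ v + sin(κx) T₋ v`, and the right condition then reads `boundaryOp Tm Tp κ
v = 0`. The operator `(T₋ + T₊ - 1)²` commutes with both projectors; its eigenspace for `1` is
`E^{DD} ⊕ E^{NN}`, for `0` it is `E^{ND} ⊕ E^{DN}`, and for `cos² γ` it is `E^{[γ]}`. On the first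
four spaces `boundaryOp` is `± sin κ` or `cos κ`; on `E^{[γ]}` it divides `cos² κ - cos² γ`, and its
kernel at a zero of this function has dimension `N^{[γ]}`. So the free frequencies are the zeros of
`sin κ`, of `cos κ` and of `cos² κ - cos² γᵢ`; each period of length `π` carries total multiplicity
`N`, and the constants in `E^{NN}` add the eigenvalue `0`.

The data `V, a, b` matter only to order `κ⁻¹`: by variation of constants the amplitudes of cosine
and sine move by `O(κ⁻¹)` on `[0,1]`. The functions above have simple zeros, so `boundaryOp` is
bounded below by a multiple of the distance to a free frequency `f`. If `κ² = f² ± ϖ`, this distance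
is about `ϖ / (2f)`, and a large `ϖ`, independent of `f`, makes the lower bound beat the
perturbation. Such `κ` are gaps (`IsGapFrequency`): for all data of size at most `R`, `κ²` is not an
eigenvalue, and `L - κ²` has a compact symmetric inverse with uniform bounds
(`IsSLSolution.norm_le`, `exists_isSLSolution`).

The number of eigenvalues below a gap is constant along the homotopy `t (V, a, b)`, `0 ≤ t ≤ 1`
(`exists_hasEigenvalueCount_gap`). It equals the dimension of the negative spectral subspace of the
inverse. The negative eigenvalues of the inverse keep a distance from `0`, because `L` is bounded
below uniformly (`IsSLSolution.energy_le`), and by Green's identity its quadratic form is Lipschitz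
in `t`; hence the dimension cannot change in a short step (`finrank_spectralSpan_le`). Counts below
gaps are therefore those of the free operator, and counts in windows are differences of two of them.
-/

/-- On `[0,1]` the function `F` is absolutely continuous with almost everywhere derivative `f`. -/
structure IsPrimitive {E : Type*} [NormedAddCommGroup E] [NormedSpace ℝ E] (F f : ℝ → E) :
    Prop where
  integrable : IntegrableOn f (Icc 0 1)
  eq : ∀ x ∈ Icc (0 : ℝ) 1, F x = F 0 + ∫ t in (0 : ℝ)..x, f t

namespace IsPrimitive

set_option linter.unusedSectionVars false

variable {E F G : Type*} [NormedAddCommGroup E] [NormedSpace ℝ E]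
  [NormedAddCommGroup F] [NormedSpace ℝ F] [NormedAddCommGroup G] [NormedSpace ℝ G]

theorem intervalIntegrable_of {f : ℝ → E} (h : IntegrableOn f (Icc 0 1)) {x y : ℝ}
    (hx : x ∈ Icc (0 : ℝ) 1) (hy : y ∈ Icc (0 : ℝ) 1) : IntervalIntegrable f volume x y := by
  rw [intervalIntegrable_iff]
  refine h.mono_set (uIoc_subset_uIcc.trans ?_)
  exact uIcc_subset_Icc hx hy

theorem continuousOn {u u' : ℝ → E} (h : IsPrimitive u u') : ContinuousOn u (Icc 0 1) := by
  have h1 : ContinuousOn (fun x => u 0 + ∫ t in (0 : ℝ)..x, u' t) (Icc 0 1) := by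
    refine continuousOn_const.add ?_
    have := intervalIntegral.continuousOn_primitive_interval (μ := volume) (f := u')
      (a := 0) (b := 1) (by rw [uIcc_of_le zero_le_one]; exact h.integrable)
    rwa [uIcc_of_le zero_le_one] at this
  exact h1.congr h.eq

theorem sub_eq {u u' : ℝ → E} (h : IsPrimitive u u') {x y : ℝ}
    (hx : x ∈ Icc (0 : ℝ) 1) (hy : y ∈ Icc (0 : ℝ) 1) : u y - u x = ∫ t in x..y, u' t := by
  have h0 : (0 : ℝ) ∈ Icc (0 : ℝ) 1 := by simp
  rw [h.eq x hx, h.eq y hy, add_sub_add_left_eq_sub,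
    intervalIntegral.integral_interval_sub_left (intervalIntegrable_of h.integrable h0 hy)
      (intervalIntegrable_of h.integrable h0 hx)]

theorem absolutelyContinuousOnInterval_of_dist_le {u : ℝ → E} {g : ℝ → ℝ}
    (hg : AbsolutelyContinuousOnInterval g 0 1)
    (h : ∀ x ∈ Icc (0 : ℝ) 1, ∀ y ∈ Icc (0 : ℝ) 1, dist (u x) (u y) ≤ dist (g x) (g y)) :
    AbsolutelyContinuousOnInterval u 0 1 := by
  rw [absolutelyContinuousOnInterval_iff] at hg ⊢
  intro ε hε
  obtain ⟨δ, hδ, H⟩ := hg ε hε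
  refine ⟨δ, hδ, fun I hI hd => lt_of_le_of_lt (Finset.sum_le_sum fun i hi => ?_) (H I hI hd)⟩
  have := hI.1 i hi
  rw [uIcc_of_le zero_le_one] at this
  exact h _ this.1 _ this.2

/-- The primitive of `m` is absolutely continuous, and its increments dominate those of `u`. -/
theorem absolutelyContinuousOnInterval_of_norm_sub_le {u : ℝ → E} {m : ℝ → ℝ}
    (hm : IntegrableOn m (Icc 0 1))
    (h : ∀ x ∈ Icc (0 : ℝ) 1, ∀ y ∈ Icc (0 : ℝ) 1, x ≤ y → ‖u y - u x‖ ≤ ∫ t in x..y, m t) :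
    AbsolutelyContinuousOnInterval u 0 1 := by
  have h0 : (0 : ℝ) ∈ Icc (0 : ℝ) 1 := by simp
  have h1 : (1 : ℝ) ∈ Icc (0 : ℝ) 1 := by simp
  have hac := (intervalIntegrable_of hm h0 h1).absolutelyContinuousOnInterval_intervalIntegral
    (c := 0) (by simp)
  refine absolutelyContinuousOnInterval_of_dist_le hac ?_
  have key : ∀ x ∈ Icc (0 : ℝ) 1, ∀ y ∈ Icc (0 : ℝ) 1, x ≤ y →
      dist (u x) (u y) ≤ dist (∫ t in (0 : ℝ)..x, m t) (∫ t in (0 : ℝ)..y, m t) := by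
    intro x hx y hy hxy
    rw [dist_comm, dist_eq_norm, dist_comm, dist_eq_norm,
      intervalIntegral.integral_interval_sub_left (intervalIntegrable_of hm h0 hy)
      (intervalIntegrable_of hm h0 hx)]
    exact (h x hx y hy hxy).trans (le_abs_self _)
  intro x hx y hy
  rcases le_total x y with hxy | hxy
  · exact key x hx y hy hxy
  · rw [dist_comm, dist_comm (∫ t in (0 : ℝ)..x, m t)]
    exact key y hy x hx hxy

theorem norm_sub_le {u u' : ℝ → E} (h : IsPrimitive u u') {x y : ℝ}
    (hx : x ∈ Icc (0 : ℝ) 1) (hy : y ∈ Icc (0 : ℝ) 1) (hxy : x ≤ y) :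
    ‖u y - u x‖ ≤ ∫ t in x..y, ‖u' t‖ := by
  rw [h.sub_eq hx hy]
  exact intervalIntegral.norm_integral_le_integral_norm hxy

theorem absolutelyContinuousOnInterval {u u' : ℝ → E} (h : IsPrimitive u u') :
    AbsolutelyContinuousOnInterval u 0 1 :=
  absolutelyContinuousOnInterval_of_norm_sub_le h.integrable.norm
    fun _ hx _ hy hxy => h.norm_sub_le hx hy hxy

theorem of_integrable [CompleteSpace E] {f : ℝ → E} (c : E) (h : IntegrableOn f (Icc 0 1)) :
    IsPrimitive (fun x => c + ∫ t in (0 : ℝ)..x, f t) f :=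
  ⟨h, fun x _ => by simp⟩

theorem ae_hasDerivAt [CompleteSpace E] {u u' : ℝ → E} (h : IsPrimitive u u') :
    ∀ᵐ x, x ∈ Ioo (0 : ℝ) 1 → HasDerivAt u (u' x) x := by
  have h0 : (0 : ℝ) ∈ Icc (0 : ℝ) 1 := by simp
  have h1 : (1 : ℝ) ∈ Icc (0 : ℝ) 1 := by simp
  filter_upwards [(intervalIntegrable_of h.integrable h0 h1).ae_hasDerivAt_integral] with x hx hx'
  have := hx (by rw [uIcc_of_le zero_le_one]; exact Ioo_subset_Icc_self hx') 0 (by simp)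
  refine (this.const_add (u 0)).congr_of_eventuallyEq ?_
  filter_upwards [Ioo_mem_nhds hx'.1 hx'.2] with y hy
  exact h.eq y (Ioo_subset_Icc_self hy)

/-- The increments of the product are dominated by integrals of an `L¹` function, so the product is
absolutely continuous. Its difference with the primitive of the expected derivative is absolutely
continuous with zero derivative almost everywhere, hence constant. -/
theorem bilin [CompleteSpace E] [CompleteSpace F] [CompleteSpace G] (B : E →L[ℝ] F →L[ℝ] G)
    {u u' : ℝ → E} {v v' : ℝ → F} (hu : IsPrimitive u u') (hv : IsPrimitive v v') :
    IsPrimitive (fun x => B (u x) (v x)) (fun x => B (u' x) (v x) + B (u x) (v' x)) := by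
  obtain ⟨C, hC⟩ := isCompact_Icc.exists_bound_of_continuousOn hu.continuousOn
  obtain ⟨D, hD⟩ := isCompact_Icc.exists_bound_of_continuousOn hv.continuousOn
  have h0 : (0 : ℝ) ∈ Icc (0 : ℝ) 1 := by simp
  have hC0 : 0 ≤ C := (norm_nonneg _).trans (hC 0 h0)
  have hD0 : 0 ≤ D := (norm_nonneg _).trans (hD 0 h0)
  have hi1 : IntegrableOn (fun x => B (u' x) (v x)) (Icc 0 1) := by
    refine Integrable.mono' ((hu.integrable.norm.const_mul ‖B‖).mul_const D) ?_ ?_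
    · exact B.aestronglyMeasurable_comp₂ hu.integrable.aestronglyMeasurable
        (hv.continuousOn.aestronglyMeasurable measurableSet_Icc)
    · filter_upwards [ae_restrict_mem measurableSet_Icc] with x hx
      refine (B.le_opNorm₂ _ _).trans ?_
      gcongr
      exact hD x hx
  have hi2 : IntegrableOn (fun x => B (u x) (v' x)) (Icc 0 1) := by
    refine Integrable.mono' (hv.integrable.norm.const_mul (‖B‖ * C)) ?_ ?_
    · exact B.aestronglyMeasurable_comp₂
        (hu.continuousOn.aestronglyMeasurable measurableSet_Icc) hv.integrable.aestronglyMeasurable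
    · filter_upwards [ae_restrict_mem measurableSet_Icc] with x hx
      refine (B.le_opNorm₂ _ _).trans ?_
      gcongr
      exact hC x hx
  have hi := hi1.add hi2
  refine ⟨hi, ?_⟩
  have hac1 : AbsolutelyContinuousOnInterval (fun x => B (u x) (v x)) 0 1 := by
    have hm1 := hu.integrable.norm.const_mul (‖B‖ * D)
    have hm2 := hv.integrable.norm.const_mul (‖B‖ * C)
    refine absolutelyContinuousOnInterval_of_norm_sub_le (hm1.add hm2) ?_
    intro x hx y hy hxy
    have e : B (u y) (v y) - B (u x) (v x) = B (u y - u x) (v y) + B (u x) (v y - v x) := by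
      simp
    have hi3 : ∫ t in x..y, (‖B‖ * D * ‖u' t‖ + ‖B‖ * C * ‖v' t‖)
        = ‖B‖ * D * (∫ t in x..y, ‖u' t‖) + ‖B‖ * C * ∫ t in x..y, ‖v' t‖ := by
      rw [intervalIntegral.integral_add (intervalIntegrable_of hm1 hx hy)
        (intervalIntegrable_of hm2 hx hy), intervalIntegral.integral_const_mul,
        intervalIntegral.integral_const_mul]
    simp only [Pi.add_apply]
    rw [hi3, e]
    refine (norm_add_le _ _).trans (add_le_add ?_ ?_)
    · calc _ ≤ ‖B‖ * ‖u y - u x‖ * ‖v y‖ := B.le_opNorm₂ _ _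
        _ ≤ ‖B‖ * (∫ t in x..y, ‖u' t‖) * D := by
          have := hu.norm_sub_le hx hy hxy
          gcongr
          · exact mul_nonneg (by positivity) ((norm_nonneg _).trans this)
          · exact hD y hy
        _ = _ := by ring
    · calc _ ≤ ‖B‖ * ‖u x‖ * ‖v y - v x‖ := B.le_opNorm₂ _ _
        _ ≤ ‖B‖ * C * (∫ t in x..y, ‖v' t‖) := by
          have := hv.norm_sub_le hx hy hxy
          gcongr
          exact hC x hx
  have hp := of_integrable 0 hi
  have hac2 := hp.absolutelyContinuousOnInterval
  obtain ⟨c, hc⟩ := (hac1.sub hac2).const_of_ae_hasDerivAt_zero (by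
    have h₁ : ∀ᵐ x : ℝ, x ≠ 0 := by simp [ae_iff, measure_singleton]
    have h₂ : ∀ᵐ x : ℝ, x ≠ 1 := by simp [ae_iff, measure_singleton]
    filter_upwards [hu.ae_hasDerivAt, hv.ae_hasDerivAt, hp.ae_hasDerivAt, h₁, h₂]
      with x hx1 hx2 hx3 hx4 hx5 hx
    rw [uIcc_of_le zero_le_one] at hx
    have hx' : x ∈ Ioo (0 : ℝ) 1 := ⟨lt_of_le_of_ne hx.1 hx4.symm, lt_of_le_of_ne hx.2 hx5⟩
    have hd := (B.hasFDerivAt_of_bilinear (hx1 hx').hasFDerivAt (hx2 hx').hasFDerivAt).hasDerivAt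
    refine (hd.sub (hx3 hx')).congr_deriv ?_
    simp [add_comm])
  rw [uIcc_of_le zero_le_one] at hc
  intro x hx
  have e1 := hc x hx
  have e2 := hc 0 h0
  simp only [Pi.sub_apply, zero_add, intervalIntegral.integral_same, sub_zero] at e1 e2
  rw [← e2] at e1
  simpa [sub_eq_iff_eq_add] using e1

theorem add {u u' v v' : ℝ → E} (hu : IsPrimitive u u') (hv : IsPrimitive v v') :
    IsPrimitive (fun x => u x + v x) (fun x => u' x + v' x) := by
  have h0 : (0 : ℝ) ∈ Icc (0 : ℝ) 1 := by simp
  refine ⟨hu.integrable.add hv.integrable, fun x hx => ?_⟩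
  rw [intervalIntegral.integral_add (intervalIntegrable_of hu.integrable h0 hx)
    (intervalIntegrable_of hv.integrable h0 hx), hu.eq x hx, hv.eq x hx]
  abel

theorem congr {u u' v v' : ℝ → E} (hu : IsPrimitive u u') (h : ∀ x ∈ Icc (0 : ℝ) 1, v x = u x)
    (h' : ∀ᵐ x ∂(volume.restrict (Icc (0 : ℝ) 1)), v' x = u' x) : IsPrimitive v v' := by
  have h0 : (0 : ℝ) ∈ Icc (0 : ℝ) 1 := by simp
  refine ⟨hu.integrable.congr (Filter.EventuallyEq.symm h'), fun x hx => ?_⟩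
  rw [h x hx, h 0 h0, hu.eq x hx]
  congr 1
  refine intervalIntegral.integral_congr_ae ?_
  rw [ae_restrict_iff' measurableSet_Icc] at h'
  filter_upwards [h'] with t ht ht'
  rw [uIoc_of_le hx.1] at ht'
  exact (ht ⟨ht'.1.le, ht'.2.trans hx.2⟩).symm

theorem of_hasDerivAt [CompleteSpace E] {u u' : ℝ → E} (h : ∀ x, HasDerivAt u (u' x) x)
    (hc : Continuous u') : IsPrimitive u u' := by
  refine ⟨hc.continuousOn.integrableOn_Icc, fun x _ => ?_⟩
  rw [intervalIntegral.integral_eq_sub_of_hasDerivAt (fun t _ => h t)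
    (hc.intervalIntegrable _ _)]
  simp

theorem smul [CompleteSpace E] {c c' : ℝ → ℝ} {u u' : ℝ → E} (hc : IsPrimitive c c')
    (hu : IsPrimitive u u') :
    IsPrimitive (fun x => c x • u x) (fun x => c' x • u x + c x • u' x) := by
  simpa using hc.bilin (ContinuousLinearMap.lsmul ℝ ℝ) hu

theorem norm_sub_le_integral {u u' : ℝ → E} (h : IsPrimitive u u') {x : ℝ}
    (hx : x ∈ Icc (0 : ℝ) 1) : ‖u x - u 0‖ ≤ ∫ t in Icc (0 : ℝ) 1, ‖u' t‖ := by
  refine (h.norm_sub_le (by simp) hx hx.1).trans ?_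
  rw [intervalIntegral.integral_of_le hx.1]
  exact setIntegral_mono_set h.integrable.norm (Filter.Eventually.of_forall fun _ => norm_nonneg _)
    (Ioc_subset_Icc_self.trans (Icc_subset_Icc_right hx.2)).eventuallyLE

end IsPrimitive

end

/-! ### Boundary conditions, the boundary matrix and variation of constants. -/

section

variable {N : ℕ}

theorem HasSecondDeriv.isPrimitive_deriv {ψ φ χ : ℝ → CVec N} (h : HasSecondDeriv ψ φ χ) :
    IsPrimitive φ χ := ⟨h.integrable, h.deriv_eq⟩

theorem HasSecondDeriv.isPrimitive {ψ φ χ : ℝ → CVec N} (h : HasSecondDeriv ψ φ χ) :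
    IsPrimitive ψ φ := ⟨h.continuousOn_deriv.integrableOn_Icc, h.eq⟩

theorem HasSecondDeriv.of_isPrimitive {ψ φ χ : ℝ → CVec N} (h : IsPrimitive φ χ)
    (h' : IsPrimitive ψ φ) : HasSecondDeriv ψ φ χ := ⟨h.integrable, h.eq, h'.eq⟩

/-- The data `V, a, b` of a Sturm-Liouville problem, of size at most `R`. -/
structure IsSLData (Tm Tp a b : COp N) (V : ℝ → COp N) (R : ℝ) : Prop where
  selfAdjoint_left : IsSelfAdjoint a
  compress_left : a = (1 - Tm) * a * (1 - Tm)
  norm_left : ‖a‖ ≤ R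
  selfAdjoint_right : IsSelfAdjoint b
  compress_right : b = (1 - Tp) * b * (1 - Tp)
  norm_right : ‖b‖ ≤ R
  integrable : IntegrableOn V (Icc 0 1)
  selfAdjoint : ∀ᵐ x ∂(volume.restrict (Icc (0 : ℝ) 1)), IsSelfAdjoint (V x)
  integral_le : (∫ x in Icc (0 : ℝ) 1, ‖V x‖) ≤ R

/-- `ψ` solves `-ψ'' + V ψ - μ ψ = f` with the boundary conditions given by `T₋, a, T₊, b`. -/
structure IsSLSolution (Tm Tp a b : COp N) (V : ℝ → COp N) (μ : ℝ) (f ψ φ χ : ℝ → CVec N) :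
    Prop where
  hasSecondDeriv : HasSecondDeriv ψ φ χ
  minus : boundaryMinus Tm a (ψ 0) (φ 0) = 0
  plus : boundaryPlus Tp b (ψ 1) (φ 1) = 0
  eq : ∀ᵐ x ∂(volume.restrict (Icc (0 : ℝ) 1)), χ x = V x (ψ x) - μ • ψ x - f x

theorem COp.map_real_smul (T : COp N) (c : ℝ) (x : CVec N) : T (c • x) = c • T x :=
  T.map_smul_of_tower c x

namespace IsStarProjection

variable {T : COp N}

theorem apply_apply (h : IsStarProjection T) (x : CVec N) : T (T x) = T x := by
  have := h.isIdempotentElem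
  exact congrArg (fun S : COp N => S x) this

theorem inner_apply_left (h : IsStarProjection T) (x y : CVec N) :
    inner ℂ (T x) y = inner ℂ x (T y) := by
  have := h.isSelfAdjoint
  rw [ContinuousLinearMap.isSelfAdjoint_iff_isSymmetric] at this
  exact this x y

theorem norm_apply_le (h : IsStarProjection T) (x : CVec N) : ‖T x‖ ≤ ‖x‖ := by
  by_cases hx : T x = 0
  · simp [hx]
  have h1 : ‖T x‖ * ‖T x‖ ≤ ‖x‖ * ‖T x‖ := by
    calc ‖T x‖ * ‖T x‖ = ‖inner ℂ (T x) (T x)‖ := by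
          rw [inner_self_eq_norm_sq_to_K]; simp [sq]
      _ = ‖inner ℂ x (T x)‖ := by rw [h.inner_apply_left, h.apply_apply]
      _ ≤ _ := norm_inner_le_norm _ _
  exact le_of_mul_le_mul_right h1 (norm_pos_iff.mpr hx)

theorem mem_opRange (h : IsStarProjection T) {x : CVec N} : x ∈ opRange T ↔ T x = x := by
  constructor
  · rintro ⟨y, rfl⟩
    exact h.apply_apply y
  · intro hx
    exact ⟨x, hx⟩

theorem mem_opRange_one_sub (h : IsStarProjection T) {x : CVec N} :
    x ∈ opRange (1 - T) ↔ T x = 0 := by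
  rw [h.one_sub.mem_opRange]
  simp

end IsStarProjection

/-- The boundary condition at the left end, with the two components separated. -/
theorem boundaryMinus_eq_zero_iff {Tm a : COp N} (hT : IsStarProjection Tm)
    (ha : a = (1 - Tm) * a * (1 - Tm)) {u v : CVec N} :
    boundaryMinus Tm a u v = 0 ↔ Tm u = 0 ∧ (1 - Tm) v = a u := by
  have hTa : Tm (a u) = 0 := by
    rw [ha]; simp [hT.apply_apply]
  constructor
  · intro h
    have h1 : Tm u = 0 := by
      have := congrArg Tm h
      simpa [boundaryMinus, hT.apply_apply] using this
    refine ⟨h1, ?_⟩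
    simp only [boundaryMinus, h1, sub_zero] at h
    rw [map_sub, sub_eq_zero] at h
    rw [h]
    simp [hTa]
  · rintro ⟨h1, h2⟩
    simp only [boundaryMinus, h1, sub_zero, map_sub, h2]
    simp [hTa]

/-- The boundary condition at the right end, with the two components separated. -/
theorem boundaryPlus_eq_zero_iff {Tp b : COp N} (hT : IsStarProjection Tp)
    (hb : b = (1 - Tp) * b * (1 - Tp)) {u v : CVec N} :
    boundaryPlus Tp b u v = 0 ↔ Tp u = 0 ∧ (1 - Tp) v = -b u := by
  -- The right condition is the left one with `-b` in place of `a`.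
  have hb' : -b = (1 - Tp) * (-b) * (1 - Tp) := by
    refine ContinuousLinearMap.ext fun x => ?_
    have := congrArg (fun S : COp N => -(S x)) hb
    simp only [mul_apply_eq_comp, sub_apply, one_apply_eq_self, neg_apply, map_sub, map_neg] at this ⊢
    rw [this]
    abel
  have := boundaryMinus_eq_zero_iff hT hb' (u := u) (v := v)
  simpa [boundaryPlus, boundaryMinus] using this

/-- The matrix whose kernel describes the solutions `cos(κ x) T₋^⊥ v + sin(κ x) T₋ v` of the free
boundary value problem. -/
noncomputable def boundaryOp (Tm Tp : COp N) (κ : ℝ) : COp N :=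
  Tp * (Real.cos κ • (1 - Tm) + Real.sin κ • Tm)
    + (1 - Tp) * (Real.cos κ • Tm - Real.sin κ • (1 - Tm))

theorem boundaryOp_apply (Tm Tp : COp N) (κ : ℝ) (x : CVec N) :
    boundaryOp Tm Tp κ x = Tp (Real.cos κ • (1 - Tm) x + Real.sin κ • Tm x)
      + (1 - Tp) (Real.cos κ • Tm x - Real.sin κ • (1 - Tm) x) := rfl

/-- Variation of constants: the amplitude of the cosine. -/
theorem IsPrimitive.cosAmplitude {ψ φ χ : ℝ → CVec N} (h : HasSecondDeriv ψ φ χ) {κ : ℝ}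
    (hκ : κ ≠ 0) :
    IsPrimitive (fun x => Real.cos (κ * x) • ψ x - (Real.sin (κ * x) / κ) • φ x)
      (fun x => -(Real.sin (κ * x) / κ) • (χ x + κ ^ 2 • ψ x)) := by
  have hc : IsPrimitive (fun x => Real.cos (κ * x)) (fun x => -(κ * Real.sin (κ * x))) := by
    refine .of_hasDerivAt (fun x => ?_) (by fun_prop)
    have e : HasDerivAt (fun x : ℝ => κ * x) κ x := by simpa using (hasDerivAt_id x).const_mul κ
    exact e.cos.congr_deriv (by ring)
  have hs : IsPrimitive (fun x => -(Real.sin (κ * x) / κ)) (fun x => -Real.cos (κ * x)) := by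
    refine .of_hasDerivAt (fun x => ?_) (by fun_prop)
    have e : HasDerivAt (fun x : ℝ => κ * x) κ x := by simpa using (hasDerivAt_id x).const_mul κ
    exact (e.sin.div_const κ).neg.congr_deriv (by field_simp)
  refine ((hc.smul h.isPrimitive).add (hs.smul h.isPrimitive_deriv)).congr ?_ ?_
  · intro x _
    simp [sub_eq_add_neg]
  · refine .of_forall fun x => ?_
    match_scalars <;> field_simp <;> ring

/-- Variation of constants: the amplitude of the sine. -/
theorem IsPrimitive.sinAmplitude {ψ φ χ : ℝ → CVec N} (h : HasSecondDeriv ψ φ χ) {κ : ℝ}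
    (hκ : κ ≠ 0) :
    IsPrimitive (fun x => Real.sin (κ * x) • ψ x + (Real.cos (κ * x) / κ) • φ x)
      (fun x => (Real.cos (κ * x) / κ) • (χ x + κ ^ 2 • ψ x)) := by
  have hs : IsPrimitive (fun x => Real.sin (κ * x)) (fun x => κ * Real.cos (κ * x)) := by
    refine .of_hasDerivAt (fun x => ?_) (by fun_prop)
    have e : HasDerivAt (fun x : ℝ => κ * x) κ x := by simpa using (hasDerivAt_id x).const_mul κ
    exact e.sin.congr_deriv (by ring)
  have hc : IsPrimitive (fun x => Real.cos (κ * x) / κ) (fun x => -Real.sin (κ * x)) := by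
    refine .of_hasDerivAt (fun x => ?_) (by fun_prop)
    have e : HasDerivAt (fun x : ℝ => κ * x) κ x := by simpa using (hasDerivAt_id x).const_mul κ
    exact (e.cos.div_const κ).congr_deriv (by field_simp)
  refine ((hs.smul h.isPrimitive).add (hc.smul h.isPrimitive_deriv)).congr ?_ ?_
  · intro x _
    simp
  · refine .of_forall fun x => ?_
    match_scalars <;> field_simp <;> ring

theorem IsPrimitive.norm_apply_sub_le_of_norm_le {u u' h : ℝ → CVec N} {C : ℝ}
    (hu : IsPrimitive u u') (hh : IntegrableOn h (Icc 0 1)) (hle : ∀ x, ‖u' x‖ ≤ C * ‖h x‖)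
    {x : ℝ} (hx : x ∈ Icc (0 : ℝ) 1) : ‖u x - u 0‖ ≤ C * ∫ t in Icc (0 : ℝ) 1, ‖h t‖ := by
  refine (hu.norm_sub_le_integral hx).trans ?_
  rw [← integral_const_mul]
  exact integral_mono hu.integrable.norm (hh.norm.const_mul C) hle

/-- The potential times a continuous function is integrable. -/
theorem integrableOn_potential_apply {V : ℝ → COp N} (hV : IntegrableOn V (Icc 0 1))
    {ψ : ℝ → CVec N} (hψ : ContinuousOn ψ (Icc 0 1)) :
    IntegrableOn (fun x => V x (ψ x)) (Icc 0 1) := by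
  obtain ⟨C, hC⟩ := isCompact_Icc.exists_bound_of_continuousOn hψ
  refine Integrable.mono' (hV.norm.mul_const C) ?_ ?_
  · exact (ContinuousLinearMap.id ℂ (COp N)).aestronglyMeasurable_comp₂ hV.aestronglyMeasurable
      (hψ.aestronglyMeasurable measurableSet_Icc)
  · filter_upwards [ae_restrict_mem measurableSet_Icc] with x hx
    exact ((V x).le_opNorm _).trans (by gcongr; exact hC x hx)

theorem integral_norm_potential_apply_le {V : ℝ → COp N} (hV : IntegrableOn V (Icc 0 1))
    {R : ℝ} (hR : (∫ x in Icc (0 : ℝ) 1, ‖V x‖) ≤ R)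
    {ψ : ℝ → CVec N} (hψ : ContinuousOn ψ (Icc 0 1)) {M : ℝ} (hM : ∀ x ∈ Icc (0 : ℝ) 1, ‖ψ x‖ ≤ M) :
    ∫ x in Icc (0 : ℝ) 1, ‖V x (ψ x)‖ ≤ R * M := by
  have hM0 : 0 ≤ M := (norm_nonneg _).trans (hM 0 (by simp))
  calc _ ≤ ∫ x in Icc (0 : ℝ) 1, ‖V x‖ * M := by
        refine setIntegral_mono_on (integrableOn_potential_apply hV hψ).norm (hV.norm.mul_const M)
          measurableSet_Icc fun x hx => ?_
        exact ((V x).le_opNorm _).trans (by gcongr; exact hM x hx)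
    _ ≤ R * M := by
        rw [integral_mul_const]; gcongr

end

/-! ### A priori bounds at gap frequencies. -/

section

variable {N : ℕ}

/-- Rotating the pair `(ψ, φ/κ)` back by the angle `κ x` gives amplitudes `p, q` that would be
constant for the free equation. The defect `χ + κ² ψ` drives them with an extra factor `κ⁻¹`, so
they stay close to the Cauchy data at `0`. -/
theorem HasSecondDeriv.exists_amplitudes {ψ φ χ : ℝ → CVec N} (h : HasSecondDeriv ψ φ χ) {κ : ℝ}
    (hκ : 0 < κ) {x : ℝ} (hx : x ∈ Icc (0 : ℝ) 1) :
    ∃ p q : CVec N, ψ x = Real.cos (κ * x) • p + Real.sin (κ * x) • q ∧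
      φ x = κ • (Real.cos (κ * x) • q - Real.sin (κ * x) • p) ∧
      ‖p - ψ 0‖ ≤ κ⁻¹ * ∫ t in Icc (0 : ℝ) 1, ‖χ t + κ ^ 2 • ψ t‖ ∧
      ‖q - κ⁻¹ • φ 0‖ ≤ κ⁻¹ * ∫ t in Icc (0 : ℝ) 1, ‖χ t + κ ^ 2 • ψ t‖ := by
  have hi : IntegrableOn (fun t => χ t + κ ^ 2 • ψ t) (Icc 0 1) :=
    h.integrable.add (h.isPrimitive.continuousOn.integrableOn_Icc.smul (κ ^ 2))
  have hcs := Real.sin_sq_add_cos_sq (κ * x)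
  have key : ∀ (c s : ℝ) (y : CVec N), |s| ≤ 1 → c = s / κ → ‖c • y‖ ≤ κ⁻¹ * ‖y‖ := by
    intro c s y hs hc
    rw [norm_smul, hc, Real.norm_eq_abs, abs_div, abs_of_pos hκ, div_eq_inv_mul]
    have := mul_le_mul_of_nonneg_left hs (inv_pos.mpr hκ).le
    gcongr
    simpa using this
  refine ⟨Real.cos (κ * x) • ψ x - (Real.sin (κ * x) / κ) • φ x,
    Real.sin (κ * x) • ψ x + (Real.cos (κ * x) / κ) • φ x, ?_, ?_, ?_, ?_⟩
  rotate_left 2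
  · have := (IsPrimitive.cosAmplitude h hκ.ne').norm_apply_sub_le_of_norm_le (C := κ⁻¹) hi
      (fun t => key _ (-Real.sin (κ * t)) _ (by rw [abs_neg]; exact Real.abs_sin_le_one _)
        (by ring)) hx
    simpa using this
  · have := (IsPrimitive.sinAmplitude h hκ.ne').norm_apply_sub_le_of_norm_le (C := κ⁻¹) hi
      (fun t => key _ (Real.cos (κ * t)) _ (Real.abs_cos_le_one _) rfl) hx
    simpa using this
  · match_scalars
    · linear_combination -hcs
    · field_simp; ring
  · match_scalars
    · field_simp; linear_combination -hcs
    · field_simp; ring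

theorem IsSLData.nonneg {Tm Tp a b : COp N} {V : ℝ → COp N} {R : ℝ}
    (h : IsSLData Tm Tp a b V R) : 0 ≤ R :=
  (norm_nonneg _).trans h.norm_left

theorem norm_cos_smul_add_sin_smul_le (θ : ℝ) (p q : CVec N) :
    ‖Real.cos θ • p + Real.sin θ • q‖ ≤ ‖p‖ + ‖q‖ := by
  refine (norm_add_le _ _).trans ?_
  rw [norm_smul, norm_smul]
  have h1 := Real.abs_cos_le_one θ
  have h2 := Real.abs_sin_le_one θ
  exact add_le_add (mul_le_of_le_one_left (norm_nonneg _) h1)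
    (mul_le_of_le_one_left (norm_nonneg _) h2)

theorem norm_cos_smul_sub_sin_smul_le (θ : ℝ) (p q : CVec N) :
    ‖Real.cos θ • q - Real.sin θ • p‖ ≤ ‖p‖ + ‖q‖ := by
  refine (norm_sub_le _ _).trans ?_
  rw [norm_smul, norm_smul, add_comm]
  have h1 := Real.abs_cos_le_one θ
  have h2 := Real.abs_sin_le_one θ
  exact add_le_add (mul_le_of_le_one_left (norm_nonneg _) h2)
    (mul_le_of_le_one_left (norm_nonneg _) h1)

/-- A solution of `-ψ'' + V ψ - κ² ψ = f` is controlled by its Cauchy data. -/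
theorem HasSecondDeriv.exists_bound {V : ℝ → COp N} {R κ : ℝ}
    (hV : IntegrableOn V (Icc 0 1)) (hR : (∫ x in Icc (0 : ℝ) 1, ‖V x‖) ≤ R)
    (hκ : 4 ≤ κ) (hκR : 4 * R ≤ κ) {f ψ φ χ : ℝ → CVec N} (h : HasSecondDeriv ψ φ χ)
    (heq : ∀ᵐ x ∂(volume.restrict (Icc (0 : ℝ) 1)), χ x = V x (ψ x) - κ ^ 2 • ψ x - f x)
    (hf : IntegrableOn f (Icc 0 1)) :
    ∃ M, (∀ x ∈ Icc (0 : ℝ) 1, ‖ψ x‖ ≤ M) ∧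
      (∫ t in Icc (0 : ℝ) 1, ‖χ t + κ ^ 2 • ψ t‖) ≤ R * M + ∫ t in Icc (0 : ℝ) 1, ‖f t‖ ∧
      M ≤ 2 * (‖ψ 0‖ + κ⁻¹ * ‖φ 0‖) + 4 * κ⁻¹ * ∫ t in Icc (0 : ℝ) 1, ‖f t‖ := by
  have hκ0 : 0 < κ := by linarith
  have hc := h.isPrimitive.continuousOn
  obtain ⟨x₀, hx₀, hmax⟩ := isCompact_Icc.exists_isMaxOn (nonempty_Icc.mpr zero_le_one) hc.norm
  have hM : ∀ x ∈ Icc (0 : ℝ) 1, ‖ψ x‖ ≤ ‖ψ x₀‖ := fun x hx => hmax hx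
  have hH : (∫ t in Icc (0 : ℝ) 1, ‖χ t + κ ^ 2 • ψ t‖)
      ≤ R * ‖ψ x₀‖ + ∫ t in Icc (0 : ℝ) 1, ‖f t‖ := by
    have hi := integrableOn_potential_apply hV hc
    calc _ = ∫ t in Icc (0 : ℝ) 1, ‖V t (ψ t) - f t‖ := by
          refine integral_congr_ae ?_
          filter_upwards [heq] with t ht
          rw [ht]; congr 1; abel
      _ ≤ ∫ t in Icc (0 : ℝ) 1, (‖V t (ψ t)‖ + ‖f t‖) :=
          integral_mono (hi.sub hf).norm (hi.norm.add hf.norm) fun t => norm_sub_le _ _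
      _ = (∫ t in Icc (0 : ℝ) 1, ‖V t (ψ t)‖) + ∫ t in Icc (0 : ℝ) 1, ‖f t‖ :=
          integral_add hi.norm hf.norm
      _ ≤ _ := by
          gcongr
          exact integral_norm_potential_apply_le hV hR hc hM
  refine ⟨‖ψ x₀‖, hM, hH, ?_⟩
  obtain ⟨p, q, e, -, hp, hq⟩ := h.exists_amplitudes hκ0 hx₀
  set H := ∫ t in Icc (0 : ℝ) 1, ‖χ t + κ ^ 2 • ψ t‖
  set A := ∫ t in Icc (0 : ℝ) 1, ‖f t‖
  have h1 : ‖ψ x₀‖ ≤ ‖p‖ + ‖q‖ := by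
    conv_lhs => rw [e]
    exact norm_cos_smul_add_sin_smul_le _ _ _
  have h2 : ‖p‖ ≤ ‖ψ 0‖ + κ⁻¹ * H := by
    have := norm_add_le (ψ 0) (p - ψ 0)
    rw [add_sub_cancel] at this
    linarith
  have h3 : ‖q‖ ≤ κ⁻¹ * ‖φ 0‖ + κ⁻¹ * H := by
    have := norm_add_le (κ⁻¹ • φ 0) (q - κ⁻¹ • φ 0)
    rw [add_sub_cancel, norm_smul, Real.norm_eq_abs, abs_of_pos (inv_pos.mpr hκ0)] at this
    linarith
  have h4 : κ⁻¹ * H ≤ κ⁻¹ * (R * ‖ψ x₀‖ + A) := by gcongr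
  -- Both amplitudes produce this term, so together they absorb half of the maximum; this explains
  -- the factors `2` and `4` in the bound.
  have h5 : κ⁻¹ * (R * ‖ψ x₀‖) ≤ ‖ψ x₀‖ / 4 := by
    rw [inv_mul_le_iff₀ hκ0]
    have := mul_le_mul_of_nonneg_right hκR (norm_nonneg (ψ x₀))
    linarith
  linarith

/-- A frequency at which the free boundary matrix is bounded below strongly enough to absorb
perturbations of size `R`. -/
structure IsGapFrequency (Tm Tp : COp N) (R κ : ℝ) : Prop where
  four_le : 4 ≤ κ
  four_mul_le : 4 * R ≤ κ
  le_norm : ∀ x, (27 * R + 1) * κ⁻¹ * ‖x‖ ≤ ‖boundaryOp Tm Tp κ x‖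

/-- A priori bounds for solutions of the boundary value problem at a gap frequency. -/
theorem IsSLSolution.norm_le {Tm Tp a b : COp N} {V : ℝ → COp N} {R κ : ℝ}
    (hTm : IsStarProjection Tm) (hTp : IsStarProjection Tp) (hd : IsSLData Tm Tp a b V R)
    (hκ : IsGapFrequency Tm Tp R κ) {f ψ φ χ : ℝ → CVec N}
    (hs : IsSLSolution Tm Tp a b V (κ ^ 2) f ψ φ χ) (hf : IntegrableOn f (Icc 0 1)) :
    ∀ x ∈ Icc (0 : ℝ) 1, ‖ψ x‖ ≤ 50 * (∫ t in Icc (0 : ℝ) 1, ‖f t‖) ∧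
      ‖φ x‖ ≤ κ * (50 * ∫ t in Icc (0 : ℝ) 1, ‖f t‖) := by
  have hR := hd.nonneg
  have h4 := hκ.four_le
  have hκ0 : 0 < κ := by linarith
  have hi0 : 0 < κ⁻¹ := inv_pos.mpr hκ0
  have hi4 : κ⁻¹ ≤ 1 / 4 := by
    rw [one_div]; exact inv_anti₀ (by norm_num) h4
  have hiR : κ⁻¹ * R ≤ 1 / 4 := by
    rw [inv_mul_le_iff₀ hκ0]; linarith [hκ.four_mul_le]
  obtain ⟨M, hM, hH, hMle⟩ := hs.hasSecondDeriv.exists_bound hd.integrable hd.integral_le h4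
    hκ.four_mul_le hs.eq hf
  obtain ⟨hu, hv⟩ := (boundaryMinus_eq_zero_iff hTm hd.compress_left).mp hs.minus
  obtain ⟨hu1, hv1⟩ := (boundaryPlus_eq_zero_iff hTp hd.compress_right).mp hs.plus
  set A := ∫ t in Icc (0 : ℝ) 1, ‖f t‖ with hA
  set H := ∫ t in Icc (0 : ℝ) 1, ‖χ t + κ ^ 2 • ψ t‖ with hHdef
  have hA0 : 0 ≤ A := integral_nonneg fun _ => norm_nonneg _
  -- One vector encodes the Cauchy data at `0`: its components along `Ran T₋^⊥` and `Ran T₋` are `ψ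
  -- 0` and `κ⁻¹ T₋ (φ 0)`. The other component of `φ 0` is `a (ψ 0)` by the left condition.
  set X : CVec N := ψ 0 + κ⁻¹ • Tm (φ 0) with hX
  have hTX : Tm X = κ⁻¹ • Tm (φ 0) := by
    rw [hX, map_add, hu, zero_add, COp.map_real_smul, hTm.apply_apply]
  have hTX' : (1 - Tm) X = ψ 0 := by
    change X - Tm X = _
    rw [hTX, hX]; abel
  have hw : κ⁻¹ • φ 0 = Tm X + κ⁻¹ • a (ψ 0) := by
    rw [hTX, ← hv]; simp [smul_sub]
  have hnu : ‖ψ 0‖ ≤ ‖X‖ := by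
    rw [← hTX']; exact hTm.one_sub.norm_apply_le X
  have hnau : ‖κ⁻¹ • a (ψ 0)‖ ≤ κ⁻¹ * (R * ‖X‖) := by
    rw [norm_smul, Real.norm_eq_abs, abs_of_pos hi0]
    gcongr
    refine (a.le_opNorm _).trans ?_
    gcongr
    exact hd.norm_left
  have hRX : κ⁻¹ * (R * ‖X‖) ≤ ‖X‖ / 4 := by
    have := mul_le_mul_of_nonneg_right hiR (norm_nonneg X)
    linarith
  have hnw : κ⁻¹ * ‖φ 0‖ ≤ 5 / 4 * ‖X‖ := by
    have e : κ⁻¹ * ‖φ 0‖ = ‖κ⁻¹ • φ 0‖ := by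
      rw [norm_smul, Real.norm_eq_abs, abs_of_pos hi0]
    rw [e, hw]
    refine (norm_add_le _ _).trans ?_
    have := hTm.norm_apply_le X
    linarith
  have hM2 : M ≤ 9 / 2 * ‖X‖ + 4 * κ⁻¹ * A := by linarith
  have hM3 : M ≤ 9 / 2 * ‖X‖ + A := by
    have := mul_le_mul_of_nonneg_right hi4 hA0
    linarith
  have hRM : R * M ≤ 9 / 2 * (R * ‖X‖) + A := by
    have h1 := mul_le_mul_of_nonneg_left hM2 hR
    have h2 := mul_le_mul_of_nonneg_right hiR hA0
    linarith
  have hH2 : H ≤ 9 / 2 * (R * ‖X‖) + 2 * A := by linarith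
  have hone : (1 : ℝ) ∈ Icc (0 : ℝ) 1 := by simp
  obtain ⟨p, q, e1, e2, hp, hq⟩ := hs.hasSecondDeriv.exists_amplitudes hκ0 hone
  rw [← hHdef] at hp hq
  rw [mul_one] at e1 e2
  -- With `X` in place of the true amplitudes, `T₊ ψ(1) = 0` holds up to the drift of `p` and `q`
  -- and the term `κ⁻¹ a (ψ 0)`.
  have hD1 : ‖Tp (Real.cos κ • (1 - Tm) X + Real.sin κ • Tm X)‖
      ≤ κ⁻¹ * (2 * H + R * ‖X‖) := by
    have e : Tp (Real.cos κ • (1 - Tm) X + Real.sin κ • Tm X)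
        = -Tp (Real.cos κ • (p - ψ 0) + Real.sin κ • ((q - κ⁻¹ • φ 0) + κ⁻¹ • a (ψ 0))) := by
      rw [eq_neg_iff_add_eq_zero, ← map_add, ← hu1, e1, hw, hTX']
      congr 1
      module
    rw [e, norm_neg]
    refine (hTp.norm_apply_le _).trans ((norm_cos_smul_add_sin_smul_le _ _ _).trans ?_)
    have := norm_add_le (q - κ⁻¹ • φ 0) (κ⁻¹ • a (ψ 0))
    linarith
  have hD2 : ‖(1 - Tp) (Real.cos κ • Tm X - Real.sin κ • (1 - Tm) X)‖
      ≤ κ⁻¹ * (2 * H + R * ‖X‖ + R * M) := by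
    have e : (1 - Tp) (Real.cos κ • Tm X - Real.sin κ • (1 - Tm) X)
        = -((1 - Tp) (Real.cos κ • ((q - κ⁻¹ • φ 0) + κ⁻¹ • a (ψ 0)) - Real.sin κ • (p - ψ 0))
          + κ⁻¹ • b (ψ 1)) := by
      have e3 : κ⁻¹ • b (ψ 1) = -(1 - Tp) (Real.cos κ • q - Real.sin κ • p) := by
        rw [e2, COp.map_real_smul] at hv1
        rw [← neg_eq_iff_eq_neg.mpr hv1, smul_neg, smul_smul, inv_mul_cancel₀ hκ0.ne', one_smul]
      rw [e3, ← sub_eq_add_neg, ← map_sub, ← map_neg, hw, hTX']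
      congr 1
      module
    rw [e, norm_neg]
    refine (norm_add_le _ _).trans ?_
    have h1 : ‖κ⁻¹ • b (ψ 1)‖ ≤ κ⁻¹ * (R * M) := by
      rw [norm_smul, Real.norm_eq_abs, abs_of_pos hi0]
      gcongr
      refine (b.le_opNorm _).trans ?_
      have := hM 1 hone
      have := hd.norm_right
      gcongr
    have h2 := (hTp.one_sub.norm_apply_le
      (Real.cos κ • ((q - κ⁻¹ • φ 0) + κ⁻¹ • a (ψ 0)) - Real.sin κ • (p - ψ 0))).trans
      (norm_cos_smul_sub_sin_smul_le _ _ _)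
    have h3 := norm_add_le (q - κ⁻¹ • φ 0) (κ⁻¹ • a (ψ 0))
    linarith
  -- The errors add up to `4H + 2R‖X‖ + RM`, which is at most `24.5 R‖X‖ + 9A`; the constant `27` of
  -- `IsGapFrequency` is a rounding of this.
  have hD : ‖boundaryOp Tm Tp κ X‖ ≤ κ⁻¹ * (27 * R * ‖X‖ + 9 * A) := by
    rw [boundaryOp_apply]
    refine (norm_add_le _ _).trans ((add_le_add hD1 hD2).trans ?_)
    rw [← mul_add]
    refine mul_le_mul_of_nonneg_left ?_ hi0.le
    have : 0 ≤ R * ‖X‖ := by positivity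
    linarith
  -- The part `27 R` of the gap bound absorbs the terms in `‖X‖`; the remaining `1` bounds `‖X‖` by
  -- the source.
  have hX9 : ‖X‖ ≤ 9 * A := by
    have h1 := (hκ.le_norm X).trans hD
    have h2 : κ⁻¹ * ‖X‖ ≤ κ⁻¹ * (9 * A) := by linarith
    exact le_of_mul_le_mul_left h2 hi0
  intro x hx
  refine ⟨(hM x hx).trans (by linarith), ?_⟩
  obtain ⟨p', q', -, e2', hp', hq'⟩ := hs.hasSecondDeriv.exists_amplitudes hκ0 hx
  rw [← hHdef] at hp' hq'
  rw [e2', norm_smul, Real.norm_eq_abs, abs_of_pos hκ0]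
  gcongr
  refine (norm_cos_smul_sub_sin_smul_le _ _ _).trans ?_
  have h2 : ‖p'‖ ≤ ‖ψ 0‖ + κ⁻¹ * H := by
    have := norm_add_le (ψ 0) (p' - ψ 0)
    rw [add_sub_cancel] at this
    linarith
  have h3 : ‖q'‖ ≤ κ⁻¹ * ‖φ 0‖ + κ⁻¹ * H := by
    have := norm_add_le (κ⁻¹ • φ 0) (q' - κ⁻¹ • φ 0)
    rw [add_sub_cancel, norm_smul, Real.norm_eq_abs, abs_of_pos (inv_pos.mpr hκ0)] at this
    linarith
  have h5 : κ⁻¹ * H ≤ 9 / 8 * ‖X‖ + A / 2 := by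
    have h6 := mul_le_mul_of_nonneg_left hH2 hi0.le
    have h7 := mul_le_mul_of_nonneg_right hi4 hA0
    linarith
  linarith

end

/-! ### Solvability of the initial and boundary value problems. -/

section

variable {N : ℕ}

section InitialValueProblem

/-- The oscillating function with amplitudes `u - κ⁻¹ ∫₀ˣ sin(κ s) h(s) ds` of the cosine and
`w + κ⁻¹ ∫₀ˣ cos(κ s) h(s) ds` of the sine. -/
noncomputable def duhamel (κ : ℝ) (u w : CVec N) (h : ℝ → CVec N) (x : ℝ) : CVec N :=
  Real.cos (κ * x) • (u + ∫ t in (0 : ℝ)..x, -(Real.sin (κ * t) / κ) • h t)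
    + Real.sin (κ * x) • (w + ∫ t in (0 : ℝ)..x, (Real.cos (κ * t) / κ) • h t)

theorem integrableOn_smul_of_continuous {c : ℝ → ℝ} (hc : Continuous c) {h : ℝ → CVec N}
    (hh : IntegrableOn h (Icc 0 1)) : IntegrableOn (fun t => c t • h t) (Icc 0 1) :=
  hh.continuousOn_smul hc.continuousOn isCompact_Icc

/-- The derivatives of the two amplitudes cancel in the first derivative and contribute exactly `h`,
by `sin² + cos² = 1`, in the second. -/
theorem duhamel_hasSecondDeriv {κ : ℝ} (hκ : κ ≠ 0) (u w : CVec N) {h : ℝ → CVec N}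
    (hh : IntegrableOn h (Icc 0 1)) :
    ∃ φ, φ 0 = κ • w ∧
      HasSecondDeriv (duhamel κ u w h) φ (fun x => h x - κ ^ 2 • duhamel κ u w h x) := by
  have hp := IsPrimitive.of_integrable u
    (integrableOn_smul_of_continuous (c := fun t => -(Real.sin (κ * t) / κ)) (by fun_prop) hh)
  have hq := IsPrimitive.of_integrable w
    (integrableOn_smul_of_continuous (c := fun t => Real.cos (κ * t) / κ) (by fun_prop) hh)
  have e : ∀ x, HasDerivAt (fun x : ℝ => κ * x) κ x := fun x => by
    simpa using (hasDerivAt_id x).const_mul κ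
  have hc : IsPrimitive (fun x => Real.cos (κ * x)) (fun x => -(κ * Real.sin (κ * x))) :=
    .of_hasDerivAt (fun x => (e x).cos.congr_deriv (by ring)) (by fun_prop)
  have hs : IsPrimitive (fun x => Real.sin (κ * x)) (fun x => κ * Real.cos (κ * x)) :=
    .of_hasDerivAt (fun x => (e x).sin.congr_deriv (by ring)) (by fun_prop)
  have hc' : IsPrimitive (fun x => κ * Real.cos (κ * x)) (fun x => -(κ ^ 2 * Real.sin (κ * x))) :=
    .of_hasDerivAt (fun x => ((e x).cos.const_mul κ).congr_deriv (by ring)) (by fun_prop)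
  have hs' : IsPrimitive (fun x => -(κ * Real.sin (κ * x))) (fun x => -(κ ^ 2 * Real.cos (κ * x))) :=
    .of_hasDerivAt (fun x => ((e x).sin.const_mul κ).neg.congr_deriv (by ring)) (by fun_prop)
  refine ⟨_, ?_, .of_isPrimitive (((hs'.smul hp).add (hc'.smul hq)).congr (fun _ _ => rfl) ?_)
    (((hc.smul hp).add (hs.smul hq)).congr (fun _ _ => rfl) ?_)⟩
  · simp
  · refine .of_forall fun x => ?_
    simp only [duhamel]
    have hcs := Real.sin_sq_add_cos_sq (κ * x)
    match_scalars
    · field_simp; linear_combination -hcs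
    · ring
    · ring
    · ring
    · ring
  · refine .of_forall fun x => ?_
    match_scalars <;> field_simp <;> ring

theorem norm_duhamel_sub_le {κ : ℝ} (hκ : 0 < κ) (u w : CVec N) {h₁ h₂ : ℝ → CVec N}
    (hh₁ : IntegrableOn h₁ (Icc 0 1)) (hh₂ : IntegrableOn h₂ (Icc 0 1)) {x : ℝ}
    (hx : x ∈ Icc (0 : ℝ) 1) :
    ‖duhamel κ u w h₁ x - duhamel κ u w h₂ x‖
      ≤ 2 * κ⁻¹ * ∫ t in Icc (0 : ℝ) 1, ‖h₁ t - h₂ t‖ := by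
  have h0 : (0 : ℝ) ∈ Icc (0 : ℝ) 1 := by simp
  have key : ∀ c : ℝ → ℝ, Continuous c → (∀ t, |c t| ≤ κ⁻¹) →
      ‖(∫ t in (0 : ℝ)..x, c t • h₁ t) - ∫ t in (0 : ℝ)..x, c t • h₂ t‖
        ≤ κ⁻¹ * ∫ t in Icc (0 : ℝ) 1, ‖h₁ t - h₂ t‖ := by
    intro c hc hle
    have hi := integrableOn_smul_of_continuous hc (hh₁.sub hh₂)
    have := (IsPrimitive.of_integrable 0 hi).norm_apply_sub_le_of_norm_le (C := κ⁻¹)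
      (hh₁.sub hh₂) (fun t => ?_) hx
    · rw [← intervalIntegral.integral_sub
        (IsPrimitive.intervalIntegrable_of (integrableOn_smul_of_continuous hc hh₁) h0 hx)
        (IsPrimitive.intervalIntegrable_of (integrableOn_smul_of_continuous hc hh₂) h0 hx)]
      simpa [smul_sub] using this
    · rw [norm_smul]
      gcongr
      exact hle t
  have k1 := key (fun t => -(Real.sin (κ * t) / κ)) (by fun_prop) fun t => by
    rw [abs_neg, abs_div, abs_of_pos hκ, div_eq_mul_inv]
    exact mul_le_of_le_one_left (inv_pos.mpr hκ).le (Real.abs_sin_le_one _)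
  have k2 := key (fun t => Real.cos (κ * t) / κ) (by fun_prop) fun t => by
    rw [abs_div, abs_of_pos hκ, div_eq_mul_inv]
    exact mul_le_of_le_one_left (inv_pos.mpr hκ).le (Real.abs_cos_le_one _)
  have e : duhamel κ u w h₁ x - duhamel κ u w h₂ x
      = Real.cos (κ * x) • ((∫ t in (0 : ℝ)..x, -(Real.sin (κ * t) / κ) • h₁ t)
          - ∫ t in (0 : ℝ)..x, -(Real.sin (κ * t) / κ) • h₂ t)
        + Real.sin (κ * x) • ((∫ t in (0 : ℝ)..x, (Real.cos (κ * t) / κ) • h₁ t)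
          - ∫ t in (0 : ℝ)..x, (Real.cos (κ * t) / κ) • h₂ t) := by
    simp only [duhamel]
    module
  rw [e]
  refine (norm_cos_smul_add_sin_smul_le _ _ _).trans ?_
  linarith

/-- Existence for the initial value problem at high frequency. -/
theorem exists_initialValueProblem {V : ℝ → COp N} {R κ : ℝ}
    (hV : IntegrableOn V (Icc 0 1)) (hR : (∫ x in Icc (0 : ℝ) 1, ‖V x‖) ≤ R)
    (hκ : 4 ≤ κ) (hκR : 4 * R ≤ κ) {f : ℝ → CVec N} (hf : IntegrableOn f (Icc 0 1))
    (u v : CVec N) :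
    ∃ ψ φ χ : ℝ → CVec N, HasSecondDeriv ψ φ χ ∧ ψ 0 = u ∧ φ 0 = v ∧
      ∀ᵐ x ∂(volume.restrict (Icc (0 : ℝ) 1)), χ x = V x (ψ x) - κ ^ 2 • ψ x - f x := by
  have hκ0 : 0 < κ := by linarith
  have h01 : (0 : ℝ) ≤ 1 := zero_le_one
  -- The potential term and the source are treated as forcing, so that a solution is a fixed point
  -- of the Duhamel map.
  let src : C(Icc (0 : ℝ) 1, CVec N) → ℝ → CVec N := fun g x => V x (IccExtend h01 g x) - f x
  have hsrc : ∀ g, IntegrableOn (src g) (Icc 0 1) := fun g =>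
    (integrableOn_potential_apply hV (g.continuous.Icc_extend' (h := h01)).continuousOn).sub hf
  have hcont : ∀ g, Continuous ((Icc (0 : ℝ) 1).domRestrict (duhamel κ u (κ⁻¹ • v) (src g))) := by
    intro g
    obtain ⟨φ, -, hφ⟩ := duhamel_hasSecondDeriv hκ0.ne' u (κ⁻¹ • v) (hsrc g)
    exact hφ.isPrimitive.continuousOn.domRestrict
  let Φ : C(Icc (0 : ℝ) 1, CVec N) → C(Icc (0 : ℝ) 1, CVec N) := fun g => ⟨_, hcont g⟩
  -- The Lipschitz constant is `2 κ⁻¹ R ≤ 1/2` because `4R ≤ κ`: high frequency alone makes the map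
  -- a contraction on all of `[0,1]` in the supremum norm.
  have hΦ : ContractingWith (1 / 2) Φ := by
    refine ⟨by rw [← NNReal.coe_lt_coe]; norm_num, LipschitzWith.of_dist_le_mul fun g₁ g₂ => ?_⟩
    rw [ContinuousMap.dist_le (by positivity)]
    intro x
    rw [dist_eq_norm]
    refine (norm_duhamel_sub_le hκ0 u (κ⁻¹ • v) (hsrc g₁) (hsrc g₂) x.2).trans ?_
    have e : ∀ t, src g₁ t - src g₂ t = V t (IccExtend h01 (g₁ - g₂) t) := by
      intro t
      simp [src, IccExtend]
    simp only [e]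
    have hle := integral_norm_potential_apply_le hV hR
      ((g₁ - g₂).continuous.Icc_extend' (h := h01)).continuousOn (M := dist g₁ g₂) (by
        intro t _
        rw [dist_eq_norm]
        exact (g₁ - g₂).norm_coe_le_norm _)
    have h3 : 2 * κ⁻¹ * (R * dist g₁ g₂) ≤ 1 / 2 * dist g₁ g₂ := by
      have : κ⁻¹ * R ≤ 1 / 4 := by rw [inv_mul_le_iff₀ hκ0]; linarith
      have := mul_le_mul_of_nonneg_right this (dist_nonneg (x := g₁) (y := g₂))
      linarith
    refine le_trans ?_ (h3.trans_eq (by simp))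
    gcongr
    exact hle
  obtain ⟨g, hg, -⟩ := hΦ.exists_fixedPoint 0 (edist_ne_top _ _)
  obtain ⟨φ, hφ0, hφ⟩ := duhamel_hasSecondDeriv hκ0.ne' u (κ⁻¹ • v) (hsrc g)
  refine ⟨_, φ, _, hφ, ?_, ?_, ?_⟩
  · simp [duhamel]
  · rw [hφ0, smul_smul, mul_inv_cancel₀ hκ0.ne', one_smul]
  · filter_upwards [ae_restrict_mem measurableSet_Icc] with x hx
    have hgx : IccExtend h01 g x = duhamel κ u (κ⁻¹ • v) (src g) x := by
      rw [IccExtend_of_mem h01 _ hx]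
      conv_lhs => rw [← hg.eq]
      rfl
    conv_lhs => rw [← hgx]
    rw [← hgx]
    simp only [src]
    abel

end InitialValueProblem

section BoundaryValueProblem

variable {Tm Tp a b : COp N} {V : ℝ → COp N} {R κ μ : ℝ}

theorem IsSLSolution.add {f₁ ψ₁ φ₁ χ₁ f₂ ψ₂ φ₂ χ₂ : ℝ → CVec N}
    (h₁ : IsSLSolution Tm Tp a b V μ f₁ ψ₁ φ₁ χ₁) (h₂ : IsSLSolution Tm Tp a b V μ f₂ ψ₂ φ₂ χ₂) :
    IsSLSolution Tm Tp a b V μ (fun x => f₁ x + f₂ x) (fun x => ψ₁ x + ψ₂ x)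
      (fun x => φ₁ x + φ₂ x) (fun x => χ₁ x + χ₂ x) where
  hasSecondDeriv := h₁.hasSecondDeriv.add h₂.hasSecondDeriv
  minus := by
    have e : boundaryMinus Tm a (ψ₁ 0 + ψ₂ 0) (φ₁ 0 + φ₂ 0)
        = boundaryMinus Tm a (ψ₁ 0) (φ₁ 0) + boundaryMinus Tm a (ψ₂ 0) (φ₂ 0) := by
      simp only [boundaryMinus, map_add, map_sub]; abel
    rw [e, h₁.minus, h₂.minus, add_zero]
  plus := by
    have e : boundaryPlus Tp b (ψ₁ 1 + ψ₂ 1) (φ₁ 1 + φ₂ 1)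
        = boundaryPlus Tp b (ψ₁ 1) (φ₁ 1) + boundaryPlus Tp b (ψ₂ 1) (φ₂ 1) := by
      simp only [boundaryPlus, map_add]; abel
    rw [e, h₁.plus, h₂.plus, add_zero]
  eq := by
    filter_upwards [h₁.eq, h₂.eq] with x e₁ e₂
    rw [e₁, e₂, map_add, smul_add]; abel

theorem IsSLSolution.smul (c : ℂ) {f ψ φ χ : ℝ → CVec N}
    (h : IsSLSolution Tm Tp a b V μ f ψ φ χ) :
    IsSLSolution Tm Tp a b V μ (fun x => c • f x) (fun x => c • ψ x)
      (fun x => c • φ x) (fun x => c • χ x) where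
  hasSecondDeriv := h.hasSecondDeriv.smul c
  minus := by
    have e : boundaryMinus Tm a (c • ψ 0) (c • φ 0) = c • boundaryMinus Tm a (ψ 0) (φ 0) := by
      simp only [boundaryMinus, map_smul, smul_sub, map_sub]
    rw [e, h.minus, smul_zero]
  plus := by
    have e : boundaryPlus Tp b (c • ψ 1) (c • φ 1) = c • boundaryPlus Tp b (ψ 1) (φ 1) := by
      simp only [boundaryPlus, map_smul, smul_sub, smul_add, map_add]
    rw [e, h.plus, smul_zero]
  eq := by
    filter_upwards [h.eq] with x e
    rw [e, map_smul, smul_sub, smul_sub, smul_comm]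

/-- The pairs of a vector `x`, encoding Cauchy data at `0` which satisfy the left boundary
condition, and of the defect at `1` of the homogeneous solution with these Cauchy data. -/
def shootingRelation (Tm Tp a b : COp N) (V : ℝ → COp N) (κ : ℝ) :
    Submodule ℂ (CVec N × CVec N) where
  carrier := {p | ∃ ψ φ χ : ℝ → CVec N, HasSecondDeriv ψ φ χ ∧ ψ 0 = (1 - Tm) p.1 ∧
    φ 0 = Tm p.1 + a p.1 ∧ boundaryPlus Tp b (ψ 1) (φ 1) = p.2 ∧
    ∀ᵐ x ∂(volume.restrict (Icc (0 : ℝ) 1)), χ x = V x (ψ x) - κ ^ 2 • ψ x}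
  zero_mem' := ⟨fun _ => 0, fun _ => 0, fun _ => 0, ⟨by simp, by simp, by simp⟩,
      by simp, by simp, by simp [boundaryPlus], by simp⟩
  add_mem' := by
    rintro p q ⟨ψ₁, φ₁, χ₁, h₁, m₁, m₁', p₁, e₁⟩ ⟨ψ₂, φ₂, χ₂, h₂, m₂, m₂', p₂, e₂⟩
    refine ⟨_, _, _, h₁.add h₂, ?_, ?_, ?_, ?_⟩
    · simp only [m₁, m₂, Prod.fst_add, map_add]
    · simp only [m₁', m₂', Prod.fst_add, map_add]; abel
    · simp only [Prod.snd_add, ← p₁, ← p₂, boundaryPlus, map_add]; abel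
    · filter_upwards [e₁, e₂] with x e₁ e₂
      rw [e₁, e₂, map_add, smul_add]; abel
  smul_mem' := by
    rintro c p ⟨ψ, φ, χ, h, m, m', p', e⟩
    refine ⟨_, _, _, h.smul c, ?_, ?_, ?_, ?_⟩
    · simp only [m, Prod.smul_fst, map_smul]
    · simp only [m', Prod.smul_fst, map_smul, smul_add]
    · simp only [← p', Prod.smul_snd, boundaryPlus, map_smul, smul_sub, smul_add, map_add]
    · filter_upwards [e] with x e
      rw [e, map_smul, smul_sub, smul_comm]

theorem boundaryMinus_eq_zero_of_cauchyData (hTm : IsStarProjection Tm)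
    (ha : a = (1 - Tm) * a * (1 - Tm)) (x : CVec N) :
    boundaryMinus Tm a ((1 - Tm) x) (Tm x + a x) = 0 := by
  have h1 : Tm (a x) = 0 := by
    rw [ha]; simp [hTm.apply_apply]
  have h2 : a (Tm x) = 0 := by
    rw [ha]; simp [hTm.apply_apply]
  rw [boundaryMinus_eq_zero_iff hTm ha]
  simp [hTm.apply_apply, h1, h2]

theorem IsSLSolution.eq_zero (hTm : IsStarProjection Tm) (hTp : IsStarProjection Tp)
    (hd : IsSLData Tm Tp a b V R) (hκ : IsGapFrequency Tm Tp R κ) {f ψ φ χ : ℝ → CVec N}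
    (hs : IsSLSolution Tm Tp a b V (κ ^ 2) f ψ φ χ)
    (hf : ∀ᵐ x ∂(volume.restrict (Icc (0 : ℝ) 1)), f x = 0) :
    ∀ x ∈ Icc (0 : ℝ) 1, ψ x = 0 ∧ φ x = 0 := by
  have hf0 : f =ᵐ[volume.restrict (Icc (0 : ℝ) 1)] 0 := hf
  have hfi : IntegrableOn f (Icc 0 1) := (integrable_zero _ _ _).congr hf0.symm
  have hi : ∫ t in Icc (0 : ℝ) 1, ‖f t‖ = 0 := by
    rw [integral_congr_ae (g := fun _ => 0) (by filter_upwards [hf] with x hx; simp [hx])]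
    simp
  intro x hx
  have := hs.norm_le hTm hTp hd hκ hfi x hx
  rw [hi] at this
  simpa using this

/-- Existence for the boundary value problem at a gap frequency. -/
theorem exists_isSLSolution (hTm : IsStarProjection Tm) (hTp : IsStarProjection Tp)
    (hd : IsSLData Tm Tp a b V R) (hκ : IsGapFrequency Tm Tp R κ) {f : ℝ → CVec N}
    (hf : IntegrableOn f (Icc 0 1)) :
    ∃ ψ φ χ, IsSLSolution Tm Tp a b V (κ ^ 2) f ψ φ χ := by
  let S := shootingRelation Tm Tp a b V κ
  let p₁ : S →ₗ[ℂ] CVec N := LinearMap.fst ℂ _ _ ∘ₗ S.subtype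
  let p₂ : S →ₗ[ℂ] CVec N := LinearMap.snd ℂ _ _ ∘ₗ S.subtype
  have h₁ : Function.Surjective p₁ := by
    intro x
    obtain ⟨ψ, φ, χ, h, h0, h0', he⟩ := exists_initialValueProblem hd.integrable hd.integral_le
      hκ.four_le hκ.four_mul_le (f := fun _ => 0) integrableOn_zero ((1 - Tm) x) (Tm x + a x)
    exact ⟨⟨(x, boundaryPlus Tp b (ψ 1) (φ 1)), ψ, φ, χ, h, h0, h0', rfl, by simpa using he⟩, rfl⟩
  have h₂ : Function.Injective p₂ := by
    rw [← LinearMap.ker_eq_bot, LinearMap.ker_eq_bot']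
    rintro ⟨⟨x, r⟩, ψ, φ, χ, h, h0, h0', h1, he⟩ hr
    change r = 0 at hr
    subst hr
    have hz := IsSLSolution.eq_zero (f := fun _ => 0) hTm hTp hd hκ ⟨h, by
      rw [h0, h0']; exact boundaryMinus_eq_zero_of_cauchyData hTm hd.compress_left x, h1,
      by simpa using he⟩ (by simp) 0 (by simp)
    simp only [h0, h0'] at hz
    have hx1 : x = Tm x := by
      have := hz.1
      simp only [sub_apply, one_apply_eq_self] at this
      exact sub_eq_zero.mp this
    have hax : a x = 0 := by
      rw [hx1, hd.compress_left]
      simp [hTm.apply_apply]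
    have hx : x = 0 := by
      have := hz.2
      rwa [hax, add_zero, ← hx1] at this
    simp [hx]
  -- Surjectivity of `p₁` gives `dim S ≥ N` and injectivity of `p₂` gives `dim S ≤ N`. Working with
  -- a relation instead of a map spares the uniqueness of the initial value problem.
  have h₃ : Function.Surjective p₂ := by
    refine (LinearMap.injective_iff_surjective_of_finrank_eq_finrank ?_).mp h₂
    exact le_antisymm (LinearMap.finrank_le_finrank_of_injective h₂)
      (LinearMap.finrank_le_finrank_of_surjective h₁)
  -- A particular solution with zero Cauchy data satisfies the left condition; a homogeneous
  -- solution then cancels its defect at `1`.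
  obtain ⟨ψ₁, φ₁, χ₁, g₁, c₁, c₁', e₁⟩ := exists_initialValueProblem hd.integrable hd.integral_le
    hκ.four_le hκ.four_mul_le hf 0 0
  obtain ⟨⟨⟨x, r⟩, ψ₂, φ₂, χ₂, g₂, c₂, c₂', b₂, e₂⟩, hr⟩ := h₃ (-boundaryPlus Tp b (ψ₁ 1) (φ₁ 1))
  change r = _ at hr
  refine ⟨_, _, _, g₁.add g₂, ?_, ?_, ?_⟩
  · simp only [c₁, c₁', c₂, c₂', zero_add]
    exact boundaryMinus_eq_zero_of_cauchyData hTm hd.compress_left x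
  · have e : boundaryPlus Tp b (ψ₁ 1 + ψ₂ 1) (φ₁ 1 + φ₂ 1)
        = boundaryPlus Tp b (ψ₁ 1) (φ₁ 1) + boundaryPlus Tp b (ψ₂ 1) (φ₂ 1) := by
      simp only [boundaryPlus, map_add]; abel
    rw [e, b₂, hr, add_neg_cancel]
  · filter_upwards [e₁, e₂] with x e₁ e₂
    rw [e₁, e₂, map_add, smul_add]; abel

end BoundaryValueProblem

end

/-! ### The inverse of `L - κ²` as a compact operator. -/

section

variable {N : ℕ}

instance isProbabilityMeasure_restrict_Icc_zero_one :
    IsProbabilityMeasure (volume.restrict (Icc (0 : ℝ) 1)) :=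
  ⟨by simp⟩

theorem L2Vec.integrableOn (f : L2Vec N) : IntegrableOn f (Icc 0 1) :=
  (Lp.memLp f).integrable (by norm_num)

theorem L2Vec.integral_norm_le (f : L2Vec N) : ∫ t in Icc (0 : ℝ) 1, ‖f t‖ ≤ ‖f‖ := by
  have h := Lp.memLp f
  rw [integral_norm_eq_lintegral_enorm h.1, ← eLpNorm_one_eq_lintegral_enorm, Lp.norm_def]
  exact ENNReal.toReal_mono h.2.ne (eLpNorm_le_eLpNorm_of_exponent_le (by norm_num) h.1)

theorem L2Vec.norm_le_of_ae_bound {u : L2Vec N} {C : ℝ} (hC : 0 ≤ C)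
    (h : ∀ᵐ x ∂(volume.restrict (Icc (0 : ℝ) 1)), ‖u x‖ ≤ C) : ‖u‖ ≤ C := by
  have := Lp.norm_le_of_ae_bound hC h
  simpa [measureUnivNNReal] using this

theorem memLp_of_continuousOn {ψ : ℝ → CVec N} (hψ : ContinuousOn ψ (Icc 0 1)) :
    MemLp ψ 2 (volume.restrict (Icc (0 : ℝ) 1)) := by
  obtain ⟨C, hC⟩ := isCompact_Icc.exists_bound_of_continuousOn hψ
  exact MemLp.of_bound (hψ.aestronglyMeasurable measurableSet_Icc) C
    ((ae_restrict_mem measurableSet_Icc).mono fun x hx => hC x hx)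

/-- Uniformly bounded and uniformly Lipschitz functions form a relatively compact set in `L²`. -/
theorem exists_isCompact_of_lipschitz (N : ℕ) (C D : ℝ) :
    ∃ K : Set (L2Vec N), IsCompact K ∧ ∀ (u : L2Vec N) (ψ : ℝ → CVec N),
      (∀ᵐ x ∂(volume.restrict (Icc (0 : ℝ) 1)), u x = ψ x) →
      (∀ x ∈ Icc (0 : ℝ) 1, ‖ψ x‖ ≤ C) →
      (∀ x ∈ Icc (0 : ℝ) 1, ∀ y ∈ Icc (0 : ℝ) 1, dist (ψ x) (ψ y) ≤ D * dist x y) → u ∈ K := by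
  have h01 : (0 : ℝ) ≤ 1 := zero_le_one
  let A : Set (BoundedContinuousFunction (Icc (0 : ℝ) 1) (CVec N)) :=
    {g | (∀ x, ‖g x‖ ≤ C) ∧ ∀ x y, dist (g x) (g y) ≤ D * dist x y}
  have hA : IsCompact A := by
    refine BoundedContinuousFunction.arzela_ascoli₂ (Metric.closedBall 0 C)
      (isCompact_closedBall 0 C) A ?_ (fun f x hf => by simpa using hf.1 x) ?_
    · have e : A = (⋂ x, {g | ‖g x‖ ≤ C}) ∩ ⋂ x, ⋂ y, {g | dist (g x) (g y) ≤ D * dist x y} := by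
        ext g
        simp only [A, mem_inter_iff, mem_iInter, mem_ofPred_eq]
      rw [e]
      refine IsClosed.inter (isClosed_iInter fun x => isClosed_le
          (continuous_eval_const x).norm continuous_const) ?_
      exact isClosed_iInter fun x => isClosed_iInter fun y => isClosed_le
          ((continuous_eval_const x).dist
            (continuous_eval_const y)) continuous_const
    · refine Metric.equicontinuous_of_continuity_modulus (fun t => D * t) ?_ _ ?_
      · have : Continuous fun t : ℝ => D * t := by fun_prop
        simpa using this.tendsto 0
      · intro x y g
        exact g.2.2 x y
  have hcont : ∀ g : BoundedContinuousFunction (Icc (0 : ℝ) 1) (CVec N),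
      ContinuousOn (IccExtend h01 g) (Icc 0 1) := fun g =>
    (g.continuous.Icc_extend' (h := h01)).continuousOn
  let J : BoundedContinuousFunction (Icc (0 : ℝ) 1) (CVec N) → L2Vec N := fun g =>
    (memLp_of_continuousOn (hcont g)).toLp _
  -- The interval has measure one, so the `L²` norm is at most the supremum norm and Arzelà–Ascoli
  -- compactness is carried to `L²`.
  have hJ : LipschitzWith 1 J := by
    refine LipschitzWith.of_dist_le_mul fun g₁ g₂ => ?_
    rw [dist_eq_norm, ← MemLp.toLp_sub]
    rw [NNReal.coe_one, one_mul]
    refine L2Vec.norm_le_of_ae_bound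
      (u := ((memLp_of_continuousOn (hcont g₁)).sub (memLp_of_continuousOn (hcont g₂))).toLp _)
      dist_nonneg (by
        filter_upwards [MemLp.coeFn_toLp
          ((memLp_of_continuousOn (hcont g₁)).sub (memLp_of_continuousOn (hcont g₂)))] with x hx
        rw [hx, Pi.sub_apply, ← dist_eq_norm]
        exact BoundedContinuousFunction.dist_coe_le_dist _)
  refine ⟨J '' A, hA.image hJ.continuous, fun u ψ hu hC hD => ?_⟩
  have hψ : Continuous ((Icc (0 : ℝ) 1).domRestrict ψ) := by
    refine (LipschitzWith.of_dist_le_mul (K := D.toNNReal) fun x y => ?_).continuous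
    refine (hD x x.2 y y.2).trans ?_
    exact mul_le_mul_of_nonneg_right (Real.le_coe_toNNReal D) dist_nonneg
  refine ⟨BoundedContinuousFunction.mkOfCompact ⟨_, hψ⟩, ⟨fun x => hC x x.2,
    fun x y => hD x x.2 y y.2⟩, ?_⟩
  refine Lp.ext ?_
  filter_upwards [MemLp.coeFn_toLp (memLp_of_continuousOn
    (hcont (BoundedContinuousFunction.mkOfCompact ⟨_, hψ⟩))), hu,
    ae_restrict_mem measurableSet_Icc] with x h1 h2 hx
  rw [h1, h2, IccExtend_of_mem h01 _ hx]
  rfl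

variable {Tm Tp a b : COp N} {V : ℝ → COp N} {R κ : ℝ}

theorem IsSLSolution.sub {μ : ℝ} {f₁ ψ₁ φ₁ χ₁ f₂ ψ₂ φ₂ χ₂ : ℝ → CVec N}
    (h₁ : IsSLSolution Tm Tp a b V μ f₁ ψ₁ φ₁ χ₁) (h₂ : IsSLSolution Tm Tp a b V μ f₂ ψ₂ φ₂ χ₂) :
    IsSLSolution Tm Tp a b V μ (fun x => f₁ x - f₂ x) (fun x => ψ₁ x - ψ₂ x)
      (fun x => φ₁ x - φ₂ x) (fun x => χ₁ x - χ₂ x) := by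
  simpa [sub_eq_add_neg] using h₁.add (h₂.smul (-1))

theorem IsSLSolution.unique (hTm : IsStarProjection Tm) (hTp : IsStarProjection Tp)
    (hd : IsSLData Tm Tp a b V R) (hκ : IsGapFrequency Tm Tp R κ)
    {f₁ ψ₁ φ₁ χ₁ f₂ ψ₂ φ₂ χ₂ : ℝ → CVec N}
    (h₁ : IsSLSolution Tm Tp a b V (κ ^ 2) f₁ ψ₁ φ₁ χ₁)
    (h₂ : IsSLSolution Tm Tp a b V (κ ^ 2) f₂ ψ₂ φ₂ χ₂)
    (hf : ∀ᵐ x ∂(volume.restrict (Icc (0 : ℝ) 1)), f₁ x = f₂ x) :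
    ∀ x ∈ Icc (0 : ℝ) 1, ψ₁ x = ψ₂ x := fun x hx =>
  sub_eq_zero.mp ((h₁.sub h₂).eq_zero hTm hTp hd hκ
    (hf.mono fun x hx => by simp [hx]) x hx).1

/-- The bounded operator `K` is the inverse of `L - κ²`. -/
def IsResolvent (Tm Tp a b : COp N) (V : ℝ → COp N) (κ : ℝ) (K : L2Vec N →L[ℂ] L2Vec N) : Prop :=
  ∀ f : L2Vec N, ∃ ψ φ χ, IsSLSolution Tm Tp a b V (κ ^ 2) f ψ φ χ ∧
    ∀ᵐ x ∂(volume.restrict (Icc (0 : ℝ) 1)), K f x = ψ x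

/-- Uniqueness at a gap frequency makes the solution map linear, and the a priori bound makes it
bounded, with constant `50`. -/
theorem exists_isResolvent (hTm : IsStarProjection Tm) (hTp : IsStarProjection Tp)
    (hd : IsSLData Tm Tp a b V R) (hκ : IsGapFrequency Tm Tp R κ) :
    ∃ K, IsResolvent Tm Tp a b V κ K := by
  choose ψ φ χ hs using fun f : L2Vec N => exists_isSLSolution hTm hTp hd hκ f.integrableOn
  have hm : ∀ f, MemLp (ψ f) 2 (volume.restrict (Icc (0 : ℝ) 1)) := fun f =>
    memLp_of_continuousOn (hs f).hasSecondDeriv.isPrimitive.continuousOn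
  let K₀ : L2Vec N →ₗ[ℂ] L2Vec N :=
    { toFun := fun f => (hm f).toLp _
      map_add' := fun f g => by
        rw [← MemLp.toLp_add]
        refine (MemLp.toLp_eq_toLp_iff _ _).mpr ?_
        filter_upwards [ae_restrict_mem measurableSet_Icc] with x hx
        exact (hs (f + g)).unique hTm hTp hd hκ ((hs f).add (hs g))
          ((Lp.coeFn_add f g).mono fun x hx => by rw [hx]; rfl) x hx
      map_smul' := fun c f => by
        rw [RingHom.id_apply, ← MemLp.toLp_const_smul]
        refine (MemLp.toLp_eq_toLp_iff _ _).mpr ?_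
        filter_upwards [ae_restrict_mem measurableSet_Icc] with x hx
        exact (hs (c • f)).unique hTm hTp hd hκ ((hs f).smul c)
          ((Lp.coeFn_smul c f).mono fun x hx => by rw [hx]; rfl) x hx }
  have hb : ∀ f, ‖K₀ f‖ ≤ 50 * ‖f‖ := fun f => by
    refine L2Vec.norm_le_of_ae_bound
      (u := (hm f).toLp _) (by positivity) (by
        filter_upwards [MemLp.coeFn_toLp (hm f), ae_restrict_mem measurableSet_Icc] with x h1 hx
        rw [h1]
        refine ((hs f).norm_le hTm hTp hd hκ f.integrableOn x hx).1.trans ?_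
        gcongr
        exact f.integral_norm_le)
  exact ⟨K₀.mkContinuous 50 hb, fun f => ⟨ψ f, φ f, χ f, hs f, MemLp.coeFn_toLp (hm f)⟩⟩

/-- The a priori bound on `φ = ψ'` makes the image of the unit ball uniformly Lipschitz, so
Arzelà–Ascoli applies. -/
theorem IsResolvent.isCompactOperator {K : L2Vec N →L[ℂ] L2Vec N} (hTm : IsStarProjection Tm)
    (hTp : IsStarProjection Tp) (hd : IsSLData Tm Tp a b V R) (hκ : IsGapFrequency Tm Tp R κ)
    (hK : IsResolvent Tm Tp a b V κ K) : IsCompactOperator K := by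
  have hκ0 : 0 < κ := by linarith [hκ.four_le]
  obtain ⟨S, hS, hmem⟩ := exists_isCompact_of_lipschitz N 50 (κ * 50)
  refine (isCompactOperator_iff_image_closedBall_subset_compact (K : L2Vec N →ₗ[ℂ] L2Vec N)
    one_pos).mpr ⟨S, hS, ?_⟩
  rintro _ ⟨f, hf, rfl⟩
  rw [mem_closedBall_zero_iff] at hf
  obtain ⟨ψ, φ, χ, hs, he⟩ := hK f
  have hb := hs.norm_le hTm hTp hd hκ f.integrableOn
  have hI := f.integral_norm_le.trans hf
  refine hmem _ ψ he (fun x hx => (hb x hx).1.trans (by linarith)) ?_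
  have key : ∀ x ∈ Icc (0 : ℝ) 1, ∀ y ∈ Icc (0 : ℝ) 1, ‖ψ y - ψ x‖ ≤ κ * 50 * |y - x| := by
    intro x hx y hy
    rw [hs.hasSecondDeriv.isPrimitive.sub_eq hx hy]
    refine intervalIntegral.norm_integral_le_of_norm_le_const fun t ht => ?_
    have ht' : t ∈ Icc (0 : ℝ) 1 := uIcc_subset_Icc hx hy (uIoc_subset_uIcc ht)
    refine (hb t ht').2.trans ?_
    gcongr
    linarith
  intro x hx y hy
  rw [dist_eq_norm, Real.dist_eq]
  exact key y hy x hx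

/-- Subtracting `κ² u` turns `L u = μ u` into `(L - κ²) u = (μ - κ²) u`, the form to which the
inverse can be applied. -/
theorem mem_sturmLiouvilleEigenspace_iff {μ : ℝ} {u : L2Vec N} :
    u ∈ sturmLiouvilleEigenspace Tm Tp a b V μ ↔ ∃ ψ φ χ,
      IsSLSolution Tm Tp a b V (κ ^ 2) ((((μ - κ ^ 2 : ℝ) : ℂ) • u : L2Vec N)) ψ φ χ ∧
        ∀ᵐ x ∂(volume.restrict (Icc (0 : ℝ) 1)), u x = ψ x := by
  constructor
  · rintro ⟨ψ, φ, χ, h, hm, hp, h1, h2⟩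
    refine ⟨ψ, φ, χ, ⟨h, hm, hp, ?_⟩, h1⟩
    filter_upwards [h1, h2, Lp.coeFn_smul (((μ - κ ^ 2 : ℝ) : ℂ)) u, Lp.coeFn_smul ((μ : ℂ)) u]
      with x e1 e2 e3 e4
    simp only [LinearMap.prod_apply, LinearMap.smul_apply, LinearMap.id_apply,
      Function.prod_apply] at e1 e2
    rw [e4, Pi.smul_apply, e1] at e2
    rw [e3, Pi.smul_apply, e1, Complex.coe_smul, sub_smul, ← Complex.coe_smul μ, e2]
    abel
  · rintro ⟨ψ, φ, χ, h, h1⟩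
    refine ⟨ψ, φ, χ, h.hasSecondDeriv, h.minus, h.plus, h1, ?_⟩
    filter_upwards [h1, h.eq, Lp.coeFn_smul (((μ - κ ^ 2 : ℝ) : ℂ)) u, Lp.coeFn_smul ((μ : ℂ)) u]
      with x e1 e2 e3 e4
    change ((μ : ℂ) • u : L2Vec N) x = _
    rw [e4, Pi.smul_apply, e1, e2, e3, Pi.smul_apply, e1, Complex.coe_smul, Complex.coe_smul,
      sub_smul]
    abel

/-- By uniqueness, `L u = μ u` is equivalent to `K ((μ - κ²) u) = u`. In particular the eigenvalues
of `L` below `κ²` become the negative eigenvalues of `K`. -/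
theorem IsResolvent.eigenspace_eq {K : L2Vec N →L[ℂ] L2Vec N} (hTm : IsStarProjection Tm)
    (hTp : IsStarProjection Tp) (hd : IsSLData Tm Tp a b V R) (hκ : IsGapFrequency Tm Tp R κ)
    (hK : IsResolvent Tm Tp a b V κ K) {μ : ℝ} (hμ : μ ≠ κ ^ 2) :
    sturmLiouvilleEigenspace Tm Tp a b V μ
      = Module.End.eigenspace (K : Module.End ℂ (L2Vec N)) (((μ - κ ^ 2)⁻¹ : ℝ) : ℂ) := by
  have hc : (((μ - κ ^ 2 : ℝ)) : ℂ) ≠ 0 := by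
    exact_mod_cast sub_ne_zero.mpr hμ
  have key : ∀ u : L2Vec N, u ∈ sturmLiouvilleEigenspace Tm Tp a b V μ ↔
      K ((((μ - κ ^ 2 : ℝ)) : ℂ) • u) = u := by
    intro u
    obtain ⟨ψ', φ', χ', h', he'⟩ := hK ((((μ - κ ^ 2 : ℝ)) : ℂ) • u)
    rw [mem_sturmLiouvilleEigenspace_iff (κ := κ)]
    constructor
    · rintro ⟨ψ, φ, χ, h, he⟩
      refine Lp.ext ?_
      filter_upwards [he, he', ae_restrict_mem measurableSet_Icc] with x e e' hx
      rw [e, e']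
      exact h'.unique hTm hTp hd hκ h (.of_forall fun _ => rfl) x hx
    · intro hu
      rw [hu] at he'
      exact ⟨ψ', φ', χ', h', he'⟩
  ext u
  rw [key, Module.End.mem_eigenspace_iff, map_smul, Complex.ofReal_inv]
  exact (eq_inv_smul_iff₀ hc).symm

theorem sturmLiouvilleEigenspace_gap_eq_bot (hTm : IsStarProjection Tm)
    (hTp : IsStarProjection Tp) (hd : IsSLData Tm Tp a b V R) (hκ : IsGapFrequency Tm Tp R κ) :
    sturmLiouvilleEigenspace Tm Tp a b V (κ ^ 2) = ⊥ := by
  rw [eq_bot_iff]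
  intro u hu
  rw [mem_sturmLiouvilleEigenspace_iff (κ := κ)] at hu
  obtain ⟨ψ, φ, χ, h, he⟩ := hu
  refine (Submodule.mem_bot ℂ).mpr (Lp.ext ?_)
  have hz := h.eq_zero hTm hTp hd hκ (by
    simp only [sub_self, Complex.ofReal_zero, zero_smul]
    exact Lp.coeFn_zero _ _ _)
  filter_upwards [he, ae_restrict_mem measurableSet_Icc,
    Lp.coeFn_zero (CVec N) 2 (volume.restrict (Icc (0 : ℝ) 1))] with x e hx e0
  rw [e, e0, (hz x hx).1]
  rfl

end

/-! ### Green's identity and the energy estimate. -/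

section

variable {N : ℕ}

/-- The inner product as a real bilinear map. -/
noncomputable def innerRealBilin (N : ℕ) : CVec N →L[ℝ] CVec N →L[ℝ] ℂ :=
  (isBoundedBilinearMap_inner (𝕜 := ℂ) (E := CVec N)).toContinuousLinearMap

theorem IsPrimitive.inner {u u' v v' : ℝ → CVec N} (hu : IsPrimitive u u')
    (hv : IsPrimitive v v') :
    IsPrimitive (fun x => inner ℂ (u x) (v x))
      (fun x => inner ℂ (u' x) (v x) + inner ℂ (u x) (v' x)) :=
  hu.bilin (innerRealBilin N) hv

theorem IsPrimitive.integral_Icc {E : Type*} [NormedAddCommGroup E] [NormedSpace ℝ E]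
    {u u' : ℝ → E} (hu : IsPrimitive u u') : ∫ x in Icc (0 : ℝ) 1, u' x = u 1 - u 0 := by
  rw [integral_Icc_eq_integral_Ioc, ← intervalIntegral.integral_of_le zero_le_one,
    hu.sub_eq (by simp) (by simp)]

theorem integrableOn_inner_left {f ψ : ℝ → CVec N} (hf : IntegrableOn f (Icc 0 1))
    (hψ : ContinuousOn ψ (Icc 0 1)) : IntegrableOn (fun x => inner ℂ (f x) (ψ x)) (Icc 0 1) := by
  obtain ⟨C, hC⟩ := isCompact_Icc.exists_bound_of_continuousOn hψ
  refine Integrable.mono' (hf.norm.mul_const C) ?_ ?_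
  · exact hf.aestronglyMeasurable.inner (hψ.aestronglyMeasurable measurableSet_Icc)
  · filter_upwards [ae_restrict_mem measurableSet_Icc] with x hx
    exact (norm_inner_le_norm _ _).trans (by gcongr; exact hC x hx)

theorem integrableOn_inner_right {f ψ : ℝ → CVec N} (hf : IntegrableOn f (Icc 0 1))
    (hψ : ContinuousOn ψ (Icc 0 1)) : IntegrableOn (fun x => inner ℂ (ψ x) (f x)) (Icc 0 1) := by
  obtain ⟨C, hC⟩ := isCompact_Icc.exists_bound_of_continuousOn hψ
  refine Integrable.mono' (hf.norm.const_mul C) ?_ ?_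
  · exact (hψ.aestronglyMeasurable measurableSet_Icc).inner hf.aestronglyMeasurable
  · filter_upwards [ae_restrict_mem measurableSet_Icc] with x hx
    exact (norm_inner_le_norm _ _).trans (by gcongr; exact hC x hx)

theorem COp.inner_apply_left {A : COp N} (hA : IsSelfAdjoint A) (x y : CVec N) :
    inner ℂ (A x) y = inner ℂ x (A y) := by
  rw [ContinuousLinearMap.isSelfAdjoint_iff_isSymmetric] at hA
  exact hA x y

theorem inner_boundary_left {Tm a : COp N} (hTm : IsStarProjection Tm) {u v y : CVec N}
    (h : (1 - Tm) v = a u) (hy : Tm y = 0) : inner ℂ v y = inner ℂ (a u) y := by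
  rw [← h]
  simp [hTm.inner_apply_left, hy]

theorem real_smul_inner_left (c : ℝ) (x y : CVec N) :
    inner ℂ (c • x) y = (c : ℂ) * inner ℂ x y := by
  rw [← Complex.coe_smul, inner_smul_left]; simp

theorem real_smul_inner_right (c : ℝ) (x y : CVec N) :
    inner ℂ x (c • y) = (c : ℂ) * inner ℂ x y := by
  rw [← Complex.coe_smul, inner_smul_right]

/-- Green's identity for two Sturm-Liouville problems with the same projectors. -/
theorem IsSLSolution.green {Tm Tp a₁ b₁ a₂ b₂ : COp N} {V₁ V₂ : ℝ → COp N} {R₁ R₂ μ : ℝ}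
    (hTm : IsStarProjection Tm) (hTp : IsStarProjection Tp)
    (hd₁ : IsSLData Tm Tp a₁ b₁ V₁ R₁) (hd₂ : IsSLData Tm Tp a₂ b₂ V₂ R₂)
    {f₁ ψ₁ φ₁ χ₁ f₂ ψ₂ φ₂ χ₂ : ℝ → CVec N}
    (h₁ : IsSLSolution Tm Tp a₁ b₁ V₁ μ f₁ ψ₁ φ₁ χ₁)
    (h₂ : IsSLSolution Tm Tp a₂ b₂ V₂ μ f₂ ψ₂ φ₂ χ₂)
    (hf₁ : IntegrableOn f₁ (Icc 0 1)) (hf₂ : IntegrableOn f₂ (Icc 0 1)) :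
    (∫ x in Icc (0 : ℝ) 1, inner ℂ (ψ₁ x) (f₂ x)) - ∫ x in Icc (0 : ℝ) 1, inner ℂ (f₁ x) (ψ₂ x)
      = (∫ x in Icc (0 : ℝ) 1, inner ℂ (ψ₁ x) ((V₂ x - V₁ x) (ψ₂ x)))
        + inner ℂ (ψ₁ 0) ((a₂ - a₁) (ψ₂ 0)) + inner ℂ (ψ₁ 1) ((b₂ - b₁) (ψ₂ 1)) := by
  have p1 := h₁.hasSecondDeriv.isPrimitive
  have p1' := h₁.hasSecondDeriv.isPrimitive_deriv
  have p2 := h₂.hasSecondDeriv.isPrimitive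
  have p2' := h₂.hasSecondDeriv.isPrimitive_deriv
  have hA := (p1'.inner p2).integral_Icc
  have hB := (p1.inner p2').integral_Icc
  have hi : IntegrableOn (fun x => inner ℂ (ψ₁ x) ((V₂ x - V₁ x) (ψ₂ x))) (Icc 0 1) :=
    integrableOn_inner_right
      (integrableOn_potential_apply (hd₂.integrable.sub hd₁.integrable) p2.continuousOn)
      p1.continuousOn
  have hl := integrableOn_inner_left hf₁ p2.continuousOn
  have hr := integrableOn_inner_right hf₂ p1.continuousOn
  have hsub := integral_sub (p1'.inner p2).integrable (p1.inner p2').integrable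
  have hE : ∫ x in Icc (0 : ℝ) 1, ((inner ℂ (χ₁ x) (ψ₂ x) + inner ℂ (φ₁ x) (φ₂ x))
        - (inner ℂ (φ₁ x) (φ₂ x) + inner ℂ (ψ₁ x) (χ₂ x)))
      = ∫ x in Icc (0 : ℝ) 1, (inner ℂ (ψ₁ x) (f₂ x) - inner ℂ (f₁ x) (ψ₂ x)
        - inner ℂ (ψ₁ x) ((V₂ x - V₁ x) (ψ₂ x))) := by
    refine integral_congr_ae ?_
    filter_upwards [h₁.eq, h₂.eq, hd₁.selfAdjoint] with x e₁ e₂ hs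
    rw [e₁, e₂]
    simp only [inner_sub_left, inner_sub_right, COp.inner_apply_left hs, sub_apply,
      real_smul_inner_left, real_smul_inner_right]
    ring
  have hsub' := integral_sub (hr.sub hl) hi
  simp only [Pi.sub_apply] at hsub'
  rw [hsub', integral_sub hr hl] at hE
  rw [hA, hB, hE] at hsub
  obtain ⟨c₁, c₁'⟩ := (boundaryMinus_eq_zero_iff hTm hd₁.compress_left).mp h₁.minus
  obtain ⟨c₂, c₂'⟩ := (boundaryMinus_eq_zero_iff hTm hd₂.compress_left).mp h₂.minus
  obtain ⟨k₁, k₁'⟩ := (boundaryPlus_eq_zero_iff hTp hd₁.compress_right).mp h₁.plus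
  obtain ⟨k₂, k₂'⟩ := (boundaryPlus_eq_zero_iff hTp hd₂.compress_right).mp h₂.plus
  -- At each end the other function lies in the kernel of the projector, so only the component of
  -- the derivative in the complementary range enters, and there it is `a ψ` or `-b ψ`.
  have i1 : inner ℂ (φ₁ 0) (ψ₂ 0) = inner ℂ (ψ₁ 0) (a₁ (ψ₂ 0)) := by
    rw [inner_boundary_left hTm c₁' c₂, COp.inner_apply_left hd₁.selfAdjoint_left]
  have i2 : inner ℂ (ψ₁ 0) (φ₂ 0) = inner ℂ (ψ₁ 0) (a₂ (ψ₂ 0)) := by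
    rw [← inner_conj_symm, inner_boundary_left hTm c₂' c₁, inner_conj_symm]
  have i3 : inner ℂ (φ₁ 1) (ψ₂ 1) = -inner ℂ (ψ₁ 1) (b₁ (ψ₂ 1)) := by
    rw [inner_boundary_left (a := -b₁) hTp k₁' k₂, neg_apply, inner_neg_left,
      COp.inner_apply_left hd₁.selfAdjoint_right]
  have i4 : inner ℂ (ψ₁ 1) (φ₂ 1) = -inner ℂ (ψ₁ 1) (b₂ (ψ₂ 1)) := by
    rw [← inner_conj_symm, inner_boundary_left (a := -b₂) hTp k₂' k₁, neg_apply, inner_conj_symm,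
      inner_neg_right]
  rw [i1, i2, i3, i4] at hsub
  simp only [sub_apply, inner_sub_right] at hsub ⊢
  linear_combination hsub

/-- The energy estimate: the spectrum is bounded below. -/
theorem IsSLSolution.energy_le {Tm Tp a b : COp N} {V : ℝ → COp N} {R μ : ℝ}
    (hTm : IsStarProjection Tm) (hTp : IsStarProjection Tp) (hd : IsSLData Tm Tp a b V R)
    {ψ φ χ : ℝ → CVec N} (h : IsSLSolution Tm Tp a b V μ (fun _ => 0) ψ φ χ) :
    ∫ x in Icc (0 : ℝ) 1, ‖φ x‖ ^ 2
      ≤ (3 * R + 1) * (μ + 3 * R * (3 * R + 2)) * ∫ x in Icc (0 : ℝ) 1, ‖ψ x‖ ^ 2 := by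
  have hR := hd.nonneg
  have p := h.hasSecondDeriv.isPrimitive
  have p' := h.hasSecondDeriv.isPrimitive_deriv
  have cψ := p.continuousOn
  have cφ := p'.continuousOn
  have iψ : IntegrableOn (fun x => ‖ψ x‖ ^ 2) (Icc 0 1) := (cψ.norm.pow 2).integrableOn_Icc
  have iφ : IntegrableOn (fun x => ‖φ x‖ ^ 2) (Icc 0 1) := (cφ.norm.pow 2).integrableOn_Icc
  set S := ∫ x in Icc (0 : ℝ) 1, ‖ψ x‖ ^ 2
  set P := ∫ x in Icc (0 : ℝ) 1, ‖φ x‖ ^ 2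
  have hP0 : 0 ≤ P := integral_nonneg fun _ => by positivity
  have hS0 : 0 ≤ S := integral_nonneg fun _ => by positivity
  obtain ⟨x₀, hx₀, hmax⟩ := isCompact_Icc.exists_isMaxOn (nonempty_Icc.mpr zero_le_one) cψ.norm
  obtain ⟨y₀, hy₀, hmin⟩ := isCompact_Icc.exists_isMinOn (nonempty_Icc.mpr zero_le_one) cψ.norm
  have hM : ∀ x ∈ Icc (0 : ℝ) 1, ‖ψ x‖ ≤ ‖ψ x₀‖ := fun x hx => hmax hx
  -- the supremum is controlled by the energy
  have hsup : ‖ψ x₀‖ ^ 2 ≤ (3 * R + 2) * S + (3 * R + 1)⁻¹ * P := by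
    have h1 : ‖ψ y₀‖ ^ 2 ≤ S := by
      have : ∫ _ in Icc (0 : ℝ) 1, ‖ψ y₀‖ ^ 2 ≤ S := by
        refine setIntegral_mono_on (integrable_const _) iψ measurableSet_Icc fun x hx => ?_
        have : ‖ψ y₀‖ ≤ ‖ψ x‖ := hmin hx
        gcongr
      simpa using this
    have hq := (p.inner p)
    -- The minimum of `‖ψ‖²` is at most its mean, and the oscillation is bounded by `2 ∫ ‖ψ‖ ‖φ‖`.
    -- Young's inequality is used with weight `3R + 1`, so that `3R` times the supremum bound
    -- contains less than the full kinetic energy.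
    have h2 : ‖ψ x₀‖ ^ 2 - ‖ψ y₀‖ ^ 2 ≤ (3 * R + 1) * S + (3 * R + 1)⁻¹ * P := by
      have e := hq.sub_eq hy₀ hx₀
      have e1 : ((‖ψ x₀‖ ^ 2 - ‖ψ y₀‖ ^ 2 : ℝ) : ℂ)
          = ∫ t in y₀..x₀, (inner ℂ (φ t) (ψ t) + inner ℂ (ψ t) (φ t)) := by
        rw [← e, inner_self_eq_norm_sq_to_K, inner_self_eq_norm_sq_to_K]
        simp
      have e2 : ‖ψ x₀‖ ^ 2 - ‖ψ y₀‖ ^ 2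
          ≤ ‖∫ t in y₀..x₀, (inner ℂ (φ t) (ψ t) + inner ℂ (ψ t) (φ t))‖ := by
        rw [← e1, Complex.norm_real]
        exact le_abs_self _
      refine e2.trans ?_
      have iφψ : IntegrableOn (fun t => (3 * R + 1) * ‖ψ t‖ ^ 2 + (3 * R + 1)⁻¹ * ‖φ t‖ ^ 2)
          (Icc 0 1) := (iψ.const_mul _).add (iφ.const_mul _)
      have e3 : ∫ t in Icc (0 : ℝ) 1, ((3 * R + 1) * ‖ψ t‖ ^ 2 + (3 * R + 1)⁻¹ * ‖φ t‖ ^ 2)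
          = (3 * R + 1) * S + (3 * R + 1)⁻¹ * P := by
        rw [integral_add (iψ.const_mul _) (iφ.const_mul _), integral_const_mul,
          integral_const_mul]
      rw [← e3]
      refine intervalIntegral.norm_integral_le_integral_norm_uIoc.trans ?_
      have hsub : uIoc y₀ x₀ ⊆ Icc (0 : ℝ) 1 := uIoc_subset_uIcc.trans (uIcc_subset_Icc hy₀ hx₀)
      refine (setIntegral_mono_set hq.integrable.norm (.of_forall fun _ => norm_nonneg _)
        hsub.eventuallyLE).trans ?_
      refine integral_mono hq.integrable.norm iφψ fun t => ?_
      have n1 := norm_inner_le_norm (𝕜 := ℂ) (φ t) (ψ t)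
      have n2 := norm_inner_le_norm (𝕜 := ℂ) (ψ t) (φ t)
      have n3 := norm_add_le (inner ℂ (φ t) (ψ t)) (inner ℂ (ψ t) (φ t))
      have hc : 0 < 3 * R + 1 := by linarith
      have n4 : 2 * (‖ψ t‖ * ‖φ t‖) ≤ (3 * R + 1) * ‖ψ t‖ ^ 2 + (3 * R + 1)⁻¹ * ‖φ t‖ ^ 2 := by
        have h5 : (3 * R + 1) * ‖ψ t‖ ^ 2 + (3 * R + 1)⁻¹ * ‖φ t‖ ^ 2 - 2 * (‖ψ t‖ * ‖φ t‖)
            = (3 * R + 1)⁻¹ * ((3 * R + 1) * ‖ψ t‖ - ‖φ t‖) ^ 2 := by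
          field_simp; ring
        have h6 : 0 ≤ (3 * R + 1)⁻¹ * ((3 * R + 1) * ‖ψ t‖ - ‖φ t‖) ^ 2 := by positivity
        linarith
      simp only []
      linarith
    linarith
  -- the form identity
  obtain ⟨c, c'⟩ := (boundaryMinus_eq_zero_iff hTm hd.compress_left).mp h.minus
  obtain ⟨k, k'⟩ := (boundaryPlus_eq_zero_iff hTp hd.compress_right).mp h.plus
  have hI := (p'.inner p).integral_Icc
  rw [inner_boundary_left hTm c' c, inner_boundary_left (a := -b) hTp k' k] at hI
  have iV : IntegrableOn (fun x => inner ℂ (V x (ψ x)) (ψ x)) (Icc 0 1) :=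
    integrableOn_inner_left (integrableOn_potential_apply hd.integrable cψ) cψ
  have hI2 : ∫ x in Icc (0 : ℝ) 1, (inner ℂ (χ x) (ψ x) + inner ℂ (φ x) (φ x))
      = (∫ x in Icc (0 : ℝ) 1, inner ℂ (V x (ψ x)) (ψ x)) + ((P - μ * S : ℝ) : ℂ) := by
    have e4 : ((P - μ * S : ℝ) : ℂ)
        = ∫ x in Icc (0 : ℝ) 1, ((‖φ x‖ ^ 2 - μ * ‖ψ x‖ ^ 2 : ℝ) : ℂ) := by
      rw [integral_complex_ofReal, integral_sub iφ (iψ.const_mul μ), integral_const_mul]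
    rw [e4, ← integral_add iV (by exact (iφ.sub (iψ.const_mul μ)).ofReal)]
    refine integral_congr_ae ?_
    filter_upwards [h.eq] with x e
    rw [e]
    simp only [inner_sub_left, real_smul_inner_left, sub_zero]
    rw [inner_self_eq_norm_sq_to_K, inner_self_eq_norm_sq_to_K]
    push_cast
    simp only [Complex.coe_algebraMap]
    ring
  rw [hI2] at hI
  set M := ‖ψ x₀‖
  have nA : ‖inner ℂ (a (ψ 0)) (ψ 0)‖ ≤ R * M ^ 2 := by
    refine (norm_inner_le_norm _ _).trans ?_
    have h1 := (a.le_opNorm (ψ 0))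
    have h2 := hM 0 (by simp)
    calc _ ≤ (‖a‖ * ‖ψ 0‖) * ‖ψ 0‖ := by gcongr
      _ ≤ (R * M) * M := by
        have := hd.norm_left
        gcongr
      _ = _ := by ring
  have nB : ‖inner ℂ (b (ψ 1)) (ψ 1)‖ ≤ R * M ^ 2 := by
    refine (norm_inner_le_norm _ _).trans ?_
    have h1 := (b.le_opNorm (ψ 1))
    have h2 := hM 1 (by simp)
    calc _ ≤ (‖b‖ * ‖ψ 1‖) * ‖ψ 1‖ := by gcongr
      _ ≤ (R * M) * M := by
        have := hd.norm_right
        gcongr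
      _ = _ := by ring
  have nV : ‖∫ x in Icc (0 : ℝ) 1, inner ℂ (V x (ψ x)) (ψ x)‖ ≤ R * M ^ 2 := by
    refine (norm_integral_le_integral_norm _).trans ?_
    have h1 := integral_norm_potential_apply_le hd.integrable hd.integral_le cψ hM
    calc _ ≤ ∫ x in Icc (0 : ℝ) 1, ‖V x (ψ x)‖ * M := by
          refine setIntegral_mono_on iV.norm
            ((integrableOn_potential_apply hd.integrable cψ).norm.mul_const M) measurableSet_Icc
            fun x hx => ?_
          exact (norm_inner_le_norm _ _).trans (by gcongr; exact hM x hx)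
      _ ≤ (R * M) * M := by
          rw [integral_mul_const]; gcongr
      _ = _ := by ring
  -- The three terms from `a`, `b` and `V` each cost `R M²`.
  have hfin : P - μ * S ≤ 3 * (R * M ^ 2) := by
    have e5 : ((P - μ * S : ℝ) : ℂ) = inner ℂ ((-b) (ψ 1)) (ψ 1) - inner ℂ (a (ψ 0)) (ψ 0)
        - ∫ x in Icc (0 : ℝ) 1, inner ℂ (V x (ψ x)) (ψ x) := by
      linear_combination hI
    calc P - μ * S ≤ ‖((P - μ * S : ℝ) : ℂ)‖ := by
          rw [Complex.norm_real]; exact le_abs_self _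
      _ ≤ _ := by
          rw [e5, neg_apply, inner_neg_left]
          refine (norm_sub_le _ _).trans ?_
          have := norm_sub_le (-inner ℂ (b (ψ 1)) (ψ 1)) (inner ℂ (a (ψ 0)) (ψ 0))
          rw [norm_neg] at this
          linarith
  have hc : 0 < 3 * R + 1 := by linarith
  have hR2 : 3 * (R * M ^ 2) ≤ 3 * R * ((3 * R + 2) * S + (3 * R + 1)⁻¹ * P) := by
    rw [← mul_assoc]
    gcongr
  -- The fraction `3R / (3R + 1)` of the kinetic energy is absorbed and `(3R + 1)⁻¹` of it remains.
  have e6 : P - 3 * R * ((3 * R + 1)⁻¹ * P) = (3 * R + 1)⁻¹ * P := by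
    field_simp; ring
  have h7 : (3 * R + 1)⁻¹ * P ≤ (μ + 3 * R * (3 * R + 2)) * S := by linarith
  rw [inv_mul_le_iff₀ hc] at h7
  linarith

end

/-! ### Negative eigenvalues of compact symmetric operators. -/

section SpectralCounting

set_option linter.unusedSectionVars false

variable {H : Type*} [NormedAddCommGroup H] [InnerProductSpace ℂ H]

theorem finrank_finset_sup_of_pairwise_isOrtho {ι : Type*} (E : ι → Submodule ℂ H)
    (ho : Pairwise fun i j => E i ⟂ E j) (s : Finset ι) (hf : ∀ i ∈ s, FiniteDimensional ℂ (E i)) :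
    FiniteDimensional ℂ ↥(s.sup E) ∧
      Module.finrank ℂ ↥(s.sup E) = ∑ i ∈ s, Module.finrank ℂ (E i) := by
  classical
  induction s using Finset.induction_on with
  | empty =>
    rw [Finset.sup_empty]
    exact ⟨inferInstance, by simp⟩
  | insert a s ha ih =>
    obtain ⟨h1, h2⟩ := ih fun i hi => hf i (Finset.mem_insert_of_mem hi)
    have h3 := hf a (Finset.mem_insert_self a s)
    have hd : E a ⟂ s.sup E := by
      rw [Finset.sup_eq_iSup]
      simp only [Submodule.isOrtho_iSup_right]
      intro i hi
      exact ho (by rintro rfl; exact ha hi)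
    rw [Finset.sup_insert, Finset.sum_insert ha]
    refine ⟨inferInstance, ?_⟩
    have := Submodule.finrank_sup_add_finrank_inf_eq (E a) (s.sup E)
    rw [hd.disjoint.eq_bot, finrank_bot, add_zero, h2] at this
    exact this

variable [CompleteSpace H]

/-- The eigenspace of `K` for a real number. -/
def realEigenspace (K : H →L[ℂ] H) (ν : ℝ) : Submodule ℂ H :=
  Module.End.eigenspace (K : Module.End ℂ H) (ν : ℂ)

theorem mem_realEigenspace {K : H →L[ℂ] H} {ν : ℝ} {x : H} :
    x ∈ realEigenspace K ν ↔ K x = (ν : ℂ) • x := Module.End.mem_eigenspace_iff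

theorem pairwise_isOrtho_realEigenspace {K : H →L[ℂ] H} (hK : K.IsSymmetric) :
    Pairwise fun ν ν' => realEigenspace K ν ⟂ realEigenspace K ν' := by
  intro ν ν' hne
  rw [Submodule.isOrtho_iff_inner_eq]
  intro x hx y hy
  rw [mem_realEigenspace] at hx hy
  have h : inner ℂ (K x) y = inner ℂ x (K y) := hK x y
  rw [hx, hy, inner_smul_left, inner_smul_right, Complex.conj_ofReal, ← sub_eq_zero, ← sub_mul] at h
  refine (mul_eq_zero.mp h).resolve_left ?_
  exact_mod_cast sub_ne_zero.mpr hne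

/-- The span of the eigenspaces of `K` with eigenvalue in `I`. -/
def spectralSpan (K : H →L[ℂ] H) (I : Set ℝ) : Submodule ℂ H := ⨆ ν ∈ I, realEigenspace K ν

/-- Eigenvectors for different real eigenvalues are orthogonal, so the norm and the quadratic form
are diagonal on finite sums. Bounds for the form follow on the span and pass to its closure by
continuity. -/
theorem exists_sum_of_mem_spectralSpan {K : H →L[ℂ] H} (hK : K.IsSymmetric) {I : Set ℝ} {x : H}
    (hx : x ∈ spectralSpan K I) : ∃ (s : Finset ℝ) (f : ℝ → H), (∀ ν ∈ s, ν ∈ I) ∧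
      (∀ ν, f ν ∈ realEigenspace K ν) ∧ ‖x‖ ^ 2 = ∑ ν ∈ s, ‖f ν‖ ^ 2 ∧
      (inner ℂ (K x) x).re = ∑ ν ∈ s, ν * ‖f ν‖ ^ 2 := by
  rw [spectralSpan, iSup_subtype', Submodule.mem_iSup_iff_exists_finsupp] at hx
  obtain ⟨g, hg, rfl⟩ := hx
  classical
  let f : ℝ → H := fun ν => if h : ν ∈ I then g ⟨ν, h⟩ else 0
  have hf : ∀ ν, f ν ∈ realEigenspace K ν := by
    intro ν
    by_cases h : ν ∈ I
    · simpa [f, h] using hg ⟨ν, h⟩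
    · simp [f, h]
  have hs : (g.sum fun _ y => y) = ∑ ν ∈ g.support.map (Function.Embedding.subtype _), f ν := by
    rw [Finset.sum_map, Finsupp.sum]
    refine Finset.sum_congr rfl fun ν _ => ?_
    simp [f]
  refine ⟨g.support.map (Function.Embedding.subtype _), f, ?_, hf, ?_, ?_⟩
  · intro ν hν
    rw [Finset.mem_map] at hν
    obtain ⟨y, -, rfl⟩ := hν
    exact y.2
  · have hc : ((‖g.sum fun _ y => y‖ ^ 2 : ℝ) : ℂ)
        = ((∑ ν ∈ g.support.map (Function.Embedding.subtype _), ‖f ν‖ ^ 2 : ℝ) : ℂ) := by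
      push_cast
      have := inner_self_eq_norm_sq_to_K (𝕜 := ℂ) (g.sum fun _ y => y)
      refine this.symm.trans ?_
      rw [hs, sum_inner]
      refine Finset.sum_congr rfl fun ν hν => ?_
      rw [inner_sum, Finset.sum_eq_single ν]
      · exact inner_self_eq_norm_sq_to_K (f ν)
      · intro ν' _ hne
        exact (Submodule.isOrtho_iff_inner_eq.mp (pairwise_isOrtho_realEigenspace hK hne.symm))
          _ (hf ν) _ (hf ν')
      · exact fun h => absurd hν h
    exact_mod_cast hc
  · have hc : inner ℂ (K (g.sum fun _ y => y)) (g.sum fun _ y => y)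
        = ((∑ ν ∈ g.support.map (Function.Embedding.subtype _), ν * ‖f ν‖ ^ 2 : ℝ) : ℂ) := by
      push_cast
      rw [hs, map_sum, sum_inner]
      refine Finset.sum_congr rfl fun ν hν => ?_
      rw [mem_realEigenspace.mp (hf ν), inner_smul_left, Complex.conj_ofReal, inner_sum,
        Finset.sum_eq_single ν]
      · rw [inner_self_eq_norm_sq_to_K]; rfl
      · intro ν' _ hne
        exact (Submodule.isOrtho_iff_inner_eq.mp (pairwise_isOrtho_realEigenspace hK hne.symm))
          _ (hf ν) _ (hf ν')
      · exact fun h => absurd hν h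
    rw [hc, Complex.ofReal_re]

theorem re_inner_le_of_mem_closure_spectralSpan {K : H →L[ℂ] H} (hK : K.IsSymmetric) {I : Set ℝ}
    {c : ℝ} (hI : ∀ ν ∈ I, realEigenspace K ν ≠ ⊥ → ν ≤ c) {x : H}
    (hx : x ∈ (spectralSpan K I).topologicalClosure) : (inner ℂ (K x) x).re ≤ c * ‖x‖ ^ 2 := by
  have hcl : IsClosed {x : H | (inner ℂ (K x) x).re ≤ c * ‖x‖ ^ 2} :=
    isClosed_le (Complex.continuous_re.comp (K.continuous.inner continuous_id)) (by fun_prop)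
  refine (closure_minimal ?_ hcl) hx
  intro y hy
  obtain ⟨s, f, hs, hf, h1, h2⟩ := exists_sum_of_mem_spectralSpan hK hy
  rw [mem_ofPred_eq]
  rw [h1, h2, Finset.mul_sum]
  refine Finset.sum_le_sum fun ν hν => ?_
  by_cases h0 : f ν = 0
  · simp [h0]
  · have := hI ν (hs ν hν) ((Submodule.ne_bot_iff _).mpr ⟨_, hf ν, h0⟩)
    gcongr

theorem re_inner_ge_of_mem_closure_spectralSpan {K : H →L[ℂ] H} (hK : K.IsSymmetric) {I : Set ℝ}
    {c : ℝ} (hI : ∀ ν ∈ I, realEigenspace K ν ≠ ⊥ → c ≤ ν) {x : H}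
    (hx : x ∈ (spectralSpan K I).topologicalClosure) : c * ‖x‖ ^ 2 ≤ (inner ℂ (K x) x).re := by
  have hcl : IsClosed {x : H | c * ‖x‖ ^ 2 ≤ (inner ℂ (K x) x).re} :=
    isClosed_le (by fun_prop) (Complex.continuous_re.comp (K.continuous.inner continuous_id))
  refine (closure_minimal ?_ hcl) hx
  intro y hy
  obtain ⟨s, f, hs, hf, h1, h2⟩ := exists_sum_of_mem_spectralSpan hK hy
  rw [mem_ofPred_eq]
  rw [h1, h2, Finset.mul_sum]
  refine Finset.sum_le_sum fun ν hν => ?_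
  by_cases h0 : f ν = 0
  · simp [h0]
  · have := hI ν (hs ν hν) ((Submodule.ne_bot_iff _).mpr ⟨_, hf ν, h0⟩)
    gcongr

theorem spectralSpan_isOrtho {K : H →L[ℂ] H} (hK : K.IsSymmetric) {I J : Set ℝ}
    (h : Disjoint I J) : spectralSpan K I ⟂ spectralSpan K J := by
  simp only [spectralSpan, Submodule.isOrtho_iSup_left, Submodule.isOrtho_iSup_right]
  intro ν hν ν' hν'
  exact pairwise_isOrtho_realEigenspace hK (by rintro rfl; exact h.notMem_of_mem_left hν' hν)

/-- The eigenvectors of a compact symmetric operator are total and its eigenvalues are real. After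
projection to the closed span for `Iᶜ`, the remainder is orthogonal to all eigenspaces and hence
zero. -/
theorem orthogonal_spectralSpan_le {K : H →L[ℂ] H} (hK : K.IsSymmetric)
    (hc : IsCompactOperator K) (I : Set ℝ) :
    (spectralSpan K I)ᗮ ≤ (spectralSpan K Iᶜ).topologicalClosure := by
  set V := (spectralSpan K Iᶜ).topologicalClosure with hV
  have hVc : CompleteSpace V := (Submodule.isClosed_topologicalClosure _).completeSpace_coe
  have hVo : V ≤ (spectralSpan K I)ᗮ := by
    refine Submodule.topologicalClosure_minimal _ ?_ (Submodule.isClosed_orthogonal _)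
    exact (spectralSpan_isOrtho hK (disjoint_compl_right (a := I))).symm
  have htop : (⨆ μ : ℂ, Module.End.eigenspace (K : Module.End ℂ H) μ)
      ≤ spectralSpan K I ⊔ spectralSpan K Iᶜ := by
    refine iSup_le fun μ => ?_
    by_cases hμ : Module.End.eigenspace (K : Module.End ℂ H) μ = ⊥
    · rw [hμ]; exact bot_le
    have hr := LinearMap.IsSymmetric.conj_eigenvalue_eq_self hK (μ := μ) hμ
    obtain ⟨ν, rfl⟩ := Complex.conj_eq_iff_real.mp hr
    by_cases hν : ν ∈ I
    · exact le_sup_of_le_left (le_iSup₂_of_le ν hν le_rfl)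
    · exact le_sup_of_le_right (le_iSup₂_of_le (f := fun ν _ => realEigenspace K ν) ν hν le_rfl)
  intro x hx
  have h1 : x - V.starProjection x ∈ (spectralSpan K I)ᗮ :=
    Submodule.sub_mem _ hx (hVo (Submodule.starProjection_apply_mem V x))
  have h2 : x - V.starProjection x ∈ Vᗮ := Submodule.sub_starProjection_mem_orthogonal x
  have h3 : x - V.starProjection x ∈ (spectralSpan K Iᶜ)ᗮ :=
    Submodule.orthogonal_le (Submodule.le_topologicalClosure _) h2
  have h4 : x - V.starProjection x ∈ (spectralSpan K I ⊔ spectralSpan K Iᶜ)ᗮ := by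
    rw [← Submodule.inf_orthogonal]; exact ⟨h1, h3⟩
  have h5 := Submodule.orthogonal_le htop h4
  rw [ContinuousLinearMap.orthogonalComplement_iSup_eigenspaces_eq_bot hc hK] at h5
  rw [sub_eq_zero.mp ((Submodule.mem_bot ℂ).mp h5)]
  exact Submodule.starProjection_apply_mem V x

theorem re_inner_nonneg_of_mem_orthogonal {K : H →L[ℂ] H} (hK : K.IsSymmetric)
    (hc : IsCompactOperator K) {x : H} (hx : x ∈ (spectralSpan K (Iio 0))ᗮ) :
    0 ≤ (inner ℂ (K x) x).re := by
  have := re_inner_ge_of_mem_closure_spectralSpan (c := 0) hK (fun ν hν _ => not_lt.mp hν)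
    (orthogonal_spectralSpan_le hK hc (Iio 0) hx)
  simpa using this

/-- On the closed negative span, which is invariant, the form is at most `-η‖x‖²`, so `K` is bounded
below there. An operator that is both compact and bounded below forces the unit ball to be compact.
-/
theorem finiteDimensional_spectralSpan {K : H →L[ℂ] H} (hK : K.IsSymmetric)
    (hc : IsCompactOperator K) {η : ℝ} (hη : 0 < η)
    (hgap : ∀ ν < 0, realEigenspace K ν ≠ ⊥ → ν ≤ -η) :
    FiniteDimensional ℂ (spectralSpan K (Iio 0)) := by
  set X := (spectralSpan K (Iio 0)).topologicalClosure with hX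
  have hXc : CompleteSpace X := (Submodule.isClosed_topologicalClosure _).completeSpace_coe
  have hinv : ∀ x ∈ X, K x ∈ X := by
    have h0 : spectralSpan K (Iio 0) ≤ (spectralSpan K (Iio 0)).comap (K : H →ₗ[ℂ] H) := by
      refine iSup₂_le fun ν hν x hx => ?_
      change K x ∈ spectralSpan K (Iio 0)
      rw [mem_realEigenspace.mp hx]
      exact Submodule.smul_mem _ _
        ((le_iSup₂_of_le (f := fun ν _ => realEigenspace K ν) ν hν le_rfl :
          realEigenspace K ν ≤ spectralSpan K (Iio 0)) hx)
    intro x hx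
    exact map_mem_closure K.continuous hx fun y hy => h0 hy
  let T : X →L[ℂ] X := K.restrict hinv
  have hT : IsCompactOperator T := IsCompactOperator.restrict' (f := (K : H →ₗ[ℂ] H)) hc hinv
  have hbd : ∀ x : X, ‖x‖ ≤ η⁻¹ * ‖T x‖ := by
    intro x
    have h1 := re_inner_le_of_mem_closure_spectralSpan hK (I := Iio 0) (c := -η) hgap x.2
    have h2 : -(inner ℂ (K x) (x : H)).re ≤ ‖K x‖ * ‖(x : H)‖ :=
      (neg_le_abs _).trans ((Complex.abs_re_le_norm _).trans (norm_inner_le_norm _ _))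
    have h3 : η * ‖(x : H)‖ ^ 2 ≤ ‖K x‖ * ‖(x : H)‖ := by linarith
    change ‖(x : H)‖ ≤ η⁻¹ * ‖K x‖
    rw [le_inv_mul_iff₀ hη]
    by_cases h0 : ‖(x : H)‖ = 0
    · rw [h0]; simp
    · have hpos : 0 < ‖(x : H)‖ := lt_of_le_of_ne (norm_nonneg _) (Ne.symm h0)
      refine le_of_mul_le_mul_right ?_ hpos
      linarith
  have hanti : AntilipschitzWith (η⁻¹).toNNReal T := by
    refine ContinuousLinearMap.antilipschitz_of_bound T fun x => ?_
    rw [Real.coe_toNNReal _ (inv_pos.mpr hη).le]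
    exact hbd x
  have hemb := hanti.isClosedEmbedding T.uniformContinuous
  obtain ⟨C, hC, hCs⟩ := hT.image_closedBall_subset_compact (f := (T : X →ₗ[ℂ] X)) 1
  have hcomp : IsCompact (Metric.closedBall (0 : X) 1) := by
    refine (hemb.isCompact_preimage hC).of_isClosed_subset Metric.isClosed_closedBall ?_
    intro x hx
    exact hCs ⟨x, hx, rfl⟩
  have hfin : FiniteDimensional ℂ X := FiniteDimensional.of_isCompact_closedBall ℂ one_pos hcomp
  exact Submodule.finiteDimensional_of_le (Submodule.le_topologicalClosure _)

/-- The number of negative eigenvalues is stable under perturbations which are small with respect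
to the spectral gap. -/
theorem finrank_spectralSpan_le {K K' : H →L[ℂ] H} (hK : K.IsSymmetric) (hK' : K'.IsSymmetric)
    (hc : IsCompactOperator K) (hc' : IsCompactOperator K') {η δ : ℝ} (hη : 0 < η) (hδ : δ < η)
    (hgap : ∀ ν < 0, realEigenspace K ν ≠ ⊥ → ν ≤ -η)
    (hgap' : ∀ ν < 0, realEigenspace K' ν ≠ ⊥ → ν ≤ -η)
    (hdiff : ∀ x, (inner ℂ (K' x) x).re - (inner ℂ (K x) x).re ≤ δ * ‖x‖ ^ 2) :
    Module.finrank ℂ (spectralSpan K (Iio 0)) ≤ Module.finrank ℂ (spectralSpan K' (Iio 0)) := by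
  have h1 := finiteDimensional_spectralSpan hK hc hη hgap
  have h2 := finiteDimensional_spectralSpan hK' hc' hη hgap'
  -- If the dimension dropped, some nonzero vector of the negative span of `K` would be orthogonal
  -- to that of `K'`. There the form of `K` is at most `-η‖x‖²` and that of `K'` is nonnegative,
  -- although they differ by at most `δ‖x‖²` with `δ < η`.
  by_contra hlt
  rw [not_le] at hlt
  let W' := spectralSpan K' (Iio 0)
  let f : spectralSpan K (Iio 0) →ₗ[ℂ] W' :=
    (W'.orthogonalProjectionOnto : H →ₗ[ℂ] W') ∘ₗ (spectralSpan K (Iio 0)).subtype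
  obtain ⟨x, hx, hx0⟩ := (Submodule.ne_bot_iff _).mp (f.ker_ne_bot_of_finrank_lt hlt)
  have hxo : (x : H) ∈ W'ᗮ := by
    rw [← Submodule.orthogonalProjectionOnto_eq_zero_iff]
    exact hx
  have e1 := re_inner_le_of_mem_closure_spectralSpan hK (I := Iio 0) (c := -η) hgap
    (Submodule.le_topologicalClosure _ x.2)
  have e2 := re_inner_nonneg_of_mem_orthogonal hK' hc' hxo
  have e3 := hdiff x
  have hpos : 0 < ‖(x : H)‖ := norm_pos_iff.mpr (by simpa using hx0)
  have : 0 < (η - δ) * ‖(x : H)‖ ^ 2 := mul_pos (by linarith) (by positivity)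
  linarith

/-- The negative eigenvalues form a finite set, and their multiplicities add up to the dimension
of the span of their eigenspaces. -/
theorem exists_finset_negative_eigenvalues {K : H →L[ℂ] H} (hK : K.IsSymmetric)
    (hc : IsCompactOperator K) {η : ℝ} (hη : 0 < η)
    (hgap : ∀ ν < 0, realEigenspace K ν ≠ ⊥ → ν ≤ -η) :
    ∃ S : Finset ℝ, (∀ ν, ν ∈ S ↔ ν < 0 ∧ realEigenspace K ν ≠ ⊥) ∧
      (∀ ν ∈ S, FiniteDimensional ℂ (realEigenspace K ν)) ∧
      ∑ ν ∈ S, Module.finrank ℂ (realEigenspace K ν)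
        = Module.finrank ℂ (spectralSpan K (Iio 0)) := by
  have hW := finiteDimensional_spectralSpan hK hc hη hgap
  have hle : ∀ ν < 0, realEigenspace K ν ≤ spectralSpan K (Iio 0) := fun ν hν =>
    le_iSup₂_of_le (f := fun ν _ => realEigenspace K ν) ν hν le_rfl
  have hfd : ∀ ν < 0, FiniteDimensional ℂ (realEigenspace K ν) := fun ν hν =>
    Submodule.finiteDimensional_of_le (hle ν hν)
  -- Distinct eigenvalues contribute orthogonal nonzero subspaces, so there are no more of them than
  -- the dimension of the negative span.
  have hfin : {ν : ℝ | ν < 0 ∧ realEigenspace K ν ≠ ⊥}.Finite := by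
    by_contra hinf
    obtain ⟨t, hts, htc⟩ := Set.Infinite.exists_subset_card_eq hinf
      (Module.finrank ℂ (spectralSpan K (Iio 0)) + 1)
    have hft : ∀ ν ∈ t, FiniteDimensional ℂ (realEigenspace K ν) := fun ν hν => hfd ν (hts hν).1
    obtain ⟨-, h2⟩ := finrank_finset_sup_of_pairwise_isOrtho _
      (pairwise_isOrtho_realEigenspace hK) t hft
    have h3 : t.sup (realEigenspace K) ≤ spectralSpan K (Iio 0) :=
      Finset.sup_le fun ν hν => hle ν (hts hν).1
    have h4 := Submodule.finrank_mono h3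
    have h5 : t.card ≤ ∑ ν ∈ t, Module.finrank ℂ (realEigenspace K ν) := by
      rw [Finset.card_eq_sum_ones]
      refine Finset.sum_le_sum fun ν hν => ?_
      have := hft ν hν
      exact Submodule.one_le_finrank_iff.mpr (hts hν).2
    omega
  refine ⟨hfin.toFinset, fun ν => by simp, fun ν hν => hfd ν (by simpa using hν : _ ∧ _).1, ?_⟩
  rw [← (finrank_finset_sup_of_pairwise_isOrtho _ (pairwise_isOrtho_realEigenspace hK)
    hfin.toFinset fun ν hν => hfd ν (by simpa using hν : _ ∧ _).1).2]
  have hsup : hfin.toFinset.sup (realEigenspace K) = spectralSpan K (Iio 0) := by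
    refine le_antisymm (Finset.sup_le fun ν hν => hle ν (by simpa using hν : _ ∧ _).1) ?_
    change (⨆ ν ∈ Iio (0:ℝ), realEigenspace K ν) ≤ _
    refine iSup₂_le fun ν hν => ?_
    by_cases h0 : realEigenspace K ν = ⊥
    · rw [h0]; exact bot_le
    · exact Finset.le_sup (f := realEigenspace K) (by simpa using ⟨hν, h0⟩)
  rw [hsup]

end SpectralCounting

/-! ### Invariance of the eigenvalue count below a gap. -/

section

variable {N : ℕ} {Tm Tp a b a₁ b₁ a₂ b₂ : COp N} {V V₁ V₂ : ℝ → COp N} {R κ : ℝ}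

/-- Green's identity expresses the difference through `V₂ - V₁`, `a₂ - a₁` and `b₂ - b₁`. Each of
the three terms carries two solution bounds `50`, whence `7500 = 3 · 50²`. For equal data and `ε =
0` this is the symmetry of the inverse. -/
theorem IsResolvent.inner_sub_inner {K₁ K₂ : L2Vec N →L[ℂ] L2Vec N} (hTm : IsStarProjection Tm)
    (hTp : IsStarProjection Tp) (hd₁ : IsSLData Tm Tp a₁ b₁ V₁ R) (hd₂ : IsSLData Tm Tp a₂ b₂ V₂ R)
    (hκ : IsGapFrequency Tm Tp R κ) (hK₁ : IsResolvent Tm Tp a₁ b₁ V₁ κ K₁)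
    (hK₂ : IsResolvent Tm Tp a₂ b₂ V₂ κ K₂) {ε : ℝ} (ha : ‖a₂ - a₁‖ ≤ ε) (hb : ‖b₂ - b₁‖ ≤ ε)
    (hV : (∫ x in Icc (0 : ℝ) 1, ‖V₂ x - V₁ x‖) ≤ ε) (f g : L2Vec N) :
    ‖inner ℂ (K₁ f) g - inner ℂ f (K₂ g)‖ ≤ 7500 * ε * (‖f‖ * ‖g‖) := by
  obtain ⟨ψ₁, φ₁, χ₁, h₁, e₁⟩ := hK₁ f
  obtain ⟨ψ₂, φ₂, χ₂, h₂, e₂⟩ := hK₂ g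
  have n₁ : ∀ x ∈ Icc (0 : ℝ) 1, ‖ψ₁ x‖ ≤ 50 * ‖f‖ := fun x hx =>
    (h₁.norm_le hTm hTp hd₁ hκ f.integrableOn x hx).1.trans (by gcongr; exact f.integral_norm_le)
  have n₂ : ∀ x ∈ Icc (0 : ℝ) 1, ‖ψ₂ x‖ ≤ 50 * ‖g‖ := fun x hx =>
    (h₂.norm_le hTm hTp hd₂ hκ g.integrableOn x hx).1.trans (by gcongr; exact g.integral_norm_le)
  have g₁ : inner ℂ (K₁ f) g = ∫ x in Icc (0 : ℝ) 1, inner ℂ (ψ₁ x) (g x) := by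
    rw [L2.inner_def]
    exact integral_congr_ae (e₁.mono fun x hx => by simp only [hx])
  have g₂ : inner ℂ f (K₂ g) = ∫ x in Icc (0 : ℝ) 1, inner ℂ (f x) (ψ₂ x) := by
    rw [L2.inner_def]
    exact integral_congr_ae (e₂.mono fun x hx => by simp only [hx])
  rw [g₁, g₂, h₁.green hTm hTp hd₁ hd₂ h₂ f.integrableOn g.integrableOn]
  have hε : 0 ≤ ε := (norm_nonneg _).trans ha
  have hend : ∀ (A : COp N), ‖A‖ ≤ ε → ∀ x ∈ Icc (0 : ℝ) 1,
      ‖inner ℂ (ψ₁ x) (A (ψ₂ x))‖ ≤ 2500 * ε * (‖f‖ * ‖g‖) := by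
    intro A hA x hx
    calc _ ≤ ‖ψ₁ x‖ * (‖A‖ * ‖ψ₂ x‖) :=
          (norm_inner_le_norm _ _).trans (by gcongr; exact A.le_opNorm _)
      _ ≤ (50 * ‖f‖) * (ε * (50 * ‖g‖)) := by
          gcongr
          exacts [n₁ x hx, n₂ x hx]
      _ = _ := by ring
  have hVi : IntegrableOn (fun x => V₂ x - V₁ x) (Icc 0 1) := hd₂.integrable.sub hd₁.integrable
  have c₂ := h₂.hasSecondDeriv.isPrimitive.continuousOn
  have hint : ‖∫ x in Icc (0 : ℝ) 1, inner ℂ (ψ₁ x) ((V₂ x - V₁ x) (ψ₂ x))‖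
      ≤ 2500 * ε * (‖f‖ * ‖g‖) := by
    have hm : ∫ x in Icc (0 : ℝ) 1, ‖(V₂ x - V₁ x) (ψ₂ x)‖ ≤ ε * (50 * ‖g‖) :=
      integral_norm_potential_apply_le hVi hV c₂ n₂
    have hi := integrableOn_potential_apply hVi c₂
    calc _ ≤ ∫ x in Icc (0 : ℝ) 1, 50 * ‖f‖ * ‖(V₂ x - V₁ x) (ψ₂ x)‖ := by
          refine norm_integral_le_of_norm_le (hi.norm.const_mul _) ?_
          filter_upwards [ae_restrict_mem measurableSet_Icc] with x hx
          exact (norm_inner_le_norm _ _).trans (by gcongr; exact n₁ x hx)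
      _ ≤ 50 * ‖f‖ * (ε * (50 * ‖g‖)) := by
          rw [integral_const_mul]; gcongr
      _ = _ := by ring
  refine (norm_add₃_le).trans ?_
  have := hend _ ha 0 (by simp)
  have := hend _ hb 1 (by simp)
  linarith

theorem IsResolvent.isSymmetric {K : L2Vec N →L[ℂ] L2Vec N} (hTm : IsStarProjection Tm)
    (hTp : IsStarProjection Tp) (hd : IsSLData Tm Tp a b V R) (hκ : IsGapFrequency Tm Tp R κ)
    (hK : IsResolvent Tm Tp a b V κ K) : K.IsSymmetric := by
  intro f g
  have := hK.inner_sub_inner hTm hTp hd hd hκ hK (ε := 0) (by simp) (by simp) (by simp) f g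
  rw [mul_zero, zero_mul] at this
  exact sub_eq_zero.mp (norm_le_zero_iff.mp this)

theorem IsResolvent.re_inner_sub_le {K₁ K₂ : L2Vec N →L[ℂ] L2Vec N} (hTm : IsStarProjection Tm)
    (hTp : IsStarProjection Tp) (hd₁ : IsSLData Tm Tp a₁ b₁ V₁ R) (hd₂ : IsSLData Tm Tp a₂ b₂ V₂ R)
    (hκ : IsGapFrequency Tm Tp R κ) (hK₁ : IsResolvent Tm Tp a₁ b₁ V₁ κ K₁)
    (hK₂ : IsResolvent Tm Tp a₂ b₂ V₂ κ K₂) {ε : ℝ} (ha : ‖a₂ - a₁‖ ≤ ε) (hb : ‖b₂ - b₁‖ ≤ ε)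
    (hV : (∫ x in Icc (0 : ℝ) 1, ‖V₂ x - V₁ x‖) ≤ ε) (f : L2Vec N) :
    |(inner ℂ (K₁ f) f).re - (inner ℂ (K₂ f) f).re| ≤ 7500 * ε * ‖f‖ ^ 2 := by
  have h := hK₁.inner_sub_inner hTm hTp hd₁ hd₂ hκ hK₂ ha hb hV f f
  have hs : inner ℂ (K₂ f) f = inner ℂ f (K₂ f) := hK₂.isSymmetric hTm hTp hd₂ hκ f f
  rw [hs, ← Complex.sub_re, pow_two]
  exact (Complex.abs_re_le_norm _).trans h

theorem mem_sturmLiouvilleEigenspace_iff_homogeneous {μ : ℝ} {u : L2Vec N} :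
    u ∈ sturmLiouvilleEigenspace Tm Tp a b V μ ↔ ∃ ψ φ χ,
      IsSLSolution Tm Tp a b V μ (fun _ => 0) ψ φ χ ∧
        ∀ᵐ x ∂(volume.restrict (Icc (0 : ℝ) 1)), u x = ψ x := by
  constructor
  · rintro ⟨ψ, φ, χ, h, hm, hp, h1, h2⟩
    refine ⟨ψ, φ, χ, ⟨h, hm, hp, ?_⟩, h1⟩
    filter_upwards [h1, h2, Lp.coeFn_smul ((μ : ℂ)) u] with x e1 e2 e4
    simp only [LinearMap.prod_apply, LinearMap.smul_apply, LinearMap.id_apply,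
      Function.prod_apply] at e1 e2
    rw [e4, Pi.smul_apply, e1] at e2
    rw [← Complex.coe_smul μ, e2]
    abel
  · rintro ⟨ψ, φ, χ, h, h1⟩
    refine ⟨ψ, φ, χ, h.hasSecondDeriv, h.minus, h.plus, h1, ?_⟩
    filter_upwards [h1, h.eq, Lp.coeFn_smul ((μ : ℂ)) u] with x e1 e2 e4
    change ((μ : ℂ) • u : L2Vec N) x = _
    rw [e4, Pi.smul_apply, e1, e2, Complex.coe_smul]
    abel

theorem integral_norm_sq_pos {u : L2Vec N} (hu : u ≠ 0) {ψ : ℝ → CVec N}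
    (h : ∀ᵐ x ∂(volume.restrict (Icc (0 : ℝ) 1)), u x = ψ x) :
    0 < ∫ x in Icc (0 : ℝ) 1, ‖ψ x‖ ^ 2 := by
  have h1 : (∫ x in Icc (0 : ℝ) 1, ‖ψ x‖ ^ 2) = ‖u‖ ^ 2 := by
    have h2 : ((∫ x in Icc (0 : ℝ) 1, ‖ψ x‖ ^ 2 : ℝ) : ℂ) = ((‖u‖ ^ 2 : ℝ) : ℂ) := by
      have h3 : inner ℂ u u = ((‖u‖ ^ 2 : ℝ) : ℂ) := by
        push_cast; exact inner_self_eq_norm_sq_to_K u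
      rw [← h3, L2.inner_def, ← integral_complex_ofReal]
      refine integral_congr_ae (h.mono fun x hx => ?_)
      simp only [hx]
      push_cast
      exact (inner_self_eq_norm_sq_to_K (ψ x)).symm
    exact_mod_cast h2
  rw [h1]
  have := norm_pos_iff.mpr hu
  positivity

theorem le_of_sturmLiouvilleEigenspace_ne_bot (hTm : IsStarProjection Tm)
    (hTp : IsStarProjection Tp) (hd : IsSLData Tm Tp a b V R) {μ : ℝ}
    (h : sturmLiouvilleEigenspace Tm Tp a b V μ ≠ ⊥) : -(3 * R * (3 * R + 2)) ≤ μ := by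
  obtain ⟨u, hu, hu0⟩ := (Submodule.ne_bot_iff _).mp h
  obtain ⟨ψ, φ, χ, hs, he⟩ := mem_sturmLiouvilleEigenspace_iff_homogeneous.mp hu
  have h1 := hs.energy_le hTm hTp hd
  have h2 := integral_norm_sq_pos hu0 he
  have h3 : 0 ≤ ∫ x in Icc (0 : ℝ) 1, ‖φ x‖ ^ 2 := integral_nonneg fun x => by positivity
  have hR := hd.nonneg
  by_contra hlt
  rw [not_le] at hlt
  have h4 : (3 * R + 1) * (μ + 3 * R * (3 * R + 2)) * ∫ x in Icc (0 : ℝ) 1, ‖ψ x‖ ^ 2 < 0 :=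
    mul_neg_of_neg_of_pos (mul_neg_of_pos_of_neg (by positivity) (by linarith)) h2
  linarith

theorem IsResolvent.sturmLiouvilleEigenspace_eq {K : L2Vec N →L[ℂ] L2Vec N}
    (hTm : IsStarProjection Tm) (hTp : IsStarProjection Tp) (hd : IsSLData Tm Tp a b V R)
    (hκ : IsGapFrequency Tm Tp R κ) (hK : IsResolvent Tm Tp a b V κ K) {ν : ℝ} (hν : ν ≠ 0) :
    sturmLiouvilleEigenspace Tm Tp a b V (κ ^ 2 + ν⁻¹) = realEigenspace K ν := by
  rw [hK.eigenspace_eq hTm hTp hd hκ (by simpa using hν)]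
  simp [realEigenspace]

/-- An eigenvalue `ν < 0` of `K` comes from the eigenvalue `κ² + ν⁻¹` of `L`, which the energy
estimate bounds from below. The resulting distance from `0` depends only on `R` and `κ`, hence is
common to the whole homotopy. -/
theorem IsResolvent.le_of_realEigenspace_ne_bot {K : L2Vec N →L[ℂ] L2Vec N}
    (hTm : IsStarProjection Tm) (hTp : IsStarProjection Tp) (hd : IsSLData Tm Tp a b V R)
    (hκ : IsGapFrequency Tm Tp R κ) (hK : IsResolvent Tm Tp a b V κ K) :
    ∀ ν < 0, realEigenspace K ν ≠ ⊥ → ν ≤ -(3 * R * (3 * R + 2) + κ ^ 2)⁻¹ := by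
  intro ν hν h
  rw [← hK.sturmLiouvilleEigenspace_eq hTm hTp hd hκ hν.ne] at h
  have h1 := le_of_sturmLiouvilleEigenspace_ne_bot hTm hTp hd h
  have h2 : 0 < 3 * R * (3 * R + 2) + κ ^ 2 := by
    have := hd.nonneg
    have := hκ.four_le
    positivity
  have h3 : (-ν)⁻¹ ≤ 3 * R * (3 * R + 2) + κ ^ 2 := by
    rw [inv_neg]; linarith
  have h4 := (inv_le_comm₀ (by linarith) h2).mp h3
  linarith

theorem IsResolvent.hasEigenvalueCount {K : L2Vec N →L[ℂ] L2Vec N}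
    (hTm : IsStarProjection Tm) (hTp : IsStarProjection Tp) (hd : IsSLData Tm Tp a b V R)
    (hκ : IsGapFrequency Tm Tp R κ) (hK : IsResolvent Tm Tp a b V κ K) :
    HasEigenvalueCount Tm Tp a b V (Iio (κ ^ 2))
      (Module.finrank ℂ (spectralSpan K (Iio 0))) := by
  have hη : 0 < (3 * R * (3 * R + 2) + κ ^ 2)⁻¹ := by
    have := hd.nonneg
    have := hκ.four_le
    positivity
  obtain ⟨S, hS, hf, hsum⟩ := exists_finset_negative_eigenvalues (hK.isSymmetric hTm hTp hd hκ)
    (hK.isCompactOperator hTm hTp hd hκ) hη (hK.le_of_realEigenspace_ne_bot hTm hTp hd hκ)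
  have hneg : ∀ ν ∈ S, ν < 0 := fun ν hν => ((hS ν).mp hν).1
  have heq : ∀ ν ∈ S, sturmLiouvilleEigenspace Tm Tp a b V (κ ^ 2 + ν⁻¹) = realEigenspace K ν :=
    fun ν hν => hK.sturmLiouvilleEigenspace_eq hTm hTp hd hκ (hneg ν hν).ne
  classical
  refine ⟨S.image fun ν => κ ^ 2 + ν⁻¹, fun μ => ?_, ?_, ?_⟩
  · rw [Finset.mem_image]
    constructor
    · rintro ⟨ν, hν, rfl⟩
      rw [heq ν hν]
      refine ⟨?_, ((hS ν).mp hν).2⟩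
      have := inv_lt_zero.mpr (hneg ν hν)
      simpa using this
    · rintro ⟨h1, h2⟩
      rw [mem_Iio] at h1
      have h3 : (μ - κ ^ 2)⁻¹ < 0 := inv_lt_zero.mpr (by linarith)
      have h4 : κ ^ 2 + ((μ - κ ^ 2)⁻¹)⁻¹ = μ := by rw [inv_inv]; ring
      refine ⟨(μ - κ ^ 2)⁻¹, (hS _).mpr ⟨h3, ?_⟩, h4⟩
      rw [← hK.sturmLiouvilleEigenspace_eq hTm hTp hd hκ h3.ne, h4]
      exact h2
  · intro μ hμ
    obtain ⟨ν, hν, rfl⟩ := Finset.mem_image.mp hμ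
    rw [heq ν hν]
    exact hf ν hν
  · rw [Finset.sum_image (by
      intro x _ y _ hxy
      exact inv_injective (add_left_cancel hxy)), ← hsum]
    exact Finset.sum_congr rfl fun ν hν => by rw [heq ν hν]

theorem COp.real_smul_apply (t : ℝ) (A : COp N) (x : CVec N) : (t • A) x = t • A x := rfl

theorem COp.isSelfAdjoint_real_smul {A : COp N} (hA : IsSelfAdjoint A) (t : ℝ) :
    IsSelfAdjoint (t • A) := by
  rw [ContinuousLinearMap.isSelfAdjoint_iff_isSymmetric]
  intro x y
  change inner ℂ (t • A x) y = inner ℂ x (t • A y)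
  rw [real_smul_inner_left, real_smul_inner_right, COp.inner_apply_left hA]

theorem COp.real_smul_compress {A T : COp N} (h : A = T * A * T) (t : ℝ) :
    t • A = T * (t • A) * T := by
  refine ContinuousLinearMap.ext fun x => ?_
  have := congrArg (fun S : COp N => t • S x) h
  simpa only [mul_apply_eq_comp, COp.real_smul_apply, COp.map_real_smul] using this

theorem IsSLData.smul (hd : IsSLData Tm Tp a b V R) {t : ℝ} (ht0 : 0 ≤ t) (ht1 : t ≤ 1) :
    IsSLData Tm Tp (t • a) (t • b) (fun x => t • V x) R := by
  have hR := hd.nonneg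
  have hn : ∀ A : COp N, ‖A‖ ≤ R → ‖t • A‖ ≤ R := fun A hA => by
    rw [norm_smul, Real.norm_eq_abs, abs_of_nonneg ht0]
    exact (mul_le_of_le_one_left (norm_nonneg _) ht1).trans hA
  refine ⟨COp.isSelfAdjoint_real_smul hd.selfAdjoint_left t,
    COp.real_smul_compress hd.compress_left t, hn a hd.norm_left,
    COp.isSelfAdjoint_real_smul hd.selfAdjoint_right t,
    COp.real_smul_compress hd.compress_right t, hn b hd.norm_right,
    hd.integrable.smul t, hd.selfAdjoint.mono fun x hx => COp.isSelfAdjoint_real_smul hx t, ?_⟩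
  · simp only [norm_smul]
    rw [integral_const_mul, Real.norm_eq_abs, abs_of_nonneg ht0]
    exact (mul_le_of_le_one_left (integral_nonneg fun x => norm_nonneg _) ht1).trans hd.integral_le

/-- The number of eigenvalues below a gap does not depend on the data `V, a, b`. -/
theorem exists_hasEigenvalueCount_gap (hTm : IsStarProjection Tm) (hTp : IsStarProjection Tp)
    (hd : IsSLData Tm Tp a b V R) (hκ : IsGapFrequency Tm Tp R κ) :
    ∃ m, HasEigenvalueCount Tm Tp a b V (Iio (κ ^ 2)) m ∧
      HasEigenvalueCount Tm Tp 0 0 (fun _ => 0) (Iio (κ ^ 2)) m := by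
  have hR := hd.nonneg
  have hη : 0 < (3 * R * (3 * R + 2) + κ ^ 2)⁻¹ := by
    have := hκ.four_le
    positivity
  set η := (3 * R * (3 * R + 2) + κ ^ 2)⁻¹ with hηdef
  -- The homotopy is cut into `n` steps, each changing the quadratic form by less than the spectral
  -- gap `η`.
  obtain ⟨n, hn⟩ := exists_nat_gt (7500 * R / η)
  have hn0 : (0 : ℝ) < n := lt_of_le_of_lt (by positivity) hn
  have hδ : 7500 * ((n : ℝ)⁻¹ * R) < η := by
    rw [div_lt_iff₀ hη] at hn
    rw [← mul_lt_mul_iff_right₀ hn0]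
    calc _ = 7500 * R := by field_simp
      _ < _ := by linarith
  have ht : ∀ i : ℕ, i ≤ n → (0 : ℝ) ≤ i * (n : ℝ)⁻¹ ∧ (i : ℝ) * (n : ℝ)⁻¹ ≤ 1 := by
    intro i hi
    refine ⟨by positivity, ?_⟩
    rw [← div_eq_mul_inv, div_le_one hn0]
    exact_mod_cast hi
  have hdi : ∀ i : ℕ, i ≤ n → IsSLData Tm Tp ((i * (n : ℝ)⁻¹) • a) ((i * (n : ℝ)⁻¹) • b)
      (fun x => (i * (n : ℝ)⁻¹) • V x) R := fun i hi => hd.smul (ht i hi).1 (ht i hi).2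
  choose! K hK using fun (i : ℕ) (hi : i ≤ n) => exists_isResolvent hTm hTp (hdi i hi) hκ
  have hstep : ∀ i, i + 1 ≤ n → Module.finrank ℂ (spectralSpan (K (i + 1)) (Iio 0))
      = Module.finrank ℂ (spectralSpan (K i) (Iio 0)) := by
    intro i hi
    have hi' : i ≤ n := by omega
    have hsub : ∀ A : COp N, (((i + 1 : ℕ) : ℝ) * (n : ℝ)⁻¹) • A - ((i : ℝ) * (n : ℝ)⁻¹) • A
        = (n : ℝ)⁻¹ • A := fun A => by
      refine ContinuousLinearMap.ext fun x => ?_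
      simp only [sub_apply, COp.real_smul_apply]
      rw [← sub_smul]; congr 1; push_cast; ring
    have hnorm : ∀ A : COp N, ‖(((i + 1 : ℕ) : ℝ) * (n : ℝ)⁻¹) • A - ((i : ℝ) * (n : ℝ)⁻¹) • A‖
        = (n : ℝ)⁻¹ * ‖A‖ := fun A => by
      rw [hsub, norm_smul, Real.norm_eq_abs, abs_of_pos (inv_pos.mpr hn0)]
    have hin := (inv_pos.mpr hn0).le
    have hre := (hK i hi').re_inner_sub_le hTm hTp (hdi i hi') (hdi _ hi) hκ (hK _ hi)
      (ε := (n : ℝ)⁻¹ * R)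
      (by rw [hnorm]; exact mul_le_mul_of_nonneg_left hd.norm_left hin)
      (by rw [hnorm]; exact mul_le_mul_of_nonneg_left hd.norm_right hin)
      (by
        simp only [hnorm]
        rw [integral_const_mul]
        exact mul_le_mul_of_nonneg_left hd.integral_le hin)
    have s := fun i hi => (hK i hi).isSymmetric hTm hTp (hdi i hi) hκ
    have cpt := fun i hi => (hK i hi).isCompactOperator hTm hTp (hdi i hi) hκ
    have gp := fun i hi => (hK i hi).le_of_realEigenspace_ne_bot hTm hTp (hdi i hi) hκ
    -- The form estimate is two-sided, so neither dimension can exceed the other.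
    refine le_antisymm ?_ ?_
    · exact finrank_spectralSpan_le (s _ hi) (s _ hi') (cpt _ hi) (cpt _ hi') hη hδ (gp _ hi)
        (gp _ hi') fun x => (le_abs_self _).trans (hre x)
    · exact finrank_spectralSpan_le (s _ hi') (s _ hi) (cpt _ hi') (cpt _ hi) hη hδ (gp _ hi')
        (gp _ hi) fun x => by
          have := (neg_le_abs _).trans (hre x)
          linarith
  have hall : ∀ i, i ≤ n → Module.finrank ℂ (spectralSpan (K i) (Iio 0))
      = Module.finrank ℂ (spectralSpan (K 0) (Iio 0)) := by
    intro i
    induction i with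
    | zero => intro _; rfl
    | succ i ih => intro hi; rw [hstep i hi, ih (by omega)]
  refine ⟨Module.finrank ℂ (spectralSpan (K 0) (Iio 0)), ?_, ?_⟩
  · have := (hK n le_rfl).hasEigenvalueCount hTm hTp (hdi n le_rfl) hκ
    rw [hall n le_rfl] at this
    have h1 : ∀ A : COp N, ((n : ℕ) * (n : ℝ)⁻¹) • A = A := fun A =>
      ContinuousLinearMap.ext fun x => by simp [mul_inv_cancel₀ hn0.ne']
    simpa only [h1] using this
  · have := (hK 0 (Nat.zero_le n)).hasEigenvalueCount hTm hTp (hdi 0 (Nat.zero_le n)) hκ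
    have h0 : ∀ A : COp N, ((0 : ℕ) * (n : ℝ)⁻¹) • A = 0 := fun A =>
      ContinuousLinearMap.ext fun x => by simp
    simpa only [h0] using this

namespace HasEigenvalueCount

variable {I J : Set ℝ} {m m' : ℕ}

theorem unique (h : HasEigenvalueCount Tm Tp a b V I m) (h' : HasEigenvalueCount Tm Tp a b V I m') :
    m = m' := by
  obtain ⟨S, hS, -, rfl⟩ := h
  obtain ⟨S', hS', -, rfl⟩ := h'
  have : S = S' := Finset.ext fun μ => (hS μ).trans (hS' μ).symm
  rw [this]

theorem congr (h : HasEigenvalueCount Tm Tp a b V I m)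
    (hIJ : ∀ μ, sturmLiouvilleEigenspace Tm Tp a b V μ ≠ ⊥ → (μ ∈ I ↔ μ ∈ J)) :
    HasEigenvalueCount Tm Tp a b V J m := by
  obtain ⟨S, hS, h2, h3⟩ := h
  refine ⟨S, fun μ => (hS μ).trans ?_, h2, h3⟩
  constructor
  · exact fun h => ⟨(hIJ μ h.2).mp h.1, h.2⟩
  · exact fun h => ⟨(hIJ μ h.2).mpr h.1, h.2⟩

/-- Counting in the complement of a smaller set. -/
theorem diff (h : HasEigenvalueCount Tm Tp a b V I m) (h' : HasEigenvalueCount Tm Tp a b V J m')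
    (hJI : J ⊆ I) : HasEigenvalueCount Tm Tp a b V (I \ J) (m - m') ∧ m' ≤ m := by
  obtain ⟨S, hS, h2, rfl⟩ := h
  obtain ⟨S', hS', h2', rfl⟩ := h'
  classical
  have hsub : S' ⊆ S := fun μ hμ =>
    (hS μ).mpr ⟨hJI ((hS' μ).mp hμ).1, ((hS' μ).mp hμ).2⟩
  have hsum := Finset.sum_sdiff hsub
    (f := fun μ => Module.finrank ℂ (sturmLiouvilleEigenspace Tm Tp a b V μ))
  refine ⟨⟨S \ S', fun μ => ?_, fun μ hμ => h2 μ (Finset.sdiff_subset hμ), by omega⟩, by omega⟩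
  rw [Finset.mem_sdiff, hS, hS', mem_sdiff]
  tauto

theorem union (h : HasEigenvalueCount Tm Tp a b V I m) (h' : HasEigenvalueCount Tm Tp a b V J m')
    (hIJ : Disjoint I J) : HasEigenvalueCount Tm Tp a b V (I ∪ J) (m + m') := by
  obtain ⟨S, hS, h2, rfl⟩ := h
  obtain ⟨S', hS', h2', rfl⟩ := h'
  classical
  have hd : Disjoint S S' := Finset.disjoint_left.mpr fun μ h1 h2 =>
    hIJ.notMem_of_mem_left ((hS μ).mp h1).1 ((hS' μ).mp h2).1
  refine ⟨S ∪ S', fun μ => ?_, fun μ hμ => ?_, Finset.sum_union hd⟩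
  · rw [Finset.mem_union, hS, hS', mem_union]
    tauto
  · exact (Finset.mem_union.mp hμ).elim (h2 μ) (h2' μ)

theorem of_finset (S : Finset ℝ)
    (hS : ∀ μ ∈ I, sturmLiouvilleEigenspace Tm Tp a b V μ ≠ ⊥ → μ ∈ S) (hSI : ∀ μ ∈ S, μ ∈ I)
    (hf : ∀ μ ∈ S, FiniteDimensional ℂ (sturmLiouvilleEigenspace Tm Tp a b V μ)) :
    HasEigenvalueCount Tm Tp a b V I
      (∑ μ ∈ S, Module.finrank ℂ (sturmLiouvilleEigenspace Tm Tp a b V μ)) := by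
  classical
  refine ⟨S.filter fun μ => sturmLiouvilleEigenspace Tm Tp a b V μ ≠ ⊥, fun μ => ?_,
    fun μ hμ => hf μ (Finset.mem_of_mem_filter μ hμ), ?_⟩
  · rw [Finset.mem_filter]
    exact ⟨fun h => ⟨hSI μ h.1, h.2⟩, fun h => ⟨hS μ h.1 h.2, h.2⟩⟩
  · refine Finset.sum_filter_of_ne fun μ _ h hbot => h ?_
    rw [hbot, finrank_bot]

end HasEigenvalueCount

end

/-! ### Geometry of two projectors and existence of the decomposition. -/

section TwoProjectors

variable {N : ℕ} {P Q : COp N} {x y : CVec N}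

/-- The operator `(P + Q - 1)²`, which commutes with the projectors `P` and `Q`. -/
noncomputable def cosSqOp (P Q : COp N) : COp N := (P + Q - 1) * (P + Q - 1)

theorem cosSqOp_apply (P Q : COp N) (x : CVec N) :
    cosSqOp P Q x = P (P x + Q x - x) + Q (P x + Q x - x) - (P x + Q x - x) := rfl

theorem cosSqOp_comm (P Q : COp N) : cosSqOp P Q = cosSqOp Q P := by
  rw [cosSqOp, cosSqOp, add_comm P Q]

theorem cosSqOp_apply_eq (hP : IsStarProjection P) (hQ : IsStarProjection Q) (x : CVec N) :
    cosSqOp P Q x = x - (P (x - Q x) + Q (x - P x)) := by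
  simp only [cosSqOp_apply, map_add, map_sub, hP.apply_apply, hQ.apply_apply]
  abel

theorem cosSqOp_apply_of_apply_eq (hP : IsStarProjection P) (hQ : IsStarProjection Q)
    (hx : P x = x) : cosSqOp P Q x = P (Q x) := by
  rw [cosSqOp_apply_eq hP hQ, hx, sub_self, map_zero, add_zero, map_sub, hx]
  abel

theorem cosSqOp_apply_comm (hP : IsStarProjection P) (hQ : IsStarProjection Q) (x : CVec N) :
    cosSqOp P Q (P x) = P (cosSqOp P Q x) := by
  simp only [cosSqOp_apply, map_add, map_sub, hP.apply_apply, hQ.apply_apply]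
  abel

theorem cosSqOp_isSymmetric (hP : IsStarProjection P) (hQ : IsStarProjection Q) :
    (cosSqOp P Q).IsSymmetric := by
  intro x y
  change inner ℂ (cosSqOp P Q x) y = inner ℂ x (cosSqOp P Q y)
  simp only [cosSqOp_apply, map_add, map_sub, inner_add_left, inner_add_right, inner_sub_left,
    inner_sub_right, hP.inner_apply_left, hQ.inner_apply_left, hP.apply_apply, hQ.apply_apply]
  ring

theorem inner_cosSqOp (hP : IsStarProjection P) (hQ : IsStarProjection Q) (x : CVec N) :
    inner ℂ x (cosSqOp P Q x) = ((‖P x + Q x - x‖ ^ 2 : ℝ) : ℂ) := by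
  have h := inner_self_eq_norm_sq_to_K (𝕜 := ℂ) (P x + Q x - x)
  push_cast
  refine Eq.trans ?_ h
  rw [cosSqOp_apply]
  simp only [map_add, map_sub, inner_add_left, inner_add_right, inner_sub_left, inner_sub_right,
    hP.inner_apply_left, hQ.inner_apply_left]
  ring

/-- This reflects the identity `(P + Q - 1)² + (P - Q)² = 1`. With `inner_cosSqOp` it confines the
spectrum of `cosSqOp` to `[0,1]`; eigenvalue `1` forces `P x = Q x`, and eigenvalue `0` forces `P x
+ Q x = x`. -/
theorem inner_sub_cosSqOp (hP : IsStarProjection P) (hQ : IsStarProjection Q) (x : CVec N) :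
    inner ℂ x (x - cosSqOp P Q x) = ((‖Q x - P x‖ ^ 2 : ℝ) : ℂ) := by
  have h := inner_self_eq_norm_sq_to_K (𝕜 := ℂ) (Q x - P x)
  push_cast
  refine Eq.trans ?_ h
  rw [cosSqOp_apply_eq hP hQ]
  simp only [map_sub, inner_add_right, inner_sub_left, inner_sub_right,
    hP.inner_apply_left, hQ.inner_apply_left, hP.apply_apply, hQ.apply_apply]
  ring

theorem mem_realEigenspace_cosSqOp {α : ℝ} :
    x ∈ realEigenspace (cosSqOp P Q) α ↔ cosSqOp P Q x = α • x := by
  rw [mem_realEigenspace, Complex.coe_smul]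

theorem apply_mem_realEigenspace_cosSqOp (hP : IsStarProjection P) (hQ : IsStarProjection Q)
    {α : ℝ} (hx : x ∈ realEigenspace (cosSqOp P Q) α) :
    P x ∈ realEigenspace (cosSqOp P Q) α := by
  rw [mem_realEigenspace_cosSqOp] at hx ⊢
  rw [cosSqOp_apply_comm hP hQ, hx, COp.map_real_smul]

theorem mem_Icc_of_realEigenspace_cosSqOp_ne_bot (hP : IsStarProjection P)
    (hQ : IsStarProjection Q) {α : ℝ} (h : realEigenspace (cosSqOp P Q) α ≠ ⊥) :
    α ∈ Icc (0 : ℝ) 1 := by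
  obtain ⟨x, hx, hx0⟩ := (Submodule.ne_bot_iff _).mp h
  rw [mem_realEigenspace_cosSqOp] at hx
  have hpos : 0 < ‖x‖ ^ 2 := by have := norm_pos_iff.mpr hx0; positivity
  have hxx : inner ℂ x x = ((‖x‖ ^ 2 : ℝ) : ℂ) := by
    push_cast; exact inner_self_eq_norm_sq_to_K x
  have h1 := inner_cosSqOp hP hQ x
  have h2 := inner_sub_cosSqOp hP hQ x
  rw [hx, real_smul_inner_right, hxx] at h1
  rw [hx, inner_sub_right, real_smul_inner_right, hxx] at h2
  have h1' : α * ‖x‖ ^ 2 = ‖P x + Q x - x‖ ^ 2 := by exact_mod_cast h1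
  have h2' : ‖x‖ ^ 2 - α * ‖x‖ ^ 2 = ‖Q x - P x‖ ^ 2 := by exact_mod_cast h2
  constructor
  · by_contra hlt
    have := mul_neg_of_neg_of_pos (not_le.mp hlt) hpos
    have := sq_nonneg ‖P x + Q x - x‖
    linarith
  · by_contra hlt
    have := mul_pos (sub_pos.mpr (not_le.mp hlt)) hpos
    have := sq_nonneg ‖Q x - P x‖
    linarith

theorem mem_spaceDD (hP : IsStarProjection P) (hQ : IsStarProjection Q) :
    x ∈ spaceDD P Q ↔ P x = x ∧ Q x = x := by
  rw [spaceDD, Submodule.mem_inf, hP.mem_opRange, hQ.mem_opRange]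

theorem mem_spaceND (hP : IsStarProjection P) (hQ : IsStarProjection Q) :
    x ∈ spaceND P Q ↔ P x = 0 ∧ Q x = x := by
  rw [spaceND, Submodule.mem_inf, hP.mem_opRange_one_sub, hQ.mem_opRange]

theorem mem_spaceDN (hP : IsStarProjection P) (hQ : IsStarProjection Q) :
    x ∈ spaceDN P Q ↔ P x = x ∧ Q x = 0 := by
  rw [spaceDN, Submodule.mem_inf, hP.mem_opRange, hQ.mem_opRange_one_sub]

theorem mem_spaceNN (hP : IsStarProjection P) (hQ : IsStarProjection Q) :
    x ∈ spaceNN P Q ↔ P x = 0 ∧ Q x = 0 := by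
  rw [spaceNN, Submodule.mem_inf, hP.mem_opRange_one_sub, hQ.mem_opRange_one_sub]

theorem realEigenspace_cosSqOp_one_le (hP : IsStarProjection P) (hQ : IsStarProjection Q) :
    realEigenspace (cosSqOp P Q) 1 ≤ spaceDD P Q ⊔ spaceNN P Q := by
  intro x hx
  rw [mem_realEigenspace_cosSqOp, one_smul] at hx
  have h := inner_sub_cosSqOp hP hQ x
  rw [hx, sub_self, inner_zero_right] at h
  have h' : ‖Q x - P x‖ = 0 := by
    have : (0 : ℝ) = ‖Q x - P x‖ ^ 2 := by exact_mod_cast h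
    exact pow_eq_zero_iff (two_ne_zero) |>.mp this.symm
  have hQP : Q x = P x := sub_eq_zero.mp (norm_eq_zero.mp h')
  refine Submodule.mem_sup.mpr ⟨P x, (mem_spaceDD hP hQ).mpr ⟨hP.apply_apply x, ?_⟩, x - P x,
    (mem_spaceNN hP hQ).mpr ⟨?_, ?_⟩, by abel⟩
  · rw [← hQP, hQ.apply_apply]
  · rw [map_sub, hP.apply_apply, sub_self]
  · rw [map_sub, ← hQP, hQ.apply_apply, sub_self]

theorem realEigenspace_cosSqOp_zero_le (hP : IsStarProjection P) (hQ : IsStarProjection Q) :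
    realEigenspace (cosSqOp P Q) 0 ≤ spaceND P Q ⊔ spaceDN P Q := by
  intro x hx
  rw [mem_realEigenspace_cosSqOp, zero_smul] at hx
  have h := inner_cosSqOp hP hQ x
  rw [hx, inner_zero_right] at h
  have h' : ‖P x + Q x - x‖ = 0 := by
    have : (0 : ℝ) = ‖P x + Q x - x‖ ^ 2 := by exact_mod_cast h
    exact pow_eq_zero_iff (two_ne_zero) |>.mp this.symm
  have hPQ : P x + Q x = x := sub_eq_zero.mp (norm_eq_zero.mp h')
  have h1 : Q x = x - P x := by rw [eq_sub_iff_add_eq, add_comm]; exact hPQ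
  have h2 : P x = x - Q x := by rw [eq_sub_iff_add_eq]; exact hPQ
  refine Submodule.mem_sup.mpr ⟨Q x, (mem_spaceND hP hQ).mpr ⟨?_, hQ.apply_apply x⟩, P x,
    (mem_spaceDN hP hQ).mpr ⟨hP.apply_apply x, ?_⟩, by rw [add_comm]; exact hPQ⟩
  · rw [h1, map_sub, hP.apply_apply, sub_self]
  · rw [h2, map_sub, hQ.apply_apply, sub_self]

theorem cosSqOp_eq_one_of_mem (hP : IsStarProjection P) (hQ : IsStarProjection Q) :
    spaceDD P Q ≤ realEigenspace (cosSqOp P Q) 1 ∧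
      spaceNN P Q ≤ realEigenspace (cosSqOp P Q) 1 := by
  constructor
  · intro x hx
    obtain ⟨h1, h2⟩ := (mem_spaceDD hP hQ).mp hx
    rw [mem_realEigenspace_cosSqOp, cosSqOp_apply, one_smul]
    simp [h1, h2]
  · intro x hx
    obtain ⟨h1, h2⟩ := (mem_spaceNN hP hQ).mp hx
    rw [mem_realEigenspace_cosSqOp, cosSqOp_apply, one_smul]
    simp [h1, h2]

theorem cosSqOp_eq_zero_of_mem (hP : IsStarProjection P) (hQ : IsStarProjection Q) :
    spaceND P Q ≤ realEigenspace (cosSqOp P Q) 0 ∧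
      spaceDN P Q ≤ realEigenspace (cosSqOp P Q) 0 := by
  constructor
  · intro x hx
    obtain ⟨h1, h2⟩ := (mem_spaceND hP hQ).mp hx
    rw [mem_realEigenspace_cosSqOp, cosSqOp_apply, zero_smul]
    simp [h1, h2]
  · intro x hx
    obtain ⟨h1, h2⟩ := (mem_spaceDN hP hQ).mp hx
    rw [mem_realEigenspace_cosSqOp, cosSqOp_apply, zero_smul]
    simp [h1, h2]

theorem IsStarProjection.isOrtho (hP : IsStarProjection P) {U W : Submodule ℂ (CVec N)}
    (hU : U ≤ opRange P) (hW : W ≤ opRange (1 - P)) : U ⟂ W := by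
  rw [Submodule.isOrtho_iff_inner_eq]
  intro x hx y hy
  have h1 := hP.mem_opRange.mp (hU hx)
  have h2 := hP.mem_opRange_one_sub.mp (hW hy)
  rw [← h1, hP.inner_apply_left, h2, inner_zero_right]

/-- `F` is invariant under the projectors `P` and `Q`, which are at the angle `γ` on `F`. -/
structure IsAngleBlock (P Q : COp N) (γ : ℝ) (F : Submodule ℂ (CVec N)) : Prop where
  apply_mem_left : ∀ x ∈ F, P x ∈ F
  apply_mem_right : ∀ x ∈ F, Q x ∈ F
  cosSqOp_apply : ∀ x ∈ F, cosSqOp P Q x = Real.cos γ ^ 2 • x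

theorem IsAngleBlock.symm {γ : ℝ} {F : Submodule ℂ (CVec N)} (h : IsAngleBlock P Q γ F) :
    IsAngleBlock Q P γ F :=
  ⟨h.apply_mem_right, h.apply_mem_left, fun x hx => by
    rw [cosSqOp_comm]; exact h.cosSqOp_apply x hx⟩

theorem isAngleBlock_realEigenspace (hP : IsStarProjection P) (hQ : IsStarProjection Q) (γ : ℝ) :
    IsAngleBlock P Q γ (realEigenspace (cosSqOp P Q) (Real.cos γ ^ 2)) :=
  ⟨fun _ hx => apply_mem_realEigenspace_cosSqOp hP hQ hx,
    fun _ hx => by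
      rw [cosSqOp_comm] at hx ⊢
      exact apply_mem_realEigenspace_cosSqOp hQ hP hx,
    fun _ hx => mem_realEigenspace_cosSqOp.mp hx⟩

namespace IsAngleBlock

variable {γ : ℝ} {F : Submodule ℂ (CVec N)}

theorem apply_apply_left (h : IsAngleBlock P Q γ F) (hP : IsStarProjection P)
    (hQ : IsStarProjection Q) (hx : x ∈ F) (hPx : P x = x) : P (Q x) = Real.cos γ ^ 2 • x := by
  rw [← cosSqOp_apply_of_apply_eq hP hQ hPx, h.cosSqOp_apply x hx]

theorem norm_apply (h : IsAngleBlock P Q γ F) (hP : IsStarProjection P)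
    (hQ : IsStarProjection Q) (hγ : 0 ≤ Real.cos γ) (hx : x ∈ F) (hPx : P x = x) :
    ‖Q x‖ = Real.cos γ * ‖x‖ := by
  have h1 : inner ℂ (Q x) (Q x) = ((Real.cos γ ^ 2 : ℝ) : ℂ) * inner ℂ x x := by
    calc inner ℂ (Q x) (Q x) = inner ℂ (Q x) x := by
          rw [hQ.inner_apply_left, hQ.inner_apply_left, hQ.apply_apply]
      _ = inner ℂ (P (Q x)) x := by rw [hP.inner_apply_left, hPx]
      _ = _ := by rw [h.apply_apply_left hP hQ hx hPx, real_smul_inner_left]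
  rw [inner_self_eq_norm_sq_to_K, inner_self_eq_norm_sq_to_K] at h1
  have h2 : ‖Q x‖ ^ 2 = (Real.cos γ * ‖x‖) ^ 2 := by
    have h3 : ((‖Q x‖ ^ 2 : ℝ) : ℂ) = ((Real.cos γ ^ 2 * ‖x‖ ^ 2 : ℝ) : ℂ) := by
      push_cast at h1 ⊢
      exact h1
    rw [mul_pow]; exact Complex.ofReal_injective h3
  exact (pow_left_inj₀ (norm_nonneg _) (by positivity) two_ne_zero).mp h2

theorem starProjection_apply (h : IsAngleBlock P Q γ F) (hQ : IsStarProjection Q) (hx : x ∈ F) :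
    (F ⊓ opRange Q).starProjection x = Q x := by
  refine Submodule.eq_starProjection_of_mem_of_inner_eq_zero
    ⟨h.apply_mem_right x hx, hQ.mem_opRange.mpr (hQ.apply_apply x)⟩ fun w hw => ?_
  rw [inner_sub_left, hQ.inner_apply_left, hQ.mem_opRange.mp hw.2, sub_self]

/-- The projector `Q` multiplies norms on `F ⊓ opRange P` by `cos γ > 0` and is therefore injective
there. -/
theorem finrank_le (h : IsAngleBlock P Q γ F) (hP : IsStarProjection P)
    (hQ : IsStarProjection Q) (hγ : 0 < Real.cos γ) :
    Module.finrank ℂ ↥(F ⊓ opRange P) ≤ Module.finrank ℂ ↥(F ⊓ opRange Q) := by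
  let f : ↥(F ⊓ opRange P) →ₗ[ℂ] ↥(F ⊓ opRange Q) :=
    (Q : CVec N →ₗ[ℂ] CVec N).restrict fun x hx =>
      ⟨h.apply_mem_right x hx.1, hQ.mem_opRange.mpr (hQ.apply_apply x)⟩
  refine LinearMap.finrank_le_finrank_of_injective (f := f) ?_
  rw [injective_iff_map_eq_zero]
  intro x hx
  have h1 : Q x = 0 := congrArg Subtype.val hx
  have h2 := h.norm_apply hP hQ hγ.le x.2.1 (hP.mem_opRange.mp x.2.2)
  rw [h1, norm_zero, eq_comm, mul_eq_zero] at h2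
  exact Subtype.ext (norm_eq_zero.mp (h2.resolve_left hγ.ne'))

theorem hasAngle (h : IsAngleBlock P Q γ F) (hP : IsStarProjection P)
    (hQ : IsStarProjection Q) (h0 : 0 < γ) (h1 : γ < π / 2) :
    HasAngle (F ⊓ opRange P) (F ⊓ opRange Q) γ := by
  have hc : 0 < Real.cos γ := Real.cos_pos_of_mem_Ioo ⟨by linarith [Real.pi_pos], h1⟩
  refine ⟨le_antisymm (h.finrank_le hP hQ hc) (h.symm.finrank_le hQ hP hc), h0, h1, ?_, ?_⟩
  · intro x hx
    rw [h.starProjection_apply hQ hx.1]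
    exact h.norm_apply hP hQ hc.le hx.1 (hP.mem_opRange.mp hx.2)
  · intro x hx
    rw [h.symm.starProjection_apply hP hx.1]
    exact h.symm.norm_apply hQ hP hc.le hx.1 (hQ.mem_opRange.mp hx.2)

theorem eq_sup (h : IsAngleBlock P Q γ F) (hP : IsStarProjection P)
    (hQ : IsStarProjection Q) (hγ : Real.cos γ ^ 2 < 1) :
    F = (F ⊓ opRange P) ⊔ (F ⊓ opRange Q) := by
  refine le_antisymm (fun x hx => ?_) (sup_le inf_le_left inf_le_left)
  have h1 := h.cosSqOp_apply x hx
  rw [cosSqOp_apply_eq hP hQ] at h1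
  have hne : 1 - Real.cos γ ^ 2 ≠ 0 := by linarith
  -- The operator `1 - cosSqOp = P(1 - Q) + Q(1 - P)` is the nonzero scalar `1 - cos² γ` on `F`;
  -- dividing by it splits `x` into its two parts.
  have h2 : x = ((1 - Real.cos γ ^ 2)⁻¹ : ℝ) • P (x - Q x)
      + ((1 - Real.cos γ ^ 2)⁻¹ : ℝ) • Q (x - P x) := by
    rw [← smul_add, eq_inv_smul_iff₀ hne, sub_smul, one_smul, ← h1]
    abel
  have hm : ∀ (c : ℝ) (T : COp N) (y : CVec N), IsStarProjection T → T y ∈ F →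
      c • T y ∈ F ⊓ opRange T := fun c T y hT hy => by
    rw [← Complex.coe_smul]
    exact Submodule.smul_mem _ _ ⟨hy, hT.mem_opRange.mpr (hT.apply_apply y)⟩
  rw [h2]
  exact Submodule.add_mem_sup
    (hm _ P _ hP (h.apply_mem_left _ (F.sub_mem hx (h.apply_mem_right x hx))))
    (hm _ Q _ hQ (h.apply_mem_right _ (F.sub_mem hx (h.apply_mem_left x hx))))

end IsAngleBlock

theorem pairwise_isOrtho_four (hP : IsStarProjection P) (hQ : IsStarProjection Q) (i j : Fin 4)
    (hij : i ≠ j) : (![spaceDD P Q, spaceND P Q, spaceDN P Q, spaceNN P Q] i) ⟂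
      (![spaceDD P Q, spaceND P Q, spaceDN P Q, spaceNN P Q] j) := by
  have h1 : spaceDD P Q ⟂ spaceND P Q := hP.isOrtho inf_le_left inf_le_left
  have h2 : spaceDD P Q ⟂ spaceDN P Q := hQ.isOrtho inf_le_right inf_le_right
  have h3 : spaceDD P Q ⟂ spaceNN P Q := hP.isOrtho inf_le_left inf_le_left
  have h4 : spaceND P Q ⟂ spaceDN P Q := hQ.isOrtho inf_le_right inf_le_right
  have h5 : spaceND P Q ⟂ spaceNN P Q := hQ.isOrtho inf_le_right inf_le_right
  have h6 : spaceDN P Q ⟂ spaceNN P Q := hP.isOrtho inf_le_left inf_le_left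
  fin_cases i <;> fin_cases j <;> first | exact absurd rfl hij | assumption |
    exact Submodule.IsOrtho.symm (by assumption)

/-- The decomposition is the spectral decomposition of `cosSqOp`: the eigenvalues `1` and `0`
account for the four intersections, and each eigenvalue `α` in `(0,1)` gives the block of angle
`arccos √α`. -/
theorem exists_isAngleDecomposition (hP : IsStarProjection P) (hQ : IsStarProjection Q) :
    ∃ (k : ℕ) (γ : Fin k → ℝ) (F : Fin k → Submodule ℂ (CVec N)),
      IsAngleDecomposition P Q γ F := by
  have hsym := cosSqOp_isSymmetric hP hQ
  have hort := pairwise_isOrtho_realEigenspace hsym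
  have hinj : InjOn (fun t => Real.cos t ^ 2) (Ioo 0 (π / 2)) := by
    intro s hs t ht hst
    have hc : ∀ u ∈ Ioo 0 (π / 2), 0 ≤ Real.cos u := fun u hu =>
      Real.cos_nonneg_of_mem_Icc ⟨by linarith [hu.1, Real.pi_pos], hu.2.le⟩
    refine Real.injOn_cos ⟨hs.1.le, by linarith [hs.2, Real.pi_pos]⟩
      ⟨ht.1.le, by linarith [ht.2, Real.pi_pos]⟩ ?_
    exact (pow_left_inj₀ (hc s hs) (hc t ht) two_ne_zero).mp hst
  have hfin : {t : ℝ | t ∈ Ioo 0 (π / 2) ∧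
      realEigenspace (cosSqOp P Q) (Real.cos t ^ 2) ≠ ⊥}.Finite := by
    refine Set.Finite.of_injOn (f := fun t => ((Real.cos t ^ 2 : ℝ) : ℂ))
      (t := {μ | Module.End.HasEigenvalue (cosSqOp P Q : Module.End ℂ (CVec N)) μ}) ?_ ?_
      (Module.End.finite_hasEigenvalue _)
    · intro t ht
      exact ht.2
    · intro s hs t ht hst
      exact hinj hs.1 ht.1 (Complex.ofReal_injective hst)
  set T := hfin.toFinset with hT
  have hmem : ∀ t, t ∈ T ↔ t ∈ Ioo 0 (π / 2) ∧
      realEigenspace (cosSqOp P Q) (Real.cos t ^ 2) ≠ ⊥ := fun t => by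
    rw [hT, Set.Finite.mem_toFinset]; rfl
  let γ : Fin T.card → ℝ := T.orderEmbOfFin rfl
  have hγ : ∀ i, γ i ∈ Ioo 0 (π / 2) ∧
      realEigenspace (cosSqOp P Q) (Real.cos (γ i) ^ 2) ≠ ⊥ := fun i =>
    (hmem _).mp (Finset.orderEmbOfFin_mem T rfl i)
  have hmono : StrictMono γ := (T.orderEmbOfFin rfl).strictMono
  have hcos : ∀ i, 0 < Real.cos (γ i) := fun i =>
    Real.cos_pos_of_mem_Ioo ⟨by linarith [(hγ i).1.1, Real.pi_pos], (hγ i).1.2⟩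
  have hcos1 : ∀ i, Real.cos (γ i) ^ 2 < 1 := fun i => by
    have h1 := Real.sin_pos_of_pos_of_lt_pi (hγ i).1.1 (by linarith [(hγ i).1.2, Real.pi_pos])
    have h2 := Real.sin_sq_add_cos_sq (γ i)
    have : 0 < Real.sin (γ i) ^ 2 := by positivity
    linarith
  have hblock : ∀ i, IsAngleBlock P Q (γ i) (realEigenspace (cosSqOp P Q) (Real.cos (γ i) ^ 2)) :=
    fun i => isAngleBlock_realEigenspace hP hQ _
  refine ⟨T.card, γ, fun i => realEigenspace (cosSqOp P Q) (Real.cos (γ i) ^ 2), hmono,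
    fun i => (hγ i).2, fun i => (hblock i).eq_sup hP hQ (hcos1 i),
    fun i => (hblock i).hasAngle hP hQ (hγ i).1.1 (hγ i).1.2, ?_, ?_⟩
  · have hmix : ∀ (i : Fin 4) (j : Fin T.card),
        (![spaceDD P Q, spaceND P Q, spaceDN P Q, spaceNN P Q] i) ⟂
          realEigenspace (cosSqOp P Q) (Real.cos (γ j) ^ 2) := by
      intro i j
      have o1 := hort (hcos1 j).ne'
      have o0 := hort (pow_pos (hcos j) 2).ne
      obtain ⟨d1, d2⟩ := cosSqOp_eq_one_of_mem hP hQ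
      obtain ⟨d3, d4⟩ := cosSqOp_eq_zero_of_mem hP hQ
      fin_cases i
      exacts [o1.mono_left d1, o0.mono_left d3, o0.mono_left d4, o1.mono_left d2]
    rintro (i | i) (j | j) hij
    · exact pairwise_isOrtho_four hP hQ i j fun h => hij (by rw [h])
    · exact hmix i j
    · exact (hmix j i).symm
    · refine hort fun h => hij ?_
      rw [hmono.injective (hinj (hγ i).1 (hγ j).1 h)]
  · set W := ⨆ i, decompositionFamily P Q
      (fun i => realEigenspace (cosSqOp P Q) (Real.cos (γ i) ^ 2)) i with hW
    have hle : ∀ i, decompositionFamily P Q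
      (fun i => realEigenspace (cosSqOp P Q) (Real.cos (γ i) ^ 2)) i ≤ W := fun i => le_iSup _ i
    have hreal : ∀ α : ℝ, realEigenspace (cosSqOp P Q) α ≤ W := by
      intro α
      by_cases hα : realEigenspace (cosSqOp P Q) α = ⊥
      · rw [hα]; exact bot_le
      have h01 := mem_Icc_of_realEigenspace_cosSqOp_ne_bot hP hQ hα
      by_cases hα1 : α = 1
      · rw [hα1]
        exact (realEigenspace_cosSqOp_one_le hP hQ).trans
          (sup_le (hle (Sum.inl 0)) (hle (Sum.inl 3)))
      by_cases hα0 : α = 0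
      · rw [hα0]
        exact (realEigenspace_cosSqOp_zero_le hP hQ).trans
          (sup_le (hle (Sum.inl 1)) (hle (Sum.inl 2)))
      have hpos : 0 < α := lt_of_le_of_ne h01.1 (Ne.symm hα0)
      have hlt : √α < 1 := by
        rw [Real.sqrt_lt' one_pos, one_pow]; exact lt_of_le_of_ne h01.2 hα1
      have hsq : Real.cos (Real.arccos √α) ^ 2 = α := by
        rw [Real.cos_arccos (by linarith [Real.sqrt_nonneg α]) hlt.le, Real.sq_sqrt h01.1]
      have hmemT : Real.arccos √α ∈ T := by
        rw [hmem, hsq]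
        exact ⟨⟨Real.arccos_pos.mpr hlt, Real.arccos_lt_pi_div_two.mpr (Real.sqrt_pos.mpr hpos)⟩,
          hα⟩
      obtain ⟨i, hi⟩ : ∃ i, γ i = Real.arccos √α := by
        have : Real.arccos √α ∈ Set.range (T.orderEmbOfFin rfl) := by
          rw [Finset.range_orderEmbOfFin]; exact hmemT
        exact this
      have := hle (Sum.inr i)
      simp only [decompositionFamily, Sum.elim_inr, hi, hsq] at this
      exact this
    have htop : (⨆ μ : ℂ, Module.End.eigenspace (cosSqOp P Q : Module.End ℂ (CVec N)) μ) ≤ W := by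
      refine iSup_le fun μ => ?_
      by_cases hμ : Module.End.eigenspace (cosSqOp P Q : Module.End ℂ (CVec N)) μ = ⊥
      · rw [hμ]; exact bot_le
      have hr := LinearMap.IsSymmetric.conj_eigenvalue_eq_self hsym (μ := μ) hμ
      obtain ⟨ν, rfl⟩ := Complex.conj_eq_iff_real.mp hr
      exact hreal ν
    have hbot := LinearMap.IsSymmetric.orthogonalComplement_iSup_eigenspaces_eq_bot hsym
    rw [Submodule.orthogonal_eq_bot_iff] at hbot
    rw [hbot] at htop
    exact top_le_iff.mp htop

end TwoProjectors

/-! ### Invariance of the blocks of an arbitrary angle decomposition. -/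

section AngleDecomposition

variable {N k : ℕ} {P Q : COp N} {γ : Fin k → ℝ} {F : Fin k → Submodule ℂ (CVec N)}

theorem finrank_iSup_of_pairwise_isOrtho {ι : Type*} [Fintype ι]
    (E : ι → Submodule ℂ (CVec N)) (ho : Pairwise fun i j => E i ⟂ E j) :
    Module.finrank ℂ ↥(⨆ i, E i) = ∑ i, Module.finrank ℂ (E i) := by
  rw [← Finset.sup_univ_eq_iSup]
  exact (finrank_finset_sup_of_pairwise_isOrtho E ho Finset.univ fun i _ => inferInstance).2

theorem exists_sum_of_mem_iSup {ι : Type*} [Fintype ι] {E : ι → Submodule ℂ (CVec N)}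
    {x : CVec N} (hx : x ∈ ⨆ i, E i) : ∃ f : ι → CVec N, (∀ i, f i ∈ E i) ∧ x = ∑ i, f i := by
  obtain ⟨g, hg, rfl⟩ := (Submodule.mem_iSup_iff_exists_finsupp E x).mp hx
  exact ⟨g, hg, Finsupp.sum_fintype _ _ fun _ => rfl⟩

theorem norm_sum_sq_of_isOrtho {ι : Type*} [Fintype ι] {E : ι → Submodule ℂ (CVec N)}
    (ho : Pairwise fun i j => E i ⟂ E j) {f : ι → CVec N} (hf : ∀ i, f i ∈ E i) :
    ‖∑ i, f i‖ ^ 2 = ∑ i, ‖f i‖ ^ 2 := by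
  classical
  have hc : ((‖∑ i, f i‖ ^ 2 : ℝ) : ℂ) = ((∑ i, ‖f i‖ ^ 2 : ℝ) : ℂ) := by
    push_cast
    refine (inner_self_eq_norm_sq_to_K (𝕜 := ℂ) (∑ i, f i)).symm.trans ?_
    rw [sum_inner]
    refine Finset.sum_congr rfl fun i _ => ?_
    rw [inner_sum, Finset.sum_eq_single i]
    · exact inner_self_eq_norm_sq_to_K (f i)
    · exact fun j _ hne =>
        (Submodule.isOrtho_iff_inner_eq.mp (ho hne.symm)) _ (hf i) _ (hf j)
    · exact fun h => absurd (Finset.mem_univ i) h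
  exact_mod_cast hc

theorem mem_of_mem_iSup_of_isOrtho {ι : Type*} [Fintype ι] {E : ι → Submodule ℂ (CVec N)}
    (ho : Pairwise fun i j => E i ⟂ E j) {i : ι} {x : CVec N} (hx : x ∈ ⨆ i, E i)
    (hj : ∀ j ≠ i, ∀ y ∈ E j, inner ℂ y x = 0) : x ∈ E i := by
  obtain ⟨f, hf, rfl⟩ := exists_sum_of_mem_iSup hx
  have hz : ∀ j ≠ i, f j = 0 := by
    intro j hji
    have h1 := hj j hji _ (hf j)
    rw [inner_sum, Finset.sum_eq_single j] at h1
    · exact inner_self_eq_zero.mp h1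
    · exact fun l _ hne => (Submodule.isOrtho_iff_inner_eq.mp (ho hne.symm)) _ (hf j) _ (hf l)
    · exact fun h => absurd (Finset.mem_univ j) h
  rw [Finset.sum_eq_single i (fun j _ hji => hz j hji) fun h => absurd (Finset.mem_univ i) h]
  exact hf i

theorem le_norm_of_isOrtho {ι : Type*} [Fintype ι] {E : ι → Submodule ℂ (CVec N)}
    (ho : Pairwise fun i j => E i ⟂ E j) (htop : ⨆ i, E i = ⊤) {T : COp N}
    (hT : ∀ i, ∀ x ∈ E i, T x ∈ E i) {c : ℝ} (hc : 0 ≤ c)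
    (hle : ∀ i, ∀ x ∈ E i, c * ‖x‖ ≤ ‖T x‖) (x : CVec N) : c * ‖x‖ ≤ ‖T x‖ := by
  obtain ⟨f, hf, rfl⟩ := exists_sum_of_mem_iSup (htop ▸ Submodule.mem_top : x ∈ ⨆ i, E i)
  refine (pow_le_pow_iff_left₀ (by positivity) (norm_nonneg _) two_ne_zero).mp ?_
  rw [mul_pow, map_sum, norm_sum_sq_of_isOrtho ho hf,
    norm_sum_sq_of_isOrtho ho fun i => hT i _ (hf i), Finset.mul_sum]
  refine Finset.sum_le_sum fun i _ => ?_
  rw [← mul_pow]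
  exact pow_le_pow_left₀ (by positivity) (hle i _ (hf i)) 2

theorem finrank_ker_of_isOrtho {ι : Type*} [Fintype ι] {E : ι → Submodule ℂ (CVec N)}
    (ho : Pairwise fun i j => E i ⟂ E j) (htop : ⨆ i, E i = ⊤) {T : COp N}
    (hT : ∀ i, ∀ x ∈ E i, T x ∈ E i) :
    Module.finrank ℂ (LinearMap.ker (T : CVec N →ₗ[ℂ] CVec N))
      = ∑ i, Module.finrank ℂ ↥(E i ⊓ LinearMap.ker (T : CVec N →ₗ[ℂ] CVec N)) := by
  rw [← finrank_iSup_of_pairwise_isOrtho _ fun i j hij => (ho hij).mono inf_le_left inf_le_left]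
  have : LinearMap.ker (T : CVec N →ₗ[ℂ] CVec N)
      = ⨆ i, E i ⊓ LinearMap.ker (T : CVec N →ₗ[ℂ] CVec N) := by
    refine le_antisymm (fun x hx => ?_) (iSup_le fun i => inf_le_right)
    obtain ⟨f, hf, rfl⟩ := exists_sum_of_mem_iSup (htop ▸ Submodule.mem_top : x ∈ ⨆ i, E i)
    have h1 : ∑ i, T (f i) = 0 := by rw [← map_sum]; exact hx
    have h2 := norm_sum_sq_of_isOrtho ho fun i => hT i _ (hf i)
    rw [h1, norm_zero, zero_pow two_ne_zero, eq_comm,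
      Finset.sum_eq_zero_iff_of_nonneg fun i _ => by positivity] at h2
    refine Submodule.sum_mem _ fun i hi => ?_
    refine (le_iSup (fun i => E i ⊓ LinearMap.ker (T : CVec N →ₗ[ℂ] CVec N)) i) ⟨hf i, ?_⟩
    have := h2 i hi
    exact norm_eq_zero.mp ((pow_eq_zero_iff two_ne_zero).mp this)
  rw [← this]

theorem HasAngle.symm {E₁ E₂ : Submodule ℂ (CVec N)} {t : ℝ} (h : HasAngle E₁ E₂ t) :
    HasAngle E₂ E₁ t :=
  ⟨h.finrank_eq.symm, h.pos, h.lt, h.right, h.left⟩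

/-- Both `⟨PQx, x⟩ = ‖Qx‖²` and `‖PQx‖ ‖x‖` equal `cos² t ‖x‖²`. This is equality in the
Cauchy–Schwarz inequality, and expanding `‖PQx - cos² t x‖²` gives zero. -/
theorem HasAngle.apply_apply {G : Submodule ℂ (CVec N)} {t : ℝ}
    (h : HasAngle (G ⊓ opRange P) (G ⊓ opRange Q) t) (hP : IsStarProjection P)
    (hQ : IsStarProjection Q) (hPG : ∀ x ∈ G, P x ∈ G) (hQG : ∀ x ∈ G, Q x ∈ G) {x : CVec N}
    (hx : x ∈ G) (hPx : P x = x) : P (Q x) = Real.cos t ^ 2 • x := by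
  have hp : ∀ (T : COp N) (y : CVec N), IsStarProjection T → y ∈ G → T y ∈ G →
      (G ⊓ opRange T).starProjection y = T y := by
    intro T y hT hy hTy
    refine Submodule.eq_starProjection_of_mem_of_inner_eq_zero
      ⟨hTy, hT.mem_opRange.mpr (hT.apply_apply y)⟩ fun w hw => ?_
    rw [inner_sub_left, hT.inner_apply_left, hT.mem_opRange.mp hw.2, sub_self]
  have h1 : ‖Q x‖ = Real.cos t * ‖x‖ := by
    rw [← h.left x ⟨hx, hP.mem_opRange.mpr hPx⟩, hp Q x hQ hx (hQG x hx)]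
  have h2 : ‖P (Q x)‖ = Real.cos t * (Real.cos t * ‖x‖) := by
    rw [← h1, ← h.right (Q x) ⟨hQG x hx, hQ.mem_opRange.mpr (hQ.apply_apply x)⟩,
      hp P (Q x) hP (hQG x hx) (hPG _ (hQG x hx))]
  have h3 : inner ℂ (P (Q x)) x = ((‖Q x‖ ^ 2 : ℝ) : ℂ) := by
    calc inner ℂ (P (Q x)) x = inner ℂ (Q x) (Q x) := by
          rw [hP.inner_apply_left, hPx, hQ.inner_apply_left, hQ.inner_apply_left, hQ.apply_apply]
      _ = _ := by
          push_cast
          exact inner_self_eq_norm_sq_to_K (Q x)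
  have h4 : ‖P (Q x) - Real.cos t ^ 2 • x‖ ^ 2 = 0 := by
    have := norm_sub_sq (𝕜 := ℂ) (E := CVec N) (P (Q x)) (Real.cos t ^ 2 • x)
    rw [real_smul_inner_right, h3, ← Complex.ofReal_mul] at this
    rw [this, h2, norm_smul, h1, Real.norm_eq_abs, abs_of_nonneg (sq_nonneg _)]
    simp only [RCLike.re_to_complex, Complex.ofReal_re]
    ring
  exact sub_eq_zero.mp (norm_eq_zero.mp ((pow_eq_zero_iff two_ne_zero).mp h4))

namespace IsAngleDecomposition


theorem isOrtho_of_ne (h : IsAngleDecomposition P Q γ F) {i j : Fin k} (hij : i ≠ j) : F i ⟂ F j :=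
  h.orthogonal (i := Sum.inr i) (j := Sum.inr j) (by simpa using hij)

theorem isOrtho_four (h : IsAngleDecomposition P Q γ F) (i : Fin 4) (j : Fin k) :
    (![spaceDD P Q, spaceND P Q, spaceDN P Q, spaceNN P Q] i) ⟂ F j :=
  h.orthogonal (i := Sum.inl i) (j := Sum.inr j) (by simp)

theorem iSup_eq_orthogonal (h : IsAngleDecomposition P Q γ F) :
    (⨆ i, F i) = (⨆ i, ![spaceDD P Q, spaceND P Q, spaceDN P Q, spaceNN P Q] i)ᗮ := by
  set G := ⨆ i, ![spaceDD P Q, spaceND P Q, spaceDN P Q, spaceNN P Q] i with hG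
  have h1 : G ⟂ ⨆ i, F i := by
    rw [hG]
    simp only [Submodule.isOrtho_iSup_left, Submodule.isOrtho_iSup_right]
    exact fun j i => h.isOrtho_four i j
  have h2 : G ⊔ ⨆ i, F i = ⊤ := by
    have := h.iSup_eq_top
    rwa [iSup_sum] at this
  refine le_antisymm h1.symm fun x hx => ?_
  obtain ⟨y, hy, z, hz, rfl⟩ := Submodule.mem_sup.mp (h2 ▸ Submodule.mem_top : x ∈ G ⊔ ⨆ i, F i)
  have h3 : y ∈ Gᗮ := by
    have := Gᗮ.sub_mem hx (h1.symm hz)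
    rwa [add_sub_cancel_right] at this
  have h4 : y = 0 := by
    have := Submodule.inner_right_of_mem_orthogonal hy h3
    exact inner_self_eq_zero.mp this
  rw [h4, zero_add]
  exact hz

/-- The sum of the blocks is the orthogonal complement of the four intersections. On each of these a
projector acts as `0` or `1`, and being symmetric it preserves the complement. -/
theorem apply_mem_iSup (h : IsAngleDecomposition P Q γ F) (hP : IsStarProjection P)
    (hQ : IsStarProjection Q) {x : CVec N} (hx : x ∈ ⨆ i, F i) : P x ∈ ⨆ i, F i ∧ Q x ∈ ⨆ i, F i := by
  rw [h.iSup_eq_orthogonal, ← Submodule.iInf_orthogonal, Submodule.mem_iInf] at hx ⊢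
  rw [Submodule.mem_iInf]
  have key : ∀ T : COp N, IsStarProjection T → ∀ i,
      (∀ y ∈ (![spaceDD P Q, spaceND P Q, spaceDN P Q, spaceNN P Q] i), T y = y ∨ T y = 0) →
      T x ∈ (![spaceDD P Q, spaceND P Q, spaceDN P Q, spaceNN P Q] i)ᗮ := by
    intro T hT i hi
    rw [Submodule.mem_orthogonal]
    intro y hy
    rw [← hT.inner_apply_left]
    rcases hi y hy with e | e
    · rw [e]; exact Submodule.inner_right_of_mem_orthogonal hy (hx i)
    · rw [e, inner_zero_left]
  constructor
  · intro i
    refine key P hP i ?_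
    fin_cases i
    · exact fun y hy => Or.inl ((mem_spaceDD hP hQ).mp hy).1
    · exact fun y hy => Or.inr ((mem_spaceND hP hQ).mp hy).1
    · exact fun y hy => Or.inl ((mem_spaceDN hP hQ).mp hy).1
    · exact fun y hy => Or.inr ((mem_spaceNN hP hQ).mp hy).1
  · intro i
    refine key Q hQ i ?_
    fin_cases i
    · exact fun y hy => Or.inl ((mem_spaceDD hP hQ).mp hy).2
    · exact fun y hy => Or.inl ((mem_spaceND hP hQ).mp hy).2
    · exact fun y hy => Or.inr ((mem_spaceDN hP hQ).mp hy).2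
    · exact fun y hy => Or.inr ((mem_spaceNN hP hQ).mp hy).2

theorem inf_opRange_inf_opRange (h : IsAngleDecomposition P Q γ F) (i : Fin k) :
    (F i ⊓ opRange P) ⊓ (F i ⊓ opRange Q) = ⊥ := by
  have h1 := (h.isOrtho_four 0 i).disjoint
  rw [eq_bot_iff, ← h1.eq_bot]
  exact fun x hx => ⟨⟨hx.1.2, hx.2.2⟩, hx.1.1⟩

theorem finrank_eq (h : IsAngleDecomposition P Q γ F) (i : Fin k) :
    Module.finrank ℂ (F i) = 2 * Module.finrank ℂ ↥(F i ⊓ opRange P) := by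
  have h1 := Submodule.finrank_sup_add_finrank_inf_eq (F i ⊓ opRange P) (F i ⊓ opRange Q)
  rw [h.inf_opRange_inf_opRange, finrank_bot, add_zero, ← h.eq_sup, ← (h.angle i).finrank_eq] at h1
  rw [h1, two_mul]

theorem pairwise_isOrtho_inf (h : IsAngleDecomposition P Q γ F) (T : COp N) :
    Pairwise fun i j => (F i ⊓ opRange T) ⟂ (F j ⊓ opRange T) := fun _ _ hij =>
  (h.isOrtho_of_ne hij).mono inf_le_left inf_le_left

/-- This is a dimension count. Inside the sum of the blocks the ranges of `P` and `Q` meet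
trivially, because `E^{DD}` is orthogonal to it, while the blockwise intersections already have
dimensions adding up to that of the whole sum. -/
theorem inf_opRange_eq_iSup (h : IsAngleDecomposition P Q γ F) :
    (⨆ i, F i) ⊓ opRange P = ⨆ i, F i ⊓ opRange P ∧
      (⨆ i, F i) ⊓ opRange Q = ⨆ i, F i ⊓ opRange Q := by
  have l1 : (⨆ i, F i ⊓ opRange P) ≤ (⨆ i, F i) ⊓ opRange P :=
    iSup_le fun i => inf_le_inf_right _ (le_iSup F i)
  have l2 : (⨆ i, F i ⊓ opRange Q) ≤ (⨆ i, F i) ⊓ opRange Q :=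
    iSup_le fun i => inf_le_inf_right _ (le_iSup F i)
  have d1 := finrank_iSup_of_pairwise_isOrtho _ (h.pairwise_isOrtho_inf P)
  have d2 := finrank_iSup_of_pairwise_isOrtho _ (h.pairwise_isOrtho_inf Q)
  have d3 := finrank_iSup_of_pairwise_isOrtho F fun i j hij => h.isOrtho_of_ne hij
  have hbot : ((⨆ i, F i) ⊓ opRange P) ⊓ ((⨆ i, F i) ⊓ opRange Q) = ⊥ := by
    have h1 : spaceDD P Q ⟂ ⨆ i, F i := by
      simp only [Submodule.isOrtho_iSup_right]
      exact fun i => h.isOrtho_four 0 i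
    rw [eq_bot_iff, ← h1.disjoint.eq_bot]
    exact fun x hx => ⟨⟨hx.1.2, hx.2.2⟩, hx.1.1⟩
  have d4 := Submodule.finrank_sup_add_finrank_inf_eq ((⨆ i, F i) ⊓ opRange P)
    ((⨆ i, F i) ⊓ opRange Q)
  rw [hbot, finrank_bot, add_zero] at d4
  have d5 : Module.finrank ℂ ↥(((⨆ i, F i) ⊓ opRange P) ⊔ ((⨆ i, F i) ⊓ opRange Q))
      ≤ Module.finrank ℂ ↥(⨆ i, F i) :=
    Submodule.finrank_mono (sup_le inf_le_left inf_le_left)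
  have d6 : ∑ i, Module.finrank ℂ (F i) = (∑ i, Module.finrank ℂ ↥(F i ⊓ opRange P))
      + ∑ i, Module.finrank ℂ ↥(F i ⊓ opRange Q) := by
    rw [← Finset.sum_add_distrib]
    refine Finset.sum_congr rfl fun i _ => ?_
    rw [h.finrank_eq, ← (h.angle i).finrank_eq, two_mul]
  have m1 := Submodule.finrank_mono l1
  have m2 := Submodule.finrank_mono l2
  exact ⟨(Submodule.eq_of_le_of_finrank_le l1 (by omega)).symm,
    (Submodule.eq_of_le_of_finrank_le l2 (by omega)).symm⟩


/-- The vector `T x` lies in the sum of the spaces `F j ⊓ opRange T`. By symmetry of `T` it is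
orthogonal to those with `j ≠ i`, since `x` is. -/
theorem apply_mem_of_mem (h : IsAngleDecomposition P Q γ F) {T : COp N} (hT : IsStarProjection T)
    (heq : (⨆ i, F i) ⊓ opRange T = ⨆ i, F i ⊓ opRange T) (hmem : ∀ x ∈ ⨆ i, F i, T x ∈ ⨆ i, F i)
    (i : Fin k) : ∀ x ∈ F i, T x ∈ F i := by
  intro x hx
  have h1 : T x ∈ ⨆ i, F i ⊓ opRange T := heq ▸
    ⟨hmem x (le_iSup F i hx), hT.mem_opRange.mpr (hT.apply_apply x)⟩
  refine (mem_of_mem_iSup_of_isOrtho (h.pairwise_isOrtho_inf T) h1 fun j hj y hy => ?_).1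
  rw [← hT.inner_apply_left, hT.mem_opRange.mp hy.2]
  exact (Submodule.isOrtho_iff_inner_eq.mp (h.isOrtho_of_ne hj)) _ hy.1 _ hx

/-- Invariance under the projectors is not part of the definition of a decomposition; it is derived
here, so that the counts hold for every decomposition and not just for the spectral one. -/
theorem isAngleBlock (h : IsAngleDecomposition P Q γ F) (hP : IsStarProjection P)
    (hQ : IsStarProjection Q) (i : Fin k) : IsAngleBlock P Q (γ i) (F i) := by
  obtain ⟨e1, e2⟩ := h.inf_opRange_eq_iSup
  have m1 := h.apply_mem_of_mem hP e1 (fun x hx => (h.apply_mem_iSup hP hQ hx).1) i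
  have m2 := h.apply_mem_of_mem hQ e2 (fun x hx => (h.apply_mem_iSup hP hQ hx).2) i
  refine ⟨m1, m2, fun x hx => ?_⟩
  rw [h.eq_sup i] at hx
  obtain ⟨p, hp, q, hq, rfl⟩ := Submodule.mem_sup.mp hx
  have hp2 := hP.mem_opRange.mp hp.2
  have hq2 := hQ.mem_opRange.mp hq.2
  rw [map_add, smul_add, cosSqOp_apply_of_apply_eq hP hQ hp2,
    (h.angle i).apply_apply hP hQ m1 m2 hp.1 hp2, cosSqOp_comm P Q,
    cosSqOp_apply_of_apply_eq hQ hP hq2, (h.angle i).symm.apply_apply hQ hP m2 m1 hq.1 hq2]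

end IsAngleDecomposition

end AngleDecomposition

/-! ### Lower bounds and kernel of the boundary matrix. -/

section BoundaryOperator

variable {N k : ℕ} {P Q : COp N} {γ : Fin k → ℝ} {F : Fin k → Submodule ℂ (CVec N)} {κ : ℝ}

theorem boundaryOp_apply_mem {G : Submodule ℂ (CVec N)} (hP : ∀ x ∈ G, P x ∈ G)
    (hQ : ∀ x ∈ G, Q x ∈ G) : ∀ x ∈ G, boundaryOp P Q κ x ∈ G := by
  have hr : ∀ (c : ℝ), ∀ x ∈ G, c • x ∈ G := fun c x hx => by
    rw [← Complex.coe_smul]; exact G.smul_mem _ hx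
  have hs : ∀ T : COp N, (∀ x ∈ G, T x ∈ G) → ∀ x ∈ G, (1 - T) x ∈ G := fun T hT x hx =>
    G.sub_mem hx (hT x hx)
  intro x hx
  rw [boundaryOp_apply]
  exact G.add_mem (hQ _ (G.add_mem (hr _ _ (hs P hP x hx)) (hr _ _ (hP x hx))))
    (hs Q hQ _ (G.sub_mem (hr _ _ (hP x hx)) (hr _ _ (hs P hP x hx))))

theorem boundaryOp_spaceDD (hP : IsStarProjection P) (hQ : IsStarProjection Q) :
    ∀ x ∈ spaceDD P Q, boundaryOp P Q κ x = Real.sin κ • x := by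
  intro x hx
  obtain ⟨h1, h2⟩ := (mem_spaceDD hP hQ).mp hx
  simp [boundaryOp_apply, h1, h2]

theorem boundaryOp_spaceND (hP : IsStarProjection P) (hQ : IsStarProjection Q) :
    ∀ x ∈ spaceND P Q, boundaryOp P Q κ x = Real.cos κ • x := by
  intro x hx
  obtain ⟨h1, h2⟩ := (mem_spaceND hP hQ).mp hx
  simp [boundaryOp_apply, h1, h2]

theorem boundaryOp_spaceDN (hP : IsStarProjection P) (hQ : IsStarProjection Q) :
    ∀ x ∈ spaceDN P Q, boundaryOp P Q κ x = Real.cos κ • x := by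
  intro x hx
  obtain ⟨h1, h2⟩ := (mem_spaceDN hP hQ).mp hx
  simp [boundaryOp_apply, h1, h2]

theorem boundaryOp_spaceNN (hP : IsStarProjection P) (hQ : IsStarProjection Q) :
    ∀ x ∈ spaceNN P Q, boundaryOp P Q κ x = (-Real.sin κ) • x := by
  intro x hx
  obtain ⟨h1, h2⟩ := (mem_spaceNN hP hQ).mp hx
  simp [boundaryOp_apply, h1, h2]

/-- The boundary operator divides `cos² κ - (P + Q - 1)²`. -/
theorem boundaryOp_adjugate (hP : IsStarProjection P) (hQ : IsStarProjection Q) (x : CVec N) :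
    Real.cos κ ^ 2 • x - cosSqOp P Q x
      = Real.cos κ • (P (boundaryOp P Q κ x - Q (boundaryOp P Q κ x))
          + (Q (boundaryOp P Q κ x) - P (Q (boundaryOp P Q κ x))))
        + Real.sin κ • ((boundaryOp P Q κ x - Q (boundaryOp P Q κ x))
          - P (boundaryOp P Q κ x)) := by
  have hcs := Real.sin_sq_add_cos_sq κ
  simp only [boundaryOp_apply, cosSqOp_apply, map_add, map_sub, COp.map_real_smul, sub_apply,
    one_apply_eq_self, hP.apply_apply, hQ.apply_apply, smul_add, smul_sub]
  match_scalars <;> first | ring1 | linear_combination hcs |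
    linear_combination -hcs

/-- In `boundaryOp_adjugate` the cofactor consists of four terms of norm at most `‖y‖`, so `5` is a
generous constant. Thus `boundaryOp` is bounded below on an angle block as long as `cos² κ` keeps
away from `cos² γ`. -/
theorem norm_cos_sq_smul_sub_le (hP : IsStarProjection P) (hQ : IsStarProjection Q)
    (x : CVec N) : ‖Real.cos κ ^ 2 • x - cosSqOp P Q x‖ ≤ 5 * ‖boundaryOp P Q κ x‖ := by
  set y := boundaryOp P Q κ x with hy
  rw [boundaryOp_adjugate hP hQ]
  have hle : ∀ (c : ℝ) (z : CVec N), |c| ≤ 1 → ‖c • z‖ ≤ ‖z‖ := fun c z hc => by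
    rw [norm_smul]; exact mul_le_of_le_one_left (norm_nonneg _) hc
  have h1 : ‖y - Q y‖ ≤ ‖y‖ := hQ.one_sub.norm_apply_le y
  have h2 : ‖Q y - P (Q y)‖ ≤ ‖Q y‖ := hP.one_sub.norm_apply_le (Q y)
  have h3 := hQ.norm_apply_le y
  have h4 := hP.norm_apply_le y
  have h5 := hP.norm_apply_le (y - Q y)
  have h6 := hle _ (P (y - Q y) + (Q y - P (Q y))) (Real.abs_cos_le_one κ)
  have h7 := hle _ (y - Q y - P y) (Real.abs_sin_le_one κ)
  have h8 := norm_add_le (P (y - Q y)) (Q y - P (Q y))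
  have h9 := norm_sub_le (y - Q y) (P y)
  have := norm_nonneg y
  refine (norm_add_le _ _).trans ?_
  linarith

theorem finrank_inf_ker_of_apply_eq_smul {T : COp N} {G : Submodule ℂ (CVec N)} {c : ℝ}
    (h : ∀ x ∈ G, T x = c • x) :
    Module.finrank ℂ ↥(G ⊓ LinearMap.ker (T : CVec N →ₗ[ℂ] CVec N))
      = if c = 0 then Module.finrank ℂ G else 0 := by
  split_ifs with hc
  · have : G ⊓ LinearMap.ker (T : CVec N →ₗ[ℂ] CVec N) = G := by
      refine inf_eq_left.mpr fun x hx => ?_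
      have := h x hx
      rw [hc, zero_smul] at this
      exact this
    rw [this]
  · have : G ⊓ LinearMap.ker (T : CVec N →ₗ[ℂ] CVec N) = ⊥ := by
      rw [eq_bot_iff]
      rintro x ⟨hx, hk⟩
      have h1 := h x hx
      have h2 : T x = 0 := hk
      rw [h2, eq_comm, smul_eq_zero] at h1
      exact h1.resolve_left hc
    rw [this, finrank_bot]

/-- The two summands lie in the complementary ranges of `Q` and `1 - Q` and vanish separately. They
are the two right boundary conditions of the free solution with amplitude `x`. -/
theorem boundaryOp_eq_zero_iff (hQ : IsStarProjection Q) {x : CVec N} :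
    boundaryOp P Q κ x = 0 ↔ Q (Real.cos κ • (x - P x) + Real.sin κ • P x) = 0 ∧
      Q (Real.cos κ • P x - Real.sin κ • (x - P x)) = Real.cos κ • P x - Real.sin κ • (x - P x) := by
  set u := Real.cos κ • (x - P x) + Real.sin κ • P x with hu
  set v := Real.cos κ • P x - Real.sin κ • (x - P x) with hv
  have he : boundaryOp P Q κ x = Q u + (v - Q v) := rfl
  rw [he]
  constructor
  · intro h
    have h1 := congrArg Q h
    rw [map_add, map_sub, hQ.apply_apply, hQ.apply_apply, sub_self, add_zero, map_zero] at h1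
    rw [h1, zero_add] at h
    exact ⟨h1, (sub_eq_zero.mp h).symm⟩
  · rintro ⟨h1, h2⟩
    rw [h1, h2, sub_self, add_zero]

theorem IsAngleBlock.finrank_inf_ker_boundaryOp {t : ℝ} {G : Submodule ℂ (CVec N)}
    (h : IsAngleBlock P Q t G) (hP : IsStarProjection P) (hQ : IsStarProjection Q)
    (hκ : Real.cos κ ^ 2 = Real.cos t ^ 2) (hc : Real.cos κ ≠ 0) (hs : Real.sin κ ≠ 0) :
    Module.finrank ℂ ↥(G ⊓ LinearMap.ker (boundaryOp P Q κ : CVec N →ₗ[ℂ] CVec N))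
      = Module.finrank ℂ ↥(G ⊓ opRange P) := by
  have hcs := Real.sin_sq_add_cos_sq κ
  have hr : ∀ (c : ℝ), ∀ x ∈ G, c • x ∈ G := fun c x hx => by
    rw [← Complex.coe_smul]; exact G.smul_mem _ hx
  refine le_antisymm ?_ ?_
  · let f : ↥(G ⊓ LinearMap.ker (boundaryOp P Q κ : CVec N →ₗ[ℂ] CVec N)) →ₗ[ℂ]
        ↥(G ⊓ opRange P) :=
      (P : CVec N →ₗ[ℂ] CVec N).restrict fun x hx =>
        ⟨h.apply_mem_left x hx.1, hP.mem_opRange.mpr (hP.apply_apply x)⟩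
    refine LinearMap.finrank_le_finrank_of_injective (f := f) ?_
    rw [injective_iff_map_eq_zero]
    intro x hx
    have h1 : P x = 0 := congrArg Subtype.val hx
    have h2 : boundaryOp P Q κ x = 0 := x.2.2
    rw [boundaryOp_eq_zero_iff hQ, h1, sub_zero, smul_zero, smul_zero, add_zero, zero_sub,
      map_neg, COp.map_real_smul, COp.map_real_smul, neg_inj] at h2
    have h3 : Q (x : CVec N) = 0 := (smul_eq_zero.mp h2.1).resolve_left hc
    rw [h3] at h2
    exact Subtype.ext ((smul_eq_zero.mp (h2.2.symm.trans (smul_zero _))).resolve_left hs)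
  · let g₀ : CVec N →ₗ[ℂ] CVec N := LinearMap.id
      + ((Real.cos κ / Real.sin κ : ℝ) : ℂ) • (LinearMap.id - (Q : CVec N →ₗ[ℂ] CVec N))
      - ((Real.sin κ / Real.cos κ : ℝ) : ℂ) • (Q : CVec N →ₗ[ℂ] CVec N)
    have hg₀ : ∀ p, g₀ p = p + (Real.cos κ / Real.sin κ) • (p - Q p)
        - (Real.sin κ / Real.cos κ) • Q p := fun p => by
      rw [← Complex.coe_smul, ← Complex.coe_smul]; rfl
    have hPg : ∀ p ∈ G ⊓ opRange P, P (g₀ p) = p := by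
      intro p hp
      have hp2 := hP.mem_opRange.mp hp.2
      have hPQ := h.apply_apply_left hP hQ hp.1 hp2
      rw [← hκ] at hPQ
      rw [hg₀, map_sub, map_add, COp.map_real_smul, COp.map_real_smul, map_sub, hPQ, hp2]
      match_scalars
      field_simp
      linear_combination (-Real.cos κ) * hcs
    let g : ↥(G ⊓ opRange P) →ₗ[ℂ]
        ↥(G ⊓ LinearMap.ker (boundaryOp P Q κ : CVec N →ₗ[ℂ] CVec N)) :=
      g₀.restrict fun p hp => by
        have hQp := h.apply_mem_right p hp.1
        constructor
        · rw [hg₀]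
          exact G.sub_mem (G.add_mem hp.1 (hr _ _ (G.sub_mem hp.1 hQp))) (hr _ _ hQp)
        · change boundaryOp P Q κ (g₀ p) = 0
          rw [boundaryOp_eq_zero_iff hQ, hPg p hp, hg₀]
          constructor
          · simp only [map_add, map_sub, COp.map_real_smul, hQ.apply_apply]
            match_scalars
            field_simp
            ring
          · simp only [map_add, map_sub, COp.map_real_smul, hQ.apply_apply]
            match_scalars <;> field_simp <;> ring
    refine LinearMap.finrank_le_finrank_of_injective (f := g) ?_
    intro p q hpq
    have h1 : g₀ p = g₀ q := congrArg Subtype.val hpq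
    exact Subtype.ext (by rw [← hPg p p.2, ← hPg q q.2, h1])

namespace IsAngleDecomposition

theorem cos_sq_mem (h : IsAngleDecomposition P Q γ F) (i : Fin k) :
    0 < Real.cos (γ i) ∧ 0 < Real.sin (γ i) :=
  ⟨Real.cos_pos_of_mem_Ioo ⟨by linarith [(h.angle i).pos, Real.pi_pos], (h.angle i).lt⟩,
    Real.sin_pos_of_pos_of_lt_pi (h.angle i).pos (by linarith [(h.angle i).lt, Real.pi_pos])⟩

theorem boundaryOp_apply_mem (h : IsAngleDecomposition P Q γ F) (hP : IsStarProjection P)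
    (hQ : IsStarProjection Q) (j : Fin 4 ⊕ Fin k) : ∀ x ∈ decompositionFamily P Q F j,
      boundaryOp P Q κ x ∈ decompositionFamily P Q F j := by
  have hs : ∀ (G : Submodule ℂ (CVec N)) (c : ℝ), (∀ x ∈ G, boundaryOp P Q κ x = c • x) →
      ∀ x ∈ G, boundaryOp P Q κ x ∈ G := fun G c hG x hx => by
    rw [hG x hx, ← Complex.coe_smul]; exact G.smul_mem _ hx
  rcases j with j | i
  · fin_cases j
    · exact hs _ _ (boundaryOp_spaceDD hP hQ)
    · exact hs _ _ (boundaryOp_spaceND hP hQ)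
    · exact hs _ _ (boundaryOp_spaceDN hP hQ)
    · exact hs _ _ (boundaryOp_spaceNN hP hQ)
  · have hb := h.isAngleBlock hP hQ i
    exact _root_.boundaryOp_apply_mem hb.apply_mem_left hb.apply_mem_right

theorem le_norm_boundaryOp (h : IsAngleDecomposition P Q γ F) (hP : IsStarProjection P)
    (hQ : IsStarProjection Q) {c : ℝ} (hc : 0 ≤ c) (h1 : c ≤ |Real.sin κ|)
    (h2 : c ≤ |Real.cos κ|) (h3 : ∀ i, 5 * c ≤ |Real.cos κ ^ 2 - Real.cos (γ i) ^ 2|)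
    (x : CVec N) : c * ‖x‖ ≤ ‖boundaryOp P Q κ x‖ := by
  refine le_norm_of_isOrtho h.orthogonal h.iSup_eq_top (h.boundaryOp_apply_mem hP hQ) hc ?_ x
  have hs : ∀ (G : Submodule ℂ (CVec N)) (d : ℝ), (∀ x ∈ G, boundaryOp P Q κ x = d • x) →
      c ≤ |d| → ∀ x ∈ G, c * ‖x‖ ≤ ‖boundaryOp P Q κ x‖ := fun G d hG hd x hx => by
    rw [hG x hx, norm_smul]; exact mul_le_mul_of_nonneg_right hd (norm_nonneg _)
  rintro (j | i)
  · fin_cases j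
    · exact hs _ _ (boundaryOp_spaceDD hP hQ) h1
    · exact hs _ _ (boundaryOp_spaceND hP hQ) h2
    · exact hs _ _ (boundaryOp_spaceDN hP hQ) h2
    · exact hs _ _ (boundaryOp_spaceNN hP hQ) (by rwa [abs_neg])
  · intro x hx
    have h4 := norm_cos_sq_smul_sub_le (κ := κ) hP hQ x
    rw [(h.isAngleBlock hP hQ i).cosSqOp_apply x hx, ← sub_smul, norm_smul,
      Real.norm_eq_abs] at h4
    have h5 := mul_le_mul_of_nonneg_right (h3 i) (norm_nonneg x)
    linarith

theorem finrank_ker_boundaryOp (h : IsAngleDecomposition P Q γ F) (hP : IsStarProjection P)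
    (hQ : IsStarProjection Q) (κ : ℝ) :
    Module.finrank ℂ (LinearMap.ker (boundaryOp P Q κ : CVec N →ₗ[ℂ] CVec N))
      = (if Real.sin κ = 0 then
          Module.finrank ℂ (spaceNN P Q) + Module.finrank ℂ (spaceDD P Q) else 0)
        + (if Real.cos κ = 0 then
          Module.finrank ℂ (spaceND P Q) + Module.finrank ℂ (spaceDN P Q) else 0)
        + ∑ i, if Real.cos κ ^ 2 = Real.cos (γ i) ^ 2 then
            Module.finrank ℂ ↥(F i ⊓ opRange P) else 0 := by
  rw [finrank_ker_of_isOrtho h.orthogonal h.iSup_eq_top (h.boundaryOp_apply_mem hP hQ),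
    Fintype.sum_sum_type, Fin.sum_univ_four]
  congr 1
  · have e0 := finrank_inf_ker_of_apply_eq_smul (boundaryOp_spaceDD (κ := κ) hP hQ)
    have e1 := finrank_inf_ker_of_apply_eq_smul (boundaryOp_spaceND (κ := κ) hP hQ)
    have e2 := finrank_inf_ker_of_apply_eq_smul (boundaryOp_spaceDN (κ := κ) hP hQ)
    have e3 := finrank_inf_ker_of_apply_eq_smul (boundaryOp_spaceNN (κ := κ) hP hQ)
    simp only [neg_eq_zero] at e3
    refine (congrArg₂ (· + ·) (congrArg₂ (· + ·) (congrArg₂ (· + ·) e0 e1) e2) e3).trans ?_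
    split_ifs <;> omega
  · refine Finset.sum_congr rfl fun i _ => ?_
    change Module.finrank ℂ ↥(F i ⊓ LinearMap.ker (boundaryOp P Q κ : CVec N →ₗ[ℂ] CVec N)) = _
    obtain ⟨c1, s1⟩ := h.cos_sq_mem i
    have hb := h.isAngleBlock hP hQ i
    split_ifs with hκ
    · refine hb.finrank_inf_ker_boundaryOp hP hQ hκ ?_ ?_
      · intro h0
        rw [h0, zero_pow two_ne_zero] at hκ
        have := pow_pos c1 2
        linarith
      · intro h0
        have e1 := Real.sin_sq_add_cos_sq κ
        have e2 := Real.sin_sq_add_cos_sq (γ i)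
        rw [h0, hκ] at e1
        have := pow_pos s1 2
        linarith
    · have : F i ⊓ LinearMap.ker (boundaryOp P Q κ : CVec N →ₗ[ℂ] CVec N) = ⊥ := by
        rw [eq_bot_iff]
        rintro x ⟨hx, hk⟩
        have h4 := norm_cos_sq_smul_sub_le (κ := κ) hP hQ x
        have h5 : boundaryOp P Q κ x = 0 := hk
        rw [h5, norm_zero, mul_zero, hb.cosSqOp_apply x hx, ← sub_smul] at h4
        exact (smul_eq_zero.mp (norm_le_zero_iff.mp h4)).resolve_left (sub_ne_zero.mpr hκ)
      rw [this, finrank_bot]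

theorem dimension_eq (h : IsAngleDecomposition P Q γ F) :
    N = Module.finrank ℂ (spaceNN P Q) + Module.finrank ℂ (spaceDD P Q)
      + (Module.finrank ℂ (spaceND P Q) + Module.finrank ℂ (spaceDN P Q))
      + 2 * ∑ i, Module.finrank ℂ ↥(F i ⊓ opRange P) := by
  have h1 := finrank_iSup_of_pairwise_isOrtho _ h.orthogonal
  rw [h.iSup_eq_top, finrank_top, finrank_euclideanSpace_fin, Fintype.sum_sum_type,
    Fin.sum_univ_four] at h1
  have h2 : ∑ i, Module.finrank ℂ ↥(decompositionFamily P Q F (Sum.inr i))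
      = 2 * ∑ i, Module.finrank ℂ ↥(F i ⊓ opRange P) := by
    rw [Finset.mul_sum]
    exact Finset.sum_congr rfl fun i _ => h.finrank_eq i
  rw [h2] at h1
  change N = Module.finrank ℂ (spaceDD P Q) + Module.finrank ℂ (spaceND P Q)
    + Module.finrank ℂ (spaceDN P Q) + Module.finrank ℂ (spaceNN P Q) + _ at h1
  omega

end IsAngleDecomposition

end BoundaryOperator

/-! ### Eigenspaces of the free operator. -/

section FreeOperator

variable {N : ℕ} {Tm Tp : COp N} {κ : ℝ}

theorem COp.isSelfAdjoint_zero : IsSelfAdjoint (0 : COp N) := by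
  rw [ContinuousLinearMap.isSelfAdjoint_iff_isSymmetric]
  intro x y
  simp

theorem isSLData_zero (Tm Tp : COp N) {R : ℝ} (hR : 0 ≤ R) :
    IsSLData Tm Tp 0 0 (fun _ => 0) R :=
  have hn : ‖(0 : COp N)‖ ≤ R := by rw [norm_zero]; exact hR
  { selfAdjoint_left := COp.isSelfAdjoint_zero
    compress_left := by rw [mul_zero, zero_mul]
    norm_left := hn
    selfAdjoint_right := COp.isSelfAdjoint_zero
    compress_right := by rw [mul_zero, zero_mul]
    norm_right := hn
    integrable := continuousOn_const.integrableOn_Icc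
    selfAdjoint := .of_forall fun _ => COp.isSelfAdjoint_zero
    integral_le := by simp only [norm_zero, integral_zero]; exact hR }

/-- The solution of `-ψ'' = κ² ψ` with the boundary condition at the left end and amplitude `x`. -/
noncomputable def freeSolution (Tm : COp N) (κ : ℝ) (x : CVec N) (s : ℝ) : CVec N :=
  Real.cos (κ * s) • (x - Tm x) + Real.sin (κ * s) • Tm x

theorem continuous_freeSolution (Tm : COp N) (κ : ℝ) (x : CVec N) :
    Continuous (freeSolution Tm κ x) := by
  unfold freeSolution
  fun_prop

/-- The solution operator, with values in `L²`. -/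
noncomputable def freeSolutionMap (Tm : COp N) (κ : ℝ) : CVec N →ₗ[ℂ] L2Vec N where
  toFun x := (memLp_of_continuousOn (continuous_freeSolution Tm κ x).continuousOn).toLp _
  map_add' x y := by
    rw [← MemLp.toLp_add]
    refine (MemLp.toLp_eq_toLp_iff _ _).mpr (.of_forall fun s => ?_)
    simp only [freeSolution, Pi.add_apply, map_add]
    module
  map_smul' c x := by
    rw [RingHom.id_apply, ← MemLp.toLp_const_smul]
    refine (MemLp.toLp_eq_toLp_iff _ _).mpr (.of_forall fun s => ?_)
    simp only [freeSolution, Pi.smul_apply, map_smul, smul_add, smul_sub,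
      smul_comm _ (_ : ℝ) (_ : CVec N)]

theorem freeSolutionMap_ae_eq (Tm : COp N) (κ : ℝ) (x : CVec N) :
    ∀ᵐ s ∂(volume.restrict (Icc (0 : ℝ) 1)), freeSolutionMap Tm κ x s = freeSolution Tm κ x s :=
  MemLp.coeFn_toLp (memLp_of_continuousOn (continuous_freeSolution Tm κ x).continuousOn)

theorem freeSolution_hasSecondDeriv (κ : ℝ) (x : CVec N) :
    HasSecondDeriv (freeSolution Tm κ x)
      (fun s => κ • (Real.cos (κ * s) • Tm x - Real.sin (κ * s) • (x - Tm x)))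
      (fun s => -(κ ^ 2 • freeSolution Tm κ x s)) := by
  have e : ∀ s : ℝ, HasDerivAt (fun s : ℝ => κ * s) κ s := fun s => by
    simpa using (hasDerivAt_id s).const_mul κ
  refine .of_isPrimitive (.of_hasDerivAt (fun s => ?_) ?_) (.of_hasDerivAt (fun s => ?_) ?_)
  · refine ((((e s).cos.smul_const (Tm x)).sub ((e s).sin.smul_const (x - Tm x))).const_smul
      κ).congr_deriv ?_
    simp only [freeSolution]
    module
  · have := continuous_freeSolution Tm κ x
    fun_prop
  · refine (((e s).cos.smul_const (x - Tm x)).add ((e s).sin.smul_const (Tm x))).congr_deriv ?_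
    module
  · fun_prop

theorem freeSolution_isSLSolution_iff (hTm : IsStarProjection Tm) (hTp : IsStarProjection Tp)
    (hκ : κ ≠ 0) (x : CVec N) :
    IsSLSolution Tm Tp 0 0 (fun _ => 0) (κ ^ 2) (fun _ => 0) (freeSolution Tm κ x)
      (fun s => κ • (Real.cos (κ * s) • Tm x - Real.sin (κ * s) • (x - Tm x)))
      (fun s => -(κ ^ 2 • freeSolution Tm κ x s)) ↔ boundaryOp Tm Tp κ x = 0 := by
  have hplus : boundaryPlus Tp 0 (freeSolution Tm κ x 1)
      (κ • (Real.cos (κ * 1) • Tm x - Real.sin (κ * 1) • (x - Tm x))) = 0 ↔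
      boundaryOp Tm Tp κ x = 0 := by
    rw [boundaryPlus_eq_zero_iff hTp (by simp), boundaryOp_eq_zero_iff hTp, freeSolution, mul_one,
      COp.map_real_smul, zero_apply, neg_zero, smul_eq_zero, or_iff_right hκ, sub_apply,
      one_apply_eq_self, sub_eq_zero]
    exact and_congr_right fun _ => eq_comm
  constructor
  · exact fun h => hplus.mp h.plus
  · intro h
    refine ⟨freeSolution_hasSecondDeriv κ x, ?_, hplus.mpr h, .of_forall fun s => by simp⟩
    rw [boundaryMinus_eq_zero_iff hTm (by simp)]
    simp [freeSolution, hTm.apply_apply]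

/-- Without potential and source the defect driving the amplitudes vanishes, so they are constant
and equal to the Cauchy data at `0`. -/
theorem IsSLSolution.exists_freeSolution (hTm : IsStarProjection Tm) (hκ : 0 < κ)
    {ψ φ χ : ℝ → CVec N}
    (h : IsSLSolution Tm Tp 0 0 (fun _ => 0) (κ ^ 2) (fun _ => 0) ψ φ χ) :
    ∃ x, (∀ s ∈ Icc (0 : ℝ) 1, ψ s = freeSolution Tm κ x s) ∧
      φ 1 = κ • (Real.cos (κ * 1) • Tm x - Real.sin (κ * 1) • (x - Tm x)) := by
  have hm := (boundaryMinus_eq_zero_iff hTm (by simp)).mp h.minus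
  have h1 : Tm (φ 0) = φ 0 := by
    have := hm.2
    rw [sub_apply, one_apply_eq_self, zero_apply, sub_eq_zero] at this
    exact this.symm
  have hint : ∫ t in Icc (0 : ℝ) 1, ‖χ t + κ ^ 2 • ψ t‖ = 0 := by
    rw [integral_eq_zero_of_ae]
    filter_upwards [h.eq] with t ht
    simp [ht]
  have hT : Tm (ψ 0 + κ⁻¹ • φ 0) = κ⁻¹ • φ 0 := by
    rw [map_add, hm.1, zero_add, COp.map_real_smul, h1]
  have key : ∀ s ∈ Icc (0 : ℝ) 1, ψ s = freeSolution Tm κ (ψ 0 + κ⁻¹ • φ 0) s ∧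
      φ s = κ • (Real.cos (κ * s) • Tm (ψ 0 + κ⁻¹ • φ 0)
        - Real.sin (κ * s) • ((ψ 0 + κ⁻¹ • φ 0) - Tm (ψ 0 + κ⁻¹ • φ 0))) := by
    intro s hs
    obtain ⟨p, q, e1, e2, e3, e4⟩ := h.hasSecondDeriv.exists_amplitudes hκ hs
    rw [hint, mul_zero] at e3 e4
    rw [freeSolution, hT, add_sub_cancel_right, e1, e2,
      sub_eq_zero.mp (norm_le_zero_iff.mp e3), sub_eq_zero.mp (norm_le_zero_iff.mp e4)]
    exact ⟨rfl, rfl⟩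
  exact ⟨ψ 0 + κ⁻¹ • φ 0, fun s hs => (key s hs).1, (key 1 (by simp)).2⟩

theorem freeSolutionMap_mem_iff (hTm : IsStarProjection Tm) (hTp : IsStarProjection Tp)
    (hκ : 0 < κ) {u : L2Vec N} :
    u ∈ sturmLiouvilleEigenspace Tm Tp 0 0 (fun _ => 0) (κ ^ 2) ↔
      ∃ x, boundaryOp Tm Tp κ x = 0 ∧ freeSolutionMap Tm κ x = u := by
  rw [mem_sturmLiouvilleEigenspace_iff_homogeneous]
  constructor
  · rintro ⟨ψ, φ, χ, h, he⟩
    obtain ⟨x, hx, hx1⟩ := h.exists_freeSolution hTm hκ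
    refine ⟨x, ?_, ?_⟩
    · have h1 := (boundaryPlus_eq_zero_iff hTp (by simp)).mp h.plus
      rw [hx 1 (by simp), hx1, freeSolution, mul_one, COp.map_real_smul, zero_apply, neg_zero,
        smul_eq_zero, or_iff_right hκ.ne', sub_apply, one_apply_eq_self, sub_eq_zero] at h1
      exact (boundaryOp_eq_zero_iff hTp).mpr ⟨h1.1, h1.2.symm⟩
    · refine Lp.ext ?_
      filter_upwards [he, freeSolutionMap_ae_eq Tm κ x, ae_restrict_mem measurableSet_Icc]
        with s e1 e2 hs
      rw [e1, e2, hx s hs]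
  · rintro ⟨x, hx, rfl⟩
    exact ⟨_, _, _, (freeSolution_isSLSolution_iff hTm hTp hκ.ne' x).mpr hx,
      freeSolutionMap_ae_eq Tm κ x⟩

theorem eqOn_zero_of_freeSolutionMap_eq_zero {x : CVec N} (h : freeSolutionMap Tm κ x = 0) :
    EqOn (freeSolution Tm κ x) (fun _ => 0) (Icc 0 1) := by
  have h1 : ∀ᵐ s ∂(volume.restrict (Icc (0 : ℝ) 1)), freeSolution Tm κ x s = 0 := by
    filter_upwards [freeSolutionMap_ae_eq Tm κ x,
      Lp.coeFn_zero (CVec N) 2 (volume.restrict (Icc (0 : ℝ) 1))] with s e1 e2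
    rw [← e1, h, e2]
    rfl
  exact Measure.eqOn_Icc_of_ae_eq volume zero_ne_one h1
    (continuous_freeSolution Tm κ x).continuousOn continuousOn_const

theorem freeSolutionMap_eq_zero (hκ : 0 < κ) {x : CVec N} (h : freeSolutionMap Tm κ x = 0) :
    x = 0 := by
  have h2 := eqOn_zero_of_freeSolutionMap_eq_zero h
  have h3 : x - Tm x = 0 := by
    have := h2 (x := 0) (by simp)
    simpa [freeSolution] using this
  -- At the point `min 1 κ⁻¹` of `[0,1]` the phase lies in `(0, 1]`, where the sine does not vanish.
  have hm0 : 0 < min 1 κ⁻¹ := lt_min one_pos (inv_pos.mpr hκ)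
  have h4 := h2 (x := min 1 κ⁻¹) ⟨hm0.le, min_le_left _ _⟩
  simp only [freeSolution, h3, smul_zero, zero_add, smul_eq_zero] at h4
  have h5 : κ * min 1 κ⁻¹ ≤ 1 := by
    calc κ * min 1 κ⁻¹ ≤ κ * κ⁻¹ := by gcongr; exact min_le_right _ _
      _ = 1 := mul_inv_cancel₀ hκ.ne'
  have h6 : Real.sin (κ * min 1 κ⁻¹) ≠ 0 :=
    (Real.sin_pos_of_pos_of_lt_pi (by positivity) (by linarith [Real.pi_gt_three])).ne'
  have h7 := h4.resolve_left h6
  rw [h7, sub_zero] at h3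
  exact h3

theorem finrank_sturmLiouvilleEigenspace_free (hTm : IsStarProjection Tm)
    (hTp : IsStarProjection Tp) (hκ : 0 < κ) :
    FiniteDimensional ℂ (sturmLiouvilleEigenspace Tm Tp 0 0 (fun _ => 0) (κ ^ 2)) ∧
      Module.finrank ℂ (sturmLiouvilleEigenspace Tm Tp 0 0 (fun _ => 0) (κ ^ 2))
        = Module.finrank ℂ (LinearMap.ker (boundaryOp Tm Tp κ : CVec N →ₗ[ℂ] CVec N)) := by
  have he : sturmLiouvilleEigenspace Tm Tp 0 0 (fun _ => 0) (κ ^ 2)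
      = (LinearMap.ker (boundaryOp Tm Tp κ : CVec N →ₗ[ℂ] CVec N)).map (freeSolutionMap Tm κ) := by
    ext u
    rw [freeSolutionMap_mem_iff hTm hTp hκ, Submodule.mem_map]
    rfl
  have hinj : Function.Injective (freeSolutionMap Tm κ) :=
    (injective_iff_map_eq_zero _).mpr fun x hx => freeSolutionMap_eq_zero hκ hx
  rw [he]
  exact ⟨inferInstance, (Submodule.equivMapOfInjective _ hinj _).finrank_eq.symm⟩

/-- The eigenvalue `0` needs its own argument because `κ > 0` is assumed above. For `R = 0` and `μ =
0` the energy estimate gives `φ = 0`, so the eigenfunctions are the constants in `E^{NN}`. -/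
theorem finrank_sturmLiouvilleEigenspace_zero (hTm : IsStarProjection Tm)
    (hTp : IsStarProjection Tp) :
    FiniteDimensional ℂ (sturmLiouvilleEigenspace Tm Tp 0 0 (fun _ => 0) 0) ∧
      Module.finrank ℂ (sturmLiouvilleEigenspace Tm Tp 0 0 (fun _ => 0) 0)
        = Module.finrank ℂ (spaceNN Tm Tp) := by
  -- With zero projector and zero frequency, `freeSolutionMap` is the embedding of constant
  -- functions.
  have he : sturmLiouvilleEigenspace Tm Tp 0 0 (fun _ => 0) 0
      = (spaceNN Tm Tp).map (freeSolutionMap (0 : COp N) 0) := by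
    have hfree : ∀ x s, freeSolution (0 : COp N) 0 x s = x := fun x s => by simp [freeSolution]
    ext u
    rw [mem_sturmLiouvilleEigenspace_iff_homogeneous, Submodule.mem_map]
    constructor
    · rintro ⟨ψ, φ, χ, h, he⟩
      have hen := h.energy_le hTm hTp (isSLData_zero Tm Tp le_rfl)
      have p := h.hasSecondDeriv.isPrimitive
      have cφ := h.hasSecondDeriv.isPrimitive_deriv.continuousOn
      have h0 : ∫ x in Icc (0 : ℝ) 1, ‖φ x‖ ^ 2 = 0 :=
        le_antisymm (by simpa using hen) (integral_nonneg fun x => by positivity)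
      have hi : IntegrableOn (fun x => ‖φ x‖ ^ 2) (Icc 0 1) := (cφ.norm.pow 2).integrableOn_Icc
      have h0' := (integral_eq_zero_iff_of_nonneg (fun x => by positivity) hi).mp h0
      have h1 : ∀ᵐ s ∂(volume.restrict (Icc (0 : ℝ) 1)), φ s = 0 :=
        h0'.mono fun s hs => norm_eq_zero.mp ((pow_eq_zero_iff two_ne_zero).mp hs)
      have h2 : EqOn φ (fun _ => 0) (Icc 0 1) :=
        Measure.eqOn_Icc_of_ae_eq volume zero_ne_one h1 cφ continuousOn_const
      have h3 : ∀ s ∈ Icc (0 : ℝ) 1, ψ s = ψ 0 := fun s hs => by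
        rw [p.eq s hs, intervalIntegral.integral_congr (g := fun _ => (0 : CVec N))
          (h2.mono (uIcc_subset_Icc (by simp) hs))]
        simp
      refine ⟨ψ 0, (mem_spaceNN hTm hTp).mpr
        ⟨((boundaryMinus_eq_zero_iff hTm (by simp)).mp h.minus).1, ?_⟩, ?_⟩
      · rw [← h3 1 (by simp)]
        exact ((boundaryPlus_eq_zero_iff hTp (by simp)).mp h.plus).1
      · refine Lp.ext ?_
        filter_upwards [he, freeSolutionMap_ae_eq (0 : COp N) 0 (ψ 0),
          ae_restrict_mem measurableSet_Icc] with s e1 e2 hs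
        rw [e1, e2, hfree, h3 s hs]
    · rintro ⟨x, hx, rfl⟩
      obtain ⟨x1, x2⟩ := (mem_spaceNN hTm hTp).mp hx
      refine ⟨fun _ => x, fun _ => 0, fun _ => 0,
        ⟨⟨integrableOn_zero, by simp, by simp⟩, ?_, ?_, by simp⟩, ?_⟩
      · rw [boundaryMinus_eq_zero_iff hTm (by simp)]
        simp [x1]
      · rw [boundaryPlus_eq_zero_iff hTp (by simp)]
        simp [x2]
      · filter_upwards [freeSolutionMap_ae_eq (0 : COp N) 0 x] with s hs
        rw [hs, hfree]
  have hinj : Function.Injective (freeSolutionMap (0 : COp N) 0) :=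
    (injective_iff_map_eq_zero _).mpr fun x hx => by
      have := eqOn_zero_of_freeSolutionMap_eq_zero hx (show (0 : ℝ) ∈ Icc (0 : ℝ) 1 by simp)
      simpa [freeSolution] using this
  rw [he]
  exact ⟨inferInstance, (Submodule.equivMapOfInjective _ hinj _).finrank_eq.symm⟩

theorem nonneg_of_sturmLiouvilleEigenspace_free_ne_bot (hTm : IsStarProjection Tm)
    (hTp : IsStarProjection Tp) {μ : ℝ}
    (h : sturmLiouvilleEigenspace Tm Tp 0 0 (fun _ => 0) μ ≠ ⊥) : 0 ≤ μ := by
  simpa using le_of_sturmLiouvilleEigenspace_ne_bot hTm hTp (isSLData_zero Tm Tp le_rfl) h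

/-- Counting the eigenvalues of the free operator by their frequencies. -/
theorem hasEigenvalueCount_free_Ico (hTm : IsStarProjection Tm) (hTp : IsStarProjection Tp)
    {α β : ℝ} (hα : 0 < α) (hβ : 0 < β) (S : Finset ℝ) (hS : ∀ κ ∈ S, κ ∈ Ico α β)
    (hker : ∀ κ ∈ Ico α β, κ ∉ S →
      LinearMap.ker (boundaryOp Tm Tp κ : CVec N →ₗ[ℂ] CVec N) = ⊥) :
    HasEigenvalueCount Tm Tp 0 0 (fun _ => 0) (Ico (α ^ 2) (β ^ 2))
      (∑ κ ∈ S, Module.finrank ℂ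
        (LinearMap.ker (boundaryOp Tm Tp κ : CVec N →ₗ[ℂ] CVec N))) := by
  classical
  have hpos : ∀ κ ∈ S, 0 < κ := fun κ hκ => hα.trans_le (hS κ hκ).1
  have hsum := Finset.sum_image (s := S) (g := fun κ : ℝ => κ ^ 2)
    (f := fun μ => Module.finrank ℂ (sturmLiouvilleEigenspace Tm Tp 0 0 (fun _ => 0) μ))
    fun x hx y hy hxy => (pow_left_inj₀ (hpos x hx).le (hpos y hy).le two_ne_zero).mp hxy
  rw [← Finset.sum_congr rfl fun κ hκ =>
    (finrank_sturmLiouvilleEigenspace_free hTm hTp (hpos κ hκ)).2, ← hsum]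
  refine HasEigenvalueCount.of_finset _ ?_ ?_ ?_
  · rintro μ ⟨h1, h2⟩ hμ
    have hμ0 : 0 < μ := (pow_pos hα 2).trans_le h1
    have hsq := Real.sq_sqrt hμ0.le
    rw [Finset.mem_image]
    refine ⟨√μ, ?_, hsq⟩
    by_contra hn
    have hlt : √μ < β := (Real.sqrt_lt' hβ).mpr h2
    have hb := hker √μ ⟨Real.le_sqrt_of_sq_le h1, hlt⟩ hn
    obtain ⟨f1, f2⟩ := finrank_sturmLiouvilleEigenspace_free hTm hTp (Real.sqrt_pos.mpr hμ0)
    rw [hb, finrank_bot, hsq] at f2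
    rw [hsq] at f1
    exact hμ (Submodule.finrank_eq_zero.mp f2)
  · intro μ hμ
    obtain ⟨κ, hκ, rfl⟩ := Finset.mem_image.mp hμ
    obtain ⟨h1, h2⟩ := hS κ hκ
    exact ⟨pow_le_pow_left₀ hα.le h1 2, pow_lt_pow_left₀ h2 (hpos κ hκ).le two_ne_zero⟩
  · intro μ hμ
    obtain ⟨κ, hκ, rfl⟩ := Finset.mem_image.mp hμ
    exact (finrank_sturmLiouvilleEigenspace_free hTm hTp (hpos κ hκ)).1

end FreeOperator

/-! ### Counting the free eigenvalues period by period. -/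

section FreeCount

variable {N k : ℕ} {P Q : COp N} {γ : Fin k → ℝ} {F : Fin k → Submodule ℂ (CVec N)}

theorem cos_sq_eq_cos_sq_iff {a b : ℝ} : Real.cos a ^ 2 = Real.cos b ^ 2 ↔
    ∃ m : ℤ, a = m * π + b ∨ a = m * π - b := by
  have key : Real.cos a ^ 2 - Real.cos b ^ 2 = -(Real.sin (a + b) * Real.sin (a - b)) := by
    rw [Real.sin_add, Real.sin_sub]
    have h1 := Real.sin_sq_add_cos_sq a
    have h2 := Real.sin_sq_add_cos_sq b
    linear_combination (Real.cos b ^ 2) * h1 - (Real.cos a ^ 2) * h2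
  rw [← sub_eq_zero, key, neg_eq_zero, mul_eq_zero, Real.sin_eq_zero_iff, Real.sin_eq_zero_iff]
  constructor
  · rintro (⟨m, hm⟩ | ⟨m, hm⟩)
    · exact ⟨m, Or.inr (by rw [hm]; ring)⟩
    · exact ⟨m, Or.inl (by rw [hm]; ring)⟩
  · rintro ⟨m, rfl | rfl⟩
    · exact Or.inr ⟨m, by ring⟩
    · exact Or.inl ⟨m, by ring⟩

/-- Periods are cut at `π n + s` with `s` below `π / 2` and all angles. Each then contains one zero
of the sine, `π (n + 1)`, one of the cosine, `π n + π / 2`, and for each angle `t` the two points `π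
n + t` and `π (n + 1) - t`. -/
theorem sin_eq_zero_iff_of_mem_Ico {n : ℕ} {s κ : ℝ} (hs : 0 < s) (hs' : s < π / 2)
    (hκ : κ ∈ Ico (π * n + s) (π * (n + 1) + s)) : Real.sin κ = 0 ↔ κ = π * (n + 1) := by
  have hπ := Real.pi_pos
  constructor
  · rw [Real.sin_eq_zero_iff]
    rintro ⟨m, rfl⟩
    have h1 : (n : ℝ) < m := lt_of_mul_lt_mul_left (by linarith [hκ.1]) hπ.le
    have h2 : (m : ℝ) < n + 2 := lt_of_mul_lt_mul_left (by linarith [hκ.2]) hπ.le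
    have h3 : (n : ℤ) < m := by exact_mod_cast h1
    have h4 : m < (n : ℤ) + 2 := by exact_mod_cast h2
    have h5 : m = (n : ℤ) + 1 := by omega
    rw [h5]; push_cast; ring
  · rintro rfl
    have := Real.sin_nat_mul_pi (n + 1)
    rw [mul_comm]
    exact_mod_cast this

theorem cos_eq_zero_iff_of_mem_Ico {n : ℕ} {s κ : ℝ} (hs : 0 < s) (hs' : s < π / 2)
    (hκ : κ ∈ Ico (π * n + s) (π * (n + 1) + s)) : Real.cos κ = 0 ↔ κ = π * n + π / 2 := by
  have hπ := Real.pi_pos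
  rw [Real.cos_eq_zero_iff]
  constructor
  · rintro ⟨m, rfl⟩
    have h1 : 2 * (n : ℝ) < 2 * m + 1 := lt_of_mul_lt_mul_left (by linarith [hκ.1]) hπ.le
    have h2 : (2 * m + 1 : ℝ) < 2 * n + 3 := lt_of_mul_lt_mul_left (by linarith [hκ.2]) hπ.le
    have h3 : 2 * (n : ℤ) < 2 * m + 1 := by exact_mod_cast h1
    have h4 : 2 * m + 1 < 2 * (n : ℤ) + 3 := by exact_mod_cast h2
    have h5 : m = (n : ℤ) := by omega
    rw [h5]; push_cast; ring
  · rintro rfl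
    exact ⟨n, by push_cast; ring⟩

theorem cos_sq_eq_iff_of_mem_Ico {n : ℕ} {s κ t : ℝ} (hs : 0 < s) (hst : s < t) (ht : t < π / 2)
    (hκ : κ ∈ Ico (π * n + s) (π * (n + 1) + s)) :
    Real.cos κ ^ 2 = Real.cos t ^ 2 ↔ κ = π * n + t ∨ κ = π * (n + 1) - t := by
  have hπ := Real.pi_pos
  rw [cos_sq_eq_cos_sq_iff]
  constructor
  · rintro ⟨m, rfl | rfl⟩
    · left
      have h1 : (n : ℝ) < m + 1 := lt_of_mul_lt_mul_left (by linarith [hκ.1]) hπ.le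
      have h2 : (m : ℝ) < n + 1 := lt_of_mul_lt_mul_left (by linarith [hκ.2]) hπ.le
      have h3 : (n : ℤ) < m + 1 := by exact_mod_cast h1
      have h4 : m < (n : ℤ) + 1 := by exact_mod_cast h2
      have h5 : m = (n : ℤ) := by omega
      rw [h5]; push_cast; ring
    · right
      have h1 : (n : ℝ) < m := lt_of_mul_lt_mul_left (by linarith [hκ.1]) hπ.le
      have h2 : (m : ℝ) < n + 2 := lt_of_mul_lt_mul_left (by linarith [hκ.2]) hπ.le
      have h3 : (n : ℤ) < m := by exact_mod_cast h1
      have h4 : m < (n : ℤ) + 2 := by exact_mod_cast h2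
      have h5 : m = (n : ℤ) + 1 := by omega
      rw [h5]; push_cast; ring
  · rintro (rfl | rfl)
    · exact ⟨n, Or.inl (by push_cast; ring)⟩
    · exact ⟨n + 1, Or.inr (by push_cast; ring)⟩

theorem ker_boundaryOp_eq_bot {κ c : ℝ} (hc : 0 < c)
    (h : ∀ x, c * ‖x‖ ≤ ‖boundaryOp P Q κ x‖) :
    LinearMap.ker (boundaryOp P Q κ : CVec N →ₗ[ℂ] CVec N) = ⊥ := by
  rw [eq_bot_iff]
  intro x hx
  have h1 := h x
  have h2 : boundaryOp P Q κ x = 0 := hx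
  rw [h2, norm_zero] at h1
  exact norm_le_zero_iff.mp (nonpos_of_mul_nonpos_right h1 hc)

namespace IsAngleDecomposition

/-- The sine zero contributes `N^{NN} + N^{DD}`, the cosine zero `N^{ND} + N^{DN}`, and each angle
twice `N^{[γᵢ]}`; by `dimension_eq` these numbers add up to `N`. -/
theorem hasEigenvalueCount_free_period (h : IsAngleDecomposition P Q γ F)
    (hP : IsStarProjection P) (hQ : IsStarProjection Q) {s : ℝ} (hs : 0 < s) (hs' : s < π / 2)
    (hsγ : ∀ i, s < γ i) (n : ℕ) :
    HasEigenvalueCount P Q 0 0 (fun _ => 0) (Ico ((π * n + s) ^ 2) ((π * (n + 1) + s) ^ 2)) N := by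
  have hπ := Real.pi_pos
  have hγ : ∀ i, γ i < π / 2 := fun i => (h.angle i).lt
  have hn : (0 : ℝ) ≤ n := Nat.cast_nonneg n
  have hπn : 0 ≤ π * n := by positivity
  have hexp : π * ((n : ℝ) + 1) = π * n + π := by ring
  classical
  set S : Finset ℝ := insert (π * (n + 1)) (insert (π * n + π / 2)
    (Finset.univ.image (fun i => π * n + γ i) ∪ Finset.univ.image fun i => π * (n + 1) - γ i))
    with hS
  have hmem : ∀ κ, κ ∈ S ↔ κ = π * (n + 1) ∨ κ = π * n + π / 2 ∨
      ∃ i, κ = π * n + γ i ∨ κ = π * (n + 1) - γ i := by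
    intro κ
    simp only [hS, Finset.mem_insert, Finset.mem_union, Finset.mem_image, Finset.mem_univ,
      true_and, eq_comm (a := κ), exists_or]
  have hIco : ∀ κ ∈ S, κ ∈ Ico (π * n + s) (π * (n + 1) + s) := by
    intro κ hκ
    rcases (hmem κ).mp hκ with rfl | rfl | ⟨i, rfl | rfl⟩
    · constructor <;> linarith
    · constructor <;> linarith
    · have := hsγ i
      have := hγ i
      constructor <;> linarith
    · have := hsγ i
      have := hγ i
      constructor <;> linarith
  have hcount := hasEigenvalueCount_free_Ico hP hQ (α := π * n + s) (β := π * (n + 1) + s)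
    (by positivity) (by positivity) S hIco (fun κ hκ hκS => by
      rw [hmem] at hκS
      push Not at hκS
      obtain ⟨h1, h2, h3⟩ := hκS
      rw [← Submodule.finrank_eq_zero (R := ℂ), h.finrank_ker_boundaryOp hP hQ,
        if_neg ((sin_eq_zero_iff_of_mem_Ico hs hs' hκ).not.mpr h1),
        if_neg ((cos_eq_zero_iff_of_mem_Ico hs hs' hκ).not.mpr h2), zero_add, zero_add]
      refine Finset.sum_eq_zero fun i _ => if_neg ?_
      rw [cos_sq_eq_iff_of_mem_Ico hs (hsγ i) (hγ i) hκ]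
      push Not
      exact h3 i)
  convert hcount using 1
  rw [Finset.sum_congr rfl fun κ _ => h.finrank_ker_boundaryOp hP hQ κ, Finset.sum_add_distrib,
    Finset.sum_add_distrib, Finset.sum_comm,
    Finset.sum_congr rfl fun κ hκ => if_congr
      (sin_eq_zero_iff_of_mem_Ico hs hs' (hIco κ hκ)) rfl rfl,
    Finset.sum_ite_eq', if_pos ((hmem _).mpr (Or.inl rfl)),
    Finset.sum_congr rfl fun κ hκ => if_congr
      (cos_eq_zero_iff_of_mem_Ico hs hs' (hIco κ hκ)) rfl rfl,
    Finset.sum_ite_eq', if_pos ((hmem _).mpr (Or.inr (Or.inl rfl)))]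
  -- The sum is arranged by blocks and not by frequencies. Hence only the two frequencies of one
  -- angle must be told apart; no other coincidence in `S` has to be excluded.
  have hthird : ∀ i, (∑ κ ∈ S, if Real.cos κ ^ 2 = Real.cos (γ i) ^ 2 then
      Module.finrank ℂ ↥(F i ⊓ opRange P) else 0) = 2 * Module.finrank ℂ ↥(F i ⊓ opRange P) := by
    intro i
    have hne : π * n + γ i ≠ π * (n + 1) - γ i := fun he => by
      have := hγ i
      linarith
    have hsplit : ∀ κ ∈ S, (if Real.cos κ ^ 2 = Real.cos (γ i) ^ 2 then
        Module.finrank ℂ ↥(F i ⊓ opRange P) else 0)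
        = (if κ = π * n + γ i then Module.finrank ℂ ↥(F i ⊓ opRange P) else 0)
          + (if κ = π * (n + 1) - γ i then Module.finrank ℂ ↥(F i ⊓ opRange P) else 0) := by
      intro κ hκ
      rw [if_congr (cos_sq_eq_iff_of_mem_Ico hs (hsγ i) (hγ i) (hIco κ hκ)) rfl rfl]
      by_cases h1 : κ = π * n + γ i
      · rw [if_pos (Or.inl h1), if_pos h1, if_neg (h1 ▸ hne), add_zero]
      · by_cases h2 : κ = π * (n + 1) - γ i
        · rw [if_pos (Or.inr h2), if_neg h1, if_pos h2, zero_add]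
        · rw [if_neg (by tauto), if_neg h1, if_neg h2, add_zero]
    rw [Finset.sum_congr rfl hsplit, Finset.sum_add_distrib, Finset.sum_ite_eq',
      Finset.sum_ite_eq', if_pos ((hmem _).mpr (Or.inr (Or.inr ⟨i, Or.inl rfl⟩))),
      if_pos ((hmem _).mpr (Or.inr (Or.inr ⟨i, Or.inr rfl⟩))), two_mul]
  rw [Finset.sum_congr rfl fun i _ => hthird i, ← Finset.mul_sum]
  exact h.dimension_eq

/-- Below `s²` the only possible eigenvalue is `0`, with multiplicity `N^{NN}`, since no free
frequency lies in `(0, s)`. Each further period adds `N`. -/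
theorem hasEigenvalueCount_free_Iio (h : IsAngleDecomposition P Q γ F)
    (hP : IsStarProjection P) (hQ : IsStarProjection Q) {s : ℝ} (hs : 0 < s) (hs' : s < π / 2)
    (hsγ : ∀ i, s < γ i) (n : ℕ) :
    HasEigenvalueCount P Q 0 0 (fun _ => 0) (Iio ((π * n + s) ^ 2))
      (n * N + Module.finrank ℂ (spaceNN P Q)) := by
  have hπ := Real.pi_pos
  induction n with
  | zero =>
    obtain ⟨f1, f2⟩ := finrank_sturmLiouvilleEigenspace_zero hP hQ
    have h0 := HasEigenvalueCount.of_finset (Tm := P) (Tp := Q) (a := 0) (b := 0)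
      (V := fun _ => 0) (I := Iio ((π * (0 : ℕ) + s) ^ 2)) {0} (fun μ hμ hne => by
        have hμ0 := nonneg_of_sturmLiouvilleEigenspace_free_ne_bot hP hQ hne
        by_contra hn
        rw [Finset.mem_singleton] at hn
        have hpos : 0 < μ := lt_of_le_of_ne hμ0 (Ne.symm hn)
        have hlt : √μ < s := (Real.sqrt_lt' hs).mpr (by simpa using hμ)
        have hsq0 := Real.sqrt_pos.mpr hpos
        obtain ⟨g1, g2⟩ := finrank_sturmLiouvilleEigenspace_free hP hQ hsq0
        rw [Real.sq_sqrt hμ0, h.finrank_ker_boundaryOp hP hQ, if_neg, if_neg,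
          Finset.sum_eq_zero] at g2
        · rw [Real.sq_sqrt hμ0] at g1
          exact hne (Submodule.finrank_eq_zero.mp g2)
        · intro i _
          rw [if_neg]
          have h1 := (h.cos_sq_mem i).1
          have h2 : Real.cos (γ i) < Real.cos √μ :=
            Real.cos_lt_cos_of_nonneg_of_le_pi_div_two hsq0.le (h.angle i).lt.le
              (hlt.trans (hsγ i))
          exact (pow_lt_pow_left₀ h2 h1.le two_ne_zero).ne'
        · exact (Real.cos_pos_of_mem_Ioo ⟨by linarith, by linarith⟩).ne'
        · exact (Real.sin_pos_of_pos_of_lt_pi hsq0 (by linarith)).ne')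
      (fun μ hμ => by
        rw [Finset.mem_singleton] at hμ
        rw [hμ, mem_Iio]
        positivity)
      (fun μ hμ => by
        rw [Finset.mem_singleton] at hμ
        rw [hμ]
        exact f1)
    rw [Finset.sum_singleton, f2] at h0
    simpa using h0
  | succ n ih =>
    have h1 := ih.union (h.hasEigenvalueCount_free_period hP hQ hs hs' hsγ n)
      (disjoint_left.mpr fun x hx hx' => not_lt.mpr hx'.1 hx)
    have hn : (0 : ℝ) ≤ n := Nat.cast_nonneg n
    rw [Iio_union_Ico_eq_Iio (pow_le_pow_left₀ (by positivity) (by nlinarith) 2)] at h1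
    push_cast
    convert h1 using 1
    ring

end IsAngleDecomposition

end FreeCount

/-! ### Gap frequencies around a free frequency. -/

section Gaps

open Filter Topology

variable {N k : ℕ} {P Q : COp N} {γ : Fin k → ℝ} {F : Fin k → Submodule ℂ (CVec N)}

/-- At a point which is not a multiple zero a function is bounded below by the distance. -/
theorem eventually_mul_abs_le_abs {f : ℝ → ℝ} {f' β : ℝ} (hf : HasDerivAt f f' β)
    (hne : f β ≠ 0 ∨ f' ≠ 0) :
    ∀ᶠ t in 𝓝[>] (0 : ℝ), ∀ s, |s| ≤ t → t * |s| ≤ |f (β + s)| := by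
  obtain ⟨η, hη, hev⟩ : ∃ η > 0, ∀ᶠ y in 𝓝 β, η * |y - β| ≤ |f y| := by
    by_cases h0 : f β = 0
    · have h1 : 0 < |f'| := abs_pos.mpr (hne.resolve_left (not_not.mpr h0))
      refine ⟨|f'| / 2, by positivity, ?_⟩
      filter_upwards [hf.isLittleO.def (c := |f'| / 2) (by positivity)] with y hy
      rw [h0, sub_zero, Real.norm_eq_abs, Real.norm_eq_abs, smul_eq_mul] at hy
      have h2 := abs_sub_abs_le_abs_sub ((y - β) * f') (f y)
      rw [abs_mul, abs_sub_comm ((y - β) * f')] at h2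
      linarith
    · have h1 : 0 < |f β| := abs_pos.mpr h0
      refine ⟨|f β| / 2, by positivity, ?_⟩
      have h2 : ∀ᶠ y in 𝓝 β, |f β| / 2 < |f y| :=
        hf.continuousAt.abs.eventually (lt_mem_nhds (by linarith))
      filter_upwards [h2, Metric.ball_mem_nhds β one_pos] with y hy hy1
      rw [Metric.mem_ball, Real.dist_eq] at hy1
      nlinarith
  obtain ⟨ε, hε, hball⟩ := Metric.eventually_nhds_iff.mp hev
  -- The same `t` serves as radius and as slope. Both conditions only get weaker as `t` decreases,
  -- so finitely many such statements hold for a common `t`.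
  filter_upwards [Ioo_mem_nhdsGT (lt_min hη hε)] with t ht s hs
  have h1 := hball (y := β + s) (by
    rw [Real.dist_eq, add_sub_cancel_left]
    exact hs.trans_lt (ht.2.trans_le (min_le_right _ _)))
  rw [add_sub_cancel_left] at h1
  refine le_trans ?_ h1
  have := ht.2.trans_le (min_le_left η ε)
  gcongr

/-- The functions `sin`, `cos` and `cos² - cos² γᵢ` have only simple zeros: the derivative of the
last is `-2 sin cos`, which is nonzero where `cos² = cos² γᵢ` lies strictly between `0` and `1`. The
division by `5` matches the hypothesis of `le_norm_boundaryOp`. -/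
theorem IsAngleDecomposition.eventually_le_norm_boundaryOp (h : IsAngleDecomposition P Q γ F)
    (hP : IsStarProjection P) (hQ : IsStarProjection Q) (β : ℝ) :
    ∀ᶠ t in 𝓝[>] (0 : ℝ), ∀ s, |s| ≤ t → ∀ x, t * |s| * ‖x‖ ≤ ‖boundaryOp P Q (β + s) x‖ := by
  have hcs := Real.sin_sq_add_cos_sq β
  have e1 := eventually_mul_abs_le_abs (Real.hasDerivAt_sin β) (by
    by_contra hn
    push Not at hn
    rw [hn.1, hn.2] at hcs
    norm_num at hcs)
  have e2 := eventually_mul_abs_le_abs (Real.hasDerivAt_cos β) (by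
    by_contra hn
    push Not at hn
    rw [neg_eq_zero.mp hn.2, hn.1] at hcs
    norm_num at hcs)
  have e3 : ∀ i, ∀ᶠ t in 𝓝[>] (0 : ℝ), ∀ s, |s| ≤ t →
      t * |s| ≤ |(Real.cos (β + s) ^ 2 - Real.cos (γ i) ^ 2) / 5| := fun i => by
    refine eventually_mul_abs_le_abs (f := fun y => (Real.cos y ^ 2 - Real.cos (γ i) ^ 2) / 5)
      ((((Real.hasDerivAt_cos β).pow 2).sub_const _).div_const 5) ?_
    by_contra hn
    push Not at hn
    obtain ⟨c1, s1⟩ := h.cos_sq_mem i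
    have hsc := Real.sin_sq_add_cos_sq (γ i)
    have h1 : Real.cos β ^ 2 = Real.cos (γ i) ^ 2 := by linarith [hn.1]
    have h2 : Real.cos β * Real.sin β = 0 := by
      have := hn.2
      simp only [Nat.cast_ofNat, Nat.add_one_sub_one, pow_one] at this
      linarith
    rcases mul_eq_zero.mp h2 with h3 | h3
    · rw [h3] at h1
      have := pow_pos c1 2
      linarith
    · rw [h3] at hcs
      have := pow_pos s1 2
      linarith
  filter_upwards [e1, e2, eventually_all.mpr e3, self_mem_nhdsWithin] with t h1 h2 h3 ht s hs x
  have ht0 : 0 < t := ht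
  refine h.le_norm_boundaryOp hP hQ (by positivity) (h1 s hs) (h2 s hs) (fun i => ?_) x
  have := h3 i s hs
  rw [abs_div, abs_of_pos (by norm_num : (0 : ℝ) < 5)] at this
  linarith

/-- A shift by `n π` changes the matrix by the sign `(-1)^n`, so a lower bound near one frequency
serves all its translates with the same constant. -/
theorem norm_boundaryOp_add_nat_mul_pi (κ : ℝ) (n : ℕ) (x : CVec N) :
    ‖boundaryOp P Q (κ + n * π) x‖ = ‖boundaryOp P Q κ x‖ := by
  have : boundaryOp P Q (κ + n * π) x = ((-1 : ℝ) ^ n) • boundaryOp P Q κ x := by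
    rw [boundaryOp_apply, boundaryOp_apply, Real.cos_add_nat_mul_pi, Real.sin_add_nat_mul_pi]
    simp only [mul_smul, ← smul_add, ← smul_sub, COp.map_real_smul]
  rw [this, norm_smul, norm_pow, norm_neg, norm_one, one_pow, one_mul]

/-- Since `|κ - f| (κ + f) = ϖ`, the lower bound `t |κ - f|` equals `3 (27R + 1) / (κ + f)`. The
conditions on `f` give `f ≤ 2κ`, so `κ + f ≤ 3κ`, which is the origin of the factor `3`. -/
theorem isGapFrequency_of_sq {t f R κ : ℝ} (ht : 0 < t) (hR : 0 ≤ R)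
    (hD : ∀ s, |s| ≤ t → ∀ x, t * |s| * ‖x‖ ≤ ‖boundaryOp P Q (f + s) x‖)
    {ϖ : ℝ} (hϖ : t * ϖ = 3 * (27 * R + 1)) (hf8 : 8 ≤ f) (hfR : 8 * R ≤ f) (hft : ϖ ≤ f * t)
    (hfϖ : 2 * ϖ ≤ f) (hκ0 : 0 ≤ κ) (hκ : |κ ^ 2 - f ^ 2| = ϖ) :
    IsGapFrequency P Q R κ ∧ |κ - f| ≤ t := by
  have hϖ0 : 0 < ϖ := by
    have : 0 < t * ϖ := by rw [hϖ]; positivity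
    exact pos_of_mul_pos_right this ht.le
  have hle : f / 2 ≤ κ := by
    refine (pow_le_pow_iff_left₀ (by linarith) hκ0 two_ne_zero).mp ?_
    have := neg_le_of_abs_le hκ.le
    nlinarith
  have hκpos : 0 < κ := by linarith
  have hmul : |κ - f| * (κ + f) = ϖ := by
    have he : κ ^ 2 - f ^ 2 = (κ - f) * (κ + f) := by ring
    rw [← hκ, he, abs_mul, abs_of_pos (show 0 < κ + f by linarith)]
  have habs := abs_nonneg (κ - f)
  have hst : |κ - f| ≤ t := by
    refine le_of_mul_le_mul_right (a := f) ?_ (by linarith)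
    nlinarith
  refine ⟨⟨by linarith, by linarith, fun x => ?_⟩, hst⟩
  have h1 := hD (κ - f) hst x
  rw [add_sub_cancel] at h1
  refine le_trans ?_ h1
  refine mul_le_mul_of_nonneg_right ?_ (norm_nonneg x)
  rw [← div_eq_mul_inv, div_le_iff₀ hκpos]
  have h2 : 3 * (27 * R + 1) = t * |κ - f| * (κ + f) := by rw [← hϖ, ← hmul]; ring
  have h3 : 0 ≤ t * |κ - f| := by positivity
  nlinarith

/-- Both `f² - ϖ` and `f² + ϖ` are gaps, so the counts below them agree with the free ones. Between
them `f` is the only free frequency, as the boundary matrix is injective at distance at most `t`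
from `f` otherwise. -/
theorem hasEigenvalueCount_window {a b : COp N} {V : ℝ → COp N} {t f R : ℝ}
    (hP : IsStarProjection P) (hQ : IsStarProjection Q) (hd : IsSLData P Q a b V R) (ht : 0 < t)
    (hD : ∀ s, |s| ≤ t → ∀ x, t * |s| * ‖x‖ ≤ ‖boundaryOp P Q (f + s) x‖)
    {ϖ : ℝ} (hϖ : t * ϖ = 3 * (27 * R + 1)) (hf8 : 8 ≤ f) (hfR : 8 * R ≤ f) (hft : ϖ ≤ f * t)
    (hfϖ : 2 * ϖ ≤ f) :
    HasEigenvalueCount P Q a b V (intervalAround (f ^ 2) ϖ)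
      (Module.finrank ℂ (LinearMap.ker (boundaryOp P Q f : CVec N →ₗ[ℂ] CVec N))) := by
  have hR := hd.nonneg
  have hϖ0 : 0 < ϖ := by
    have : 0 < t * ϖ := by rw [hϖ]; positivity
    exact pos_of_mul_pos_right this ht.le
  have hm : 0 < f ^ 2 - ϖ := by nlinarith
  have sm := Real.sq_sqrt hm.le
  have sp := Real.sq_sqrt (show 0 ≤ f ^ 2 + ϖ by positivity)
  obtain ⟨gm, dm⟩ := isGapFrequency_of_sq ht hR hD hϖ hf8 hfR hft hfϖ
    (Real.sqrt_nonneg (f ^ 2 - ϖ)) (by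
      rw [sm, sub_sub_cancel_left, abs_neg, abs_of_pos hϖ0])
  obtain ⟨gp, dp⟩ := isGapFrequency_of_sq ht hR hD hϖ hf8 hfR hft hfϖ
    (Real.sqrt_nonneg (f ^ 2 + ϖ)) (by
      rw [sp, add_sub_cancel_left, abs_of_pos hϖ0])
  have hpm : 0 < √(f ^ 2 - ϖ) := Real.sqrt_pos.mpr hm
  have hmf : √(f ^ 2 - ϖ) ≤ f := Real.sqrt_le_iff.mpr ⟨by linarith, by linarith⟩
  have hfp : f < √(f ^ 2 + ϖ) := Real.lt_sqrt_of_sq_lt (by linarith)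
  have hfree := hasEigenvalueCount_free_Ico hP hQ (α := √(f ^ 2 - ϖ)) (β := √(f ^ 2 + ϖ)) hpm
    (hpm.trans_le (hmf.trans hfp.le)) {f} (fun κ hκ => by
      rw [Finset.mem_singleton.mp hκ]; exact ⟨hmf, hfp⟩) (fun κ hκ hne => by
      rw [Finset.mem_singleton] at hne
      have h1 : |κ - f| ≤ t := by
        rw [abs_le] at dm dp ⊢
        constructor
        · linarith [hκ.1, dm.1]
        · linarith [hκ.2, dp.2]
      refine ker_boundaryOp_eq_bot (c := t * |κ - f|)
        (mul_pos ht (abs_pos.mpr (sub_ne_zero.mpr hne))) fun x => ?_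
      have := hD (κ - f) h1 x
      rwa [add_sub_cancel] at this)
  rw [Finset.sum_singleton] at hfree
  obtain ⟨m₁, c1, c1'⟩ := exists_hasEigenvalueCount_gap hP hQ hd gm
  obtain ⟨m₂, c2, c2'⟩ := exists_hasEigenvalueCount_gap hP hQ hd gp
  have hsub : Iio (√(f ^ 2 - ϖ) ^ 2) ⊆ Iio (√(f ^ 2 + ϖ) ^ 2) :=
    Iio_subset_Iio (by rw [sm, sp]; linarith)
  have d1 := (c2.diff c1 hsub).1
  have d2 := (c2'.diff c1' hsub).1
  have hset : Iio (√(f ^ 2 + ϖ) ^ 2) \ Iio (√(f ^ 2 - ϖ) ^ 2)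
      = Ico (√(f ^ 2 - ϖ) ^ 2) (√(f ^ 2 + ϖ) ^ 2) := by
    ext x
    simp only [Set.mem_sdiff, mem_Iio, not_lt, mem_Ico]
    tauto
  rw [hset] at d1 d2
  rw [d2.unique hfree] at d1
  -- The half-open interval can be replaced by the open one because its left end is a gap and not an
  -- eigenvalue.
  refine d1.congr fun μ hμ => ?_
  have hne : μ ≠ f ^ 2 - ϖ := by
    rintro rfl
    refine hμ ?_
    have := sturmLiouvilleEigenspace_gap_eq_bot hP hQ hd gm
    rwa [sm] at this
  rw [sm, sp]
  exact ⟨fun hx => ⟨lt_of_le_of_ne hx.1 hne.symm, hx.2⟩, fun hx => ⟨hx.1.le, hx.2⟩⟩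

end Gaps

/-! ### The eigenvalue counts at all large frequencies. -/

section Frequencies

open Filter Topology

variable {N k : ℕ} {P Q : COp N} {γ : Fin k → ℝ} {F : Fin k → Submodule ℂ (CVec N)}

namespace IsAngleDecomposition

theorem cos_sq_ne_one (h : IsAngleDecomposition P Q γ F) (i : Fin k) :
    Real.cos (γ i) ^ 2 ≠ 1 := by
  have h1 := pow_pos (h.cos_sq_mem i).2 2
  have h2 := Real.sin_sq_add_cos_sq (γ i)
  intro h3
  linarith

theorem cos_sq_injective (h : IsAngleDecomposition P Q γ F) {i j : Fin k}
    (hij : Real.cos (γ i) ^ 2 = Real.cos (γ j) ^ 2) : i = j := by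
  have h1 := (pow_left_inj₀ (h.cos_sq_mem i).1.le (h.cos_sq_mem j).1.le two_ne_zero).mp hij
  have hπ := Real.pi_pos
  refine h.strictMono.injective (Real.injOn_cos ?_ ?_ h1)
  · exact ⟨(h.angle i).pos.le, by linarith [(h.angle i).lt]⟩
  · exact ⟨(h.angle j).pos.le, by linarith [(h.angle j).lt]⟩

theorem finrank_ker_of_cos_sq_eq_one (h : IsAngleDecomposition P Q γ F)
    (hP : IsStarProjection P) (hQ : IsStarProjection Q) {κ : ℝ} (hκ : Real.cos κ ^ 2 = 1) :
    Module.finrank ℂ (LinearMap.ker (boundaryOp P Q κ : CVec N →ₗ[ℂ] CVec N))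
      = Module.finrank ℂ (spaceNN P Q) + Module.finrank ℂ (spaceDD P Q) := by
  have hs : Real.sin κ = 0 := by
    have := Real.sin_sq_add_cos_sq κ
    exact (pow_eq_zero_iff two_ne_zero).mp (by linarith)
  have hc : Real.cos κ ≠ 0 := fun h0 => by
    rw [h0] at hκ
    norm_num at hκ
  rw [h.finrank_ker_boundaryOp hP hQ, if_pos hs, if_neg hc, add_zero, Finset.sum_eq_zero, add_zero]
  exact fun i _ => if_neg (by rw [hκ]; exact (h.cos_sq_ne_one i).symm)

theorem finrank_ker_of_cos_eq_zero (h : IsAngleDecomposition P Q γ F)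
    (hP : IsStarProjection P) (hQ : IsStarProjection Q) {κ : ℝ} (hκ : Real.cos κ = 0) :
    Module.finrank ℂ (LinearMap.ker (boundaryOp P Q κ : CVec N →ₗ[ℂ] CVec N))
      = Module.finrank ℂ (spaceND P Q) + Module.finrank ℂ (spaceDN P Q) := by
  have hs : Real.sin κ ≠ 0 := fun h0 => by
    have := Real.sin_sq_add_cos_sq κ
    rw [h0, hκ] at this
    norm_num at this
  rw [h.finrank_ker_boundaryOp hP hQ, if_neg hs, if_pos hκ, zero_add, Finset.sum_eq_zero, add_zero]
  intro i _
  rw [if_neg]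
  rw [hκ, zero_pow two_ne_zero]
  exact (pow_pos (h.cos_sq_mem i).1 2).ne

theorem finrank_ker_of_cos_sq_eq (h : IsAngleDecomposition P Q γ F)
    (hP : IsStarProjection P) (hQ : IsStarProjection Q) {κ : ℝ} {i : Fin k}
    (hκ : Real.cos κ ^ 2 = Real.cos (γ i) ^ 2) :
    Module.finrank ℂ (LinearMap.ker (boundaryOp P Q κ : CVec N →ₗ[ℂ] CVec N))
      = Module.finrank ℂ ↥(F i ⊓ opRange P) := by
  have hs : Real.sin κ ≠ 0 := fun h0 => by
    have h1 := Real.sin_sq_add_cos_sq κ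
    rw [h0, zero_pow two_ne_zero, zero_add, hκ] at h1
    exact h.cos_sq_ne_one i h1
  have hc : Real.cos κ ≠ 0 := fun h0 => by
    rw [h0, zero_pow two_ne_zero] at hκ
    exact (pow_pos (h.cos_sq_mem i).1 2).ne hκ
  rw [h.finrank_ker_boundaryOp hP hQ, if_neg hs, if_neg hc, zero_add, zero_add,
    Finset.sum_eq_single i, if_pos hκ]
  · intro j _ hji
    rw [if_neg]
    rw [hκ]
    exact fun hij => hji (h.cos_sq_injective hij).symm
  · exact fun hi => absurd (Finset.mem_univ i) hi

/-- The eigenvalues are counted near the squares of the frequencies of the free operator. -/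
theorem exists_count (h : IsAngleDecomposition P Q γ F) (hP : IsStarProjection P)
    (hQ : IsStarProjection Q) {R : ℝ} (hR : 0 ≤ R) :
    ∃ (n₀ : ℕ) (ϖ : ℝ), 1 ≤ n₀ ∧ 0 ≤ ϖ ∧ ∀ (a b : COp N) (V : ℝ → COp N),
      IsSLData P Q a b V R → ∀ n : ℕ, n₀ ≤ n →
        HasEigenvalueCount P Q a b V (Iio ((π * n) ^ 2 + ϖ))
          (n * N + Module.finrank ℂ (spaceNN P Q)) ∧
        HasEigenvalueCount P Q a b V (intervalAround ((π * n) ^ 2) ϖ)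
          (Module.finrank ℂ (spaceNN P Q) + Module.finrank ℂ (spaceDD P Q)) ∧
        HasEigenvalueCount P Q a b V (intervalAround ((π * n + π / 2) ^ 2) ϖ)
          (Module.finrank ℂ (spaceND P Q) + Module.finrank ℂ (spaceDN P Q)) ∧
        ∀ i : Fin k,
          HasEigenvalueCount P Q a b V (intervalAround ((π * n + γ i) ^ 2) ϖ)
            (Module.finrank ℂ ↥(F i ⊓ opRange P)) ∧
          HasEigenvalueCount P Q a b V (intervalAround ((π * n - γ i) ^ 2) ϖ)
            (Module.finrank ℂ ↥(F i ⊓ opRange P)) := by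
  have hπ := Real.pi_gt_three
  have hγ : ∀ i, 0 < γ i ∧ γ i < π / 2 := fun i => ⟨(h.angle i).pos, (h.angle i).lt⟩
  have e1 : ∀ᶠ t in 𝓝[>] (0 : ℝ), t ∈ Ioo 0 (π / 2) := Ioo_mem_nhdsGT (by positivity)
  have e2 : ∀ᶠ t in 𝓝[>] (0 : ℝ), ∀ i, t ∈ Ioo 0 (γ i) :=
    eventually_all.mpr fun i => Ioo_mem_nhdsGT (hγ i).1
  -- Up to translation by multiples of `π` the free frequencies are `0`, `π / 2` and `± γᵢ`; one `t`
  -- is taken for this finite list.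
  obtain ⟨t, t1, t2, t3, t4, tp, tm⟩ := (e1.and (e2.and
    ((h.eventually_le_norm_boundaryOp hP hQ 0).and
    ((h.eventually_le_norm_boundaryOp hP hQ (π / 2)).and
    ((eventually_all.mpr fun i => h.eventually_le_norm_boundaryOp hP hQ (γ i)).and
    (eventually_all.mpr fun i => h.eventually_le_norm_boundaryOp hP hQ (-γ i))))))).exists
  have ht : 0 < t := t1.1
  obtain ⟨ϖ, hϖ⟩ : ∃ ϖ, t * ϖ = 3 * (27 * R + 1) := ⟨t⁻¹ * (3 * (27 * R + 1)), by field_simp⟩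
  have hϖ0 : 0 < ϖ := by
    have : 0 < t * ϖ := by rw [hϖ]; positivity
    exact pos_of_mul_pos_right this ht.le
  -- Each summand secures one size condition of `isGapFrequency_of_sq` at `π n + β`, with `3n ≤ π n`
  -- leaving room for `β ≥ -π / 2`.
  obtain ⟨n₀, hn₀⟩ := exists_nat_ge (8 + 8 * R + ϖ / t + 2 * ϖ)
  have hϖt : 0 < ϖ / t := by positivity
  refine ⟨n₀, ϖ, ?_, hϖ0.le, fun a b V hd n hn => ?_⟩
  · have : (1 : ℝ) ≤ n₀ := by linarith
    exact_mod_cast this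
  have hnn : 8 + 8 * R + ϖ / t + 2 * ϖ ≤ (n : ℝ) := hn₀.trans (by exact_mod_cast hn)
  have hπn : 3 * (n : ℝ) ≤ π * n := by gcongr
  have hπ4 := Real.pi_le_four
  have hwin : ∀ β : ℝ, -(π / 2) ≤ β →
      (∀ s, |s| ≤ t → ∀ x, t * |s| * ‖x‖ ≤ ‖boundaryOp P Q (β + s) x‖) →
      (∀ s, |s| ≤ t → ∀ x, t * |s| * ‖x‖ ≤ ‖boundaryOp P Q (π * n + β + s) x‖) ∧
      8 ≤ π * n + β ∧ 8 * R ≤ π * n + β ∧ ϖ ≤ (π * n + β) * t ∧ 2 * ϖ ≤ π * n + β := by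
    intro β hβ hD
    refine ⟨fun s hs x => ?_, by linarith, by linarith, ?_, by linarith⟩
    · have he : π * n + β + s = (β + s) + n * π := by ring
      rw [he, norm_boundaryOp_add_nat_mul_pi]
      exact hD s hs x
    · rw [← div_le_iff₀ ht]
      linarith
  have hcos : ∀ β, Real.cos (π * n + β) ^ 2 = Real.cos β ^ 2 := fun β =>
    cos_sq_eq_cos_sq_iff.mpr ⟨n, Or.inl (by push_cast; ring)⟩
  refine ⟨?_, ?_, ?_, fun i => ⟨?_, ?_⟩⟩
  · obtain ⟨w1, w2, w3, w4, w5⟩ := hwin 0 (by linarith) t3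
    rw [add_zero] at w1 w2 w3 w4 w5
    have hsq := Real.sq_sqrt (show 0 ≤ (π * n) ^ 2 + ϖ by positivity)
    obtain ⟨g, d⟩ := isGapFrequency_of_sq ht hR w1 hϖ w2 w3 w4 w5
      (Real.sqrt_nonneg ((π * n) ^ 2 + ϖ)) (by
        rw [hsq, add_sub_cancel_left, abs_of_pos hϖ0])
    have hlt : π * n < √((π * n) ^ 2 + ϖ) := Real.lt_sqrt_of_sq_lt (by linarith)
    have hle := (le_abs_self _).trans d
    -- The period cut is placed exactly at the gap just above `π n`. It satisfies `s ≤ t`, and `t`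
    -- was chosen below all angles and `π / 2`.
    have hfree := h.hasEigenvalueCount_free_Iio hP hQ (s := √((π * n) ^ 2 + ϖ) - π * n)
      (by linarith) (by linarith [t1.2]) (fun i => by linarith [(t2 i).2]) n
    rw [add_sub_cancel] at hfree
    obtain ⟨m, c1, c2⟩ := exists_hasEigenvalueCount_gap hP hQ hd g
    rw [c2.unique hfree, hsq] at c1
    exact c1
  · obtain ⟨w1, w2, w3, w4, w5⟩ := hwin 0 (by linarith) t3
    have := hasEigenvalueCount_window hP hQ hd ht w1 hϖ w2 w3 w4 w5
    rwa [h.finrank_ker_of_cos_sq_eq_one hP hQ (by rw [hcos, Real.cos_zero, one_pow]),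
      add_zero] at this
  · obtain ⟨w1, w2, w3, w4, w5⟩ := hwin (π / 2) (by linarith) t4
    have := hasEigenvalueCount_window hP hQ hd ht w1 hϖ w2 w3 w4 w5
    rwa [h.finrank_ker_of_cos_eq_zero hP hQ ((pow_eq_zero_iff two_ne_zero).mp (by
      rw [hcos, Real.cos_pi_div_two, zero_pow two_ne_zero]))] at this
  · obtain ⟨w1, w2, w3, w4, w5⟩ := hwin (γ i) (by linarith [(hγ i).1]) (tp i)
    have := hasEigenvalueCount_window hP hQ hd ht w1 hϖ w2 w3 w4 w5
    rwa [h.finrank_ker_of_cos_sq_eq hP hQ (hcos (γ i))] at this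
  · obtain ⟨w1, w2, w3, w4, w5⟩ := hwin (-γ i) (by linarith [(hγ i).2]) (tm i)
    have := hasEigenvalueCount_window hP hQ hd ht w1 hϖ w2 w3 w4 w5
    rwa [h.finrank_ker_of_cos_sq_eq hP hQ (i := i) (by rw [hcos, Real.cos_neg]),
      ← sub_eq_add_neg] at this

end IsAngleDecomposition

end Frequencies

theorem mainTheorem2 (N : ℕ) (Tm Tp : COp N) (hTm : IsStarProjection Tm)
    (hTp : IsStarProjection Tp) :
    (∃ (k : ℕ) (γ : Fin k → ℝ) (F : Fin k → Submodule ℂ (CVec N)),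
      IsAngleDecomposition Tm Tp γ F) ∧
    ∀ (k : ℕ) (γ : Fin k → ℝ) (F : Fin k → Submodule ℂ (CVec N)),
      IsAngleDecomposition Tm Tp γ F →
      ∀ R : ℝ, ∃ (n₀ : ℕ) (ϖ : ℝ), 1 ≤ n₀ ∧ 0 ≤ ϖ ∧
        ∀ (a b : COp N) (V : ℝ → COp N),
          IsSelfAdjoint a → a = (1 - Tm) * a * (1 - Tm) → ‖a‖ ≤ R →
          IsSelfAdjoint b → b = (1 - Tp) * b * (1 - Tp) → ‖b‖ ≤ R →
          IntegrableOn V (Icc 0 1) →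
          (∀ᵐ x ∂(volume.restrict (Icc (0 : ℝ) 1)), IsSelfAdjoint (V x)) →
          (∫ x in Icc (0 : ℝ) 1, ‖V x‖) ≤ R →
          ∀ n : ℕ, n₀ ≤ n →
            HasEigenvalueCount Tm Tp a b V (Iio (π ^ 2 * (n : ℝ) ^ 2 + ϖ))
              (n * N + Module.finrank ℂ (spaceNN Tm Tp)) ∧
            HasEigenvalueCount Tm Tp a b V (intervalAround (π ^ 2 * (n : ℝ) ^ 2) ϖ)
              (Module.finrank ℂ (spaceNN Tm Tp) + Module.finrank ℂ (spaceDD Tm Tp)) ∧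
            HasEigenvalueCount Tm Tp a b V (intervalAround (π ^ 2 * ((n : ℝ) + 1 / 2) ^ 2) ϖ)
              (Module.finrank ℂ (spaceND Tm Tp) + Module.finrank ℂ (spaceDN Tm Tp)) ∧
            ∀ i : Fin k,
              Module.finrank ℂ ↥(F i ⊓ opRange Tm) = Module.finrank ℂ ↥(F i ⊓ opRange Tp) ∧
              HasEigenvalueCount Tm Tp a b V (intervalAround ((π * (n : ℝ) + γ i) ^ 2) ϖ)
                (Module.finrank ℂ ↥(F i ⊓ opRange Tm)) ∧
              HasEigenvalueCount Tm Tp a b V (intervalAround ((π * (n : ℝ) - γ i) ^ 2) ϖ)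
                (Module.finrank ℂ ↥(F i ⊓ opRange Tm)) := by
  refine ⟨exists_isAngleDecomposition hTm hTp, fun k γ F h R => ?_⟩
  by_cases hR : 0 ≤ R
  · obtain ⟨n₀, ϖ, hn₀, hϖ, hcount⟩ := h.exists_count hTm hTp hR
    refine ⟨n₀, ϖ, hn₀, hϖ, fun a b V ha ha' han hb hb' hbn hV hVs hVR n hn => ?_⟩
    obtain ⟨h1, h2, h3, h4⟩ := hcount a b V ⟨ha, ha', han, hb, hb', hbn, hV, hVs, hVR⟩ n hn
    have e1 : π ^ 2 * (n : ℝ) ^ 2 = (π * n) ^ 2 := by ring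
    have e2 : π ^ 2 * ((n : ℝ) + 1 / 2) ^ 2 = (π * n + π / 2) ^ 2 := by ring
    rw [e1, e2]
    exact ⟨h1, h2, h3, fun i => ⟨(h.angle i).finrank_eq, h4 i⟩⟩
  -- For negative `R` no data satisfy `‖a‖ ≤ R`, so any constants will do.
  · exact ⟨1, 0, le_rfl, le_rfl, fun a b V _ _ han =>
      absurd ((norm_nonneg a).trans han) hR⟩
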